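/- Let $\mathbb{F}_q$ be a finite field with $q$ elements. For $n\ge 0$ let $C_n(q)$ be the complex vector space of functions $f\colon\mathfrak{gl}_n(\mathbb{F}_q)\to\mathbb{C}$ that are invariant under conjugation by $\mathrm{GL}_n(\mathbb{F}_q)$ (so $C_0(q)=\mathbb{C}$), with the hermitian form $(f,g)=\frac{1}{|\mathrm{GL}_n(\mathbb{F}_q)|}\sum_{x}f(x)\overline{g(x)}$, and let $C(q)=\bigoplus_{n\ge 0}C_n(q)$. For $k+l=n$ let $P\subseteq \mathrm{GL}_n(\mathbb{F}_q)$ and $\mathcal{P}\subseteq\mathfrak{gl}_n(\mathbb{F}_q)$ be the block upper triangular matrices with diagonal blocks of sizes $k,l$, let $U\subseteq P$ be the subgroup of those whose diagonal blocks are the identity, $\mathcal{U}=\{u-1: u\in U\}$, and let $\pi\colon\mathcal{P}\to\mathfrak{gl}_k(\mathbb{F}_q)\times\mathfrak{gl}_l(\mathbb{F}_q)$ be the projection to the diagonal blocks. Identify $C_k(q)\otimes C_l(q)$ with the space of invariant functions on $\mathfrak{gl}_k(\mathbb{F}_q)\times\mathfrak{gl}_l(\mathbb{F}_q)$. Define on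 $C(q)$ the multiplication $m$ whose $(k,l)$ component is $$R_{k,l}^n(f)(x)=\frac{1}{|P|}\sum_{g\in \mathrm{GL}_n(\mathbb{F}_q),\ gxg^{-1}\in\mathcal{P}}f(\pi(gxg^{-1})),$$ and the comultiplication $m^*$, which on $C_n(q)$ is the sum over $k+l=n$ of $${}^*R_{k,l}^n(f)(x,y)=\frac{1}{|U|}\sum_{u\in\mathcal{U}}f\bigl(\mathrm{diag}(x,y)+u\bigr);$$ the unit and counit are the embedding of, and the projection onto, $C_0(q)=\mathbb{C}$. An invariant character of $\mathfrak{gl}_n(\mathbb{F}_q)$ is a complex character of its additive group that lies in $C_n(q)$; it is irreducible if it is non-zero and not the sum of two non-zero invariant characters. Let $\Omega(q)$ be the set of all $\chi/\sqrt{(\chi,\chi)}$, where $\chi$ runs over the irreducible invariant characters of all the $\mathfrak{gl}_n(\mathbb{F}_q)$, $n\ge 0$, and let $\mathfrak{C}(q)=\mathbb{R}[\Omega(q)]\subseteq C(q)$ be its real span, graded by the degrees of the elements of $\Omega(q)$. For $K=\mathbb{R}$ or $K=\mathbb{Z}$, a PSH algebra over $K$ (a real PSH algebra if $K=\mathbb{R}$)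 is a pair $(H,\Omega)$ consisting of a connected graded Hopf algebra $H=\bigoplus_{n\ge 0}H_n$ over $K$ and a $K$-basis $\Omega$ of homogeneous elements such that (P) unit, counit, multiplication and comultiplication take linear combinations with non-negative coefficients of the standard bases ($\{1\}$ of $K$, $\Omega$ of $H$, $\Omega\otimes\Omega$ of $H\otimes H$) to such combinations, and (S) unit and counit are mutually adjoint, and multiplication and comultiplication are mutually adjoint, for the bilinear forms making these bases orthonormal. A real PSH algebra $(H,\Omega)$ is descending if there are a PSH algebra $(A,\Psi)$ over $\mathbb{Z}$ and an isomorphism of graded Hopf algebras $\iota\colon \mathbb{R}\otimes_{\mathbb{Z}}A\to H$ with $\iota(1\otimes\Psi)=\Omega$, and non-descending otherwise. **Theorem.** The operations of $C(q)$ restrict to $\mathfrak{C}(q)$, and with them $(\mathfrak{C}(q),\Omega(q))$ is a non-descending real PSH algebra. Moreover, the elements $f=\sqrt{\frac{q-1}{q}}\cdot 1_{\mathfrak{gl}_1(\mathbb{F}_q)}$ and $h=\sqrt{\frac{q(q-1)^2(q+1)}{q^4}}\cdot 1_{\mathfrak{gl}_2(\mathbb{F}_q)}$ (multiples of trivial characters)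 belong to $\Omega(q)$, the coefficient of $h$ in the expansion of $m(f\otimes f)$ in the basis $\Omega(q)$ is $\sqrt{\frac{q+1}{q}}$, and this number is irrational. -/

import Mathlib

open scoped TensorProduct DirectSum

universe u

/-! ## Connected graded Hopf algebras and PSH algebras over an ordered ring -/

section PSH

/-- The Hopf algebra `H` over `R`, with the family of submodules `𝒜`, is a connected graded Hopf
algebra: `H` is the direct sum of the `𝒜 n`, the (co)multiplication and (co)unit are homogeneous
of degree `0`, and the unit identifies `R` with `𝒜 0` (the unit is injective because the counit
is a retraction of it). The antipode is then automatically homogeneous. -/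
structure IsConnectedGradedHopf (R : Type*) [CommRing R] {H : Type*} [Ring H] [HopfAlgebra R H]
    (𝒜 : ℕ → Submodule R H) : Prop where
  isInternal : DirectSum.IsInternal 𝒜
  one_mem : (1 : H) ∈ 𝒜 0
  mul_mem : ∀ (k l : ℕ) (x y : H), x ∈ 𝒜 k → y ∈ 𝒜 l → x * y ∈ 𝒜 (k + l)
  comul_mem : ∀ (n : ℕ) (x : H), x ∈ 𝒜 n → Coalgebra.comul (R := R) x ∈
    ⨆ p ∈ Finset.HasAntidiagonal.antidiagonal n,
      LinearMap.range (TensorProduct.map (𝒜 p.1).subtype (𝒜 p.2).subtype)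
  counit_eq_zero : ∀ (n : ℕ) (x : H), 0 < n → x ∈ 𝒜 n → Coalgebra.counit (R := R) x = 0
  connected : ∀ x ∈ 𝒜 0, ∃ r : R, algebraMap R H r = x

open Classical in
/-- The bilinear form on a free module for which the given basis is orthonormal. -/
noncomputable def basisForm {R M ι : Type*} [CommRing R] [AddCommGroup M] [Module R M]
    (b : Module.Basis ι R M) : LinearMap.BilinForm R M := b.toDual

/-- The set `R≥0[Ω]` of linear combinations, with nonnegative coefficients, of a family. -/
def nonnegSpan (R : Type*) [CommRing R] [PartialOrder R] [IsOrderedRing R] {M ι : Type*}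
    [AddCommGroup M] [Module R M] (b : ι → M) : PointedCone R M :=
  Submodule.span {c : R // 0 ≤ c} (Set.range b)

/-- A PSH algebra over an ordered commutative ring `R`, given by a Hopf algebra `H`, a grading `𝒜`
and a basis `Ω` of `H`. For `R = ℝ` this is the notion of a real PSH algebra, and for `R = ℤ` it
is the notion of a PSH algebra in the sense of Zelevinsky. -/
structure IsPSHAlgebra (R : Type*) [CommRing R] [PartialOrder R] [IsOrderedRing R]
    {H ι : Type*} [Ring H] [HopfAlgebra R H] (𝒜 : ℕ → Submodule R H)
    (Ω : Module.Basis ι R H) : Prop where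
  isConnectedGradedHopf : IsConnectedGradedHopf R 𝒜
  homogeneous : ∀ i, ∃ n, Ω i ∈ 𝒜 n
  unit_nonneg : ∀ r : R, 0 ≤ r → algebraMap R H r ∈ nonnegSpan R Ω
  counit_nonneg : ∀ x ∈ nonnegSpan R Ω, 0 ≤ Coalgebra.counit (R := R) x
  mul_nonneg : ∀ t ∈ nonnegSpan R (Ω.tensorProduct Ω), LinearMap.mul' R H t ∈ nonnegSpan R Ω
  comul_nonneg : ∀ x ∈ nonnegSpan R Ω,
    Coalgebra.comul (R := R) x ∈ nonnegSpan R (Ω.tensorProduct Ω)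
  unit_adjoint : ∀ (r : R) (x : H),
    basisForm Ω (algebraMap R H r) x = r * Coalgebra.counit (R := R) x
  mul_adjoint : ∀ (t : H ⊗[R] H) (x : H),
    basisForm Ω (LinearMap.mul' R H t) x =
      basisForm (Ω.tensorProduct Ω) t (Coalgebra.comul (R := R) x)

/-- There is an isomorphism of graded Hopf algebras from the base change to `S` of the graded Hopf
algebra `(A, ℬ)` over `R` to the graded Hopf algebra `(H, 𝒜)` over `S`, carrying the set of the
elements of the basis `Ψ` of `A` onto the set of the elements of the basis `Ω` of `H`. -/
def IsBaseChangeOf (R S : Type*) [CommRing R] [CommRing S] [Algebra R S]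
    {A κ : Type*} [Ring A] [HopfAlgebra R A] (ℬ : ℕ → Submodule R A) (Ψ : Module.Basis κ R A)
    {H ι : Type*} [Ring H] [HopfAlgebra S H] (𝒜 : ℕ → Submodule S H)
    (Ω : Module.Basis ι S H) : Prop :=
  ∃ f : (S ⊗[R] A) ≃ₐc[S] H,
    (∀ (n : ℕ) (t : S ⊗[R] A), t ∈ (ℬ n).baseChange S ↔ f t ∈ 𝒜 n) ∧
    Set.range (fun k => f ((1 : S) ⊗ₜ[R] Ψ k)) = Set.range Ω

/-- `(H, 𝒜, Ω)` over `S` is, up to isomorphism, the base change of a PSH algebra over `R`. -/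
def IsDefinedOver (R S : Type*) [CommRing R] [PartialOrder R] [IsOrderedRing R] [CommRing S]
    [Algebra R S] {H ι : Type u} [Ring H] [HopfAlgebra S H] (𝒜 : ℕ → Submodule S H)
    (Ω : Module.Basis ι S H) : Prop :=
  ∃ (A : Type u) (_ : Ring A) (_ : HopfAlgebra R A) (ℬ : ℕ → Submodule R A) (κ : Type u)
    (Ψ : Module.Basis κ R A), IsPSHAlgebra R ℬ Ψ ∧ IsBaseChangeOf R S ℬ Ψ 𝒜 Ω

/-- A real PSH algebra is descending if it is the base change of a PSH algebra over `ℤ`. -/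
def IsDescending {H ι : Type u} [Ring H] [HopfAlgebra ℝ H]
    (𝒜 : ℕ → Submodule ℝ H) (Ω : Module.Basis ι ℝ H) : Prop :=
  IsDefinedOver ℤ ℝ 𝒜 Ω

end PSH

/-! ## Invariant functions on `gl_n(F_q)` -/

namespace InvFun

/-- `gl_n(F)`. -/
abbrev gl (F : Type u) (n : ℕ) : Type u := Matrix (Fin n) (Fin n) F

/-- `GL_n(F)`. -/
abbrev G (F : Type u) [Field F] (n : ℕ) : Type u := Matrix.GeneralLinearGroup (Fin n) F

/-- The adjoint action of `GL_n(F)` on `gl_n(F)`. -/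
def ad {F : Type u} [Field F] {n : ℕ} (g : G F n) (x : gl F n) : gl F n :=
  (g : gl F n) * x * ((g⁻¹ : G F n) : gl F n)

theorem ad_mul {F : Type u} [Field F] {n : ℕ} (g h : G F n) (x : gl F n) :
    ad (g * h) x = ad g (ad h x) := by
  simp [ad, mul_assoc]

/-- `C_n(q)`: the complex invariant functions on `gl_n(F)`. -/
def C (F : Type u) [Field F] (n : ℕ) : Submodule ℂ (gl F n → ℂ) where
  carrier := {f | ∀ (g : G F n) (x : gl F n), f (ad g x) = f x}
  add_mem' {a b} ha hb g x := by simp [ha g x, hb g x]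
  zero_mem' g x := rfl
  smul_mem' c a ha g x := by simp [ha g x]

/-- The complex invariant functions on `gl_k(F) × gl_l(F)`, for the action of
`GL_k(F) × GL_l(F)`. -/
def C₂ (F : Type u) [Field F] (k l : ℕ) : Submodule ℂ (gl F k × gl F l → ℂ) where
  carrier := {f | ∀ (g : G F k) (h : G F l) (x : gl F k) (y : gl F l),
    f (ad g x, ad h y) = f (x, y)}
  add_mem' {a b} ha hb g h x y := by simp [ha g h x y, hb g h x y]
  zero_mem' g h x y := rfl
  smul_mem' c a ha g h x y := by simp [ha g h x y]

/-- The graded space `C(q)`. -/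
abbrev CC (F : Type u) [Field F] : Type u := ⨁ n : ℕ, C F n

/-- A function on `gl_n(F)` in degree `n` of `C(q)`. -/
noncomputable abbrev inDeg (F : Type u) [Field F] (n : ℕ) : C F n →ₗ[ℂ] CC F :=
  DirectSum.lof ℂ ℕ (fun n => C F n) n

/-- The constant function `1`, that is, the trivial character of `gl_n(F)`. -/
def one (F : Type u) [Field F] (n : ℕ) : C F n := ⟨fun _ => 1, fun _ _ => rfl⟩

/-- The exterior product `f ⊠ g`. -/
def boxTimes (F : Type u) [Field F] (k l : ℕ) : C F k ⊗[ℂ] C F l →ₗ[ℂ] C₂ F k l :=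
  TensorProduct.lift (LinearMap.mk₂ ℂ
    (fun a b => ⟨fun p => a.1 p.1 * b.1 p.2, fun g h x y => by
      have h1 := a.2 g x
      have h2 := b.2 h y
      simp only [h1, h2]⟩)
    (fun _ _ _ => by ext; simp [add_mul]) (fun _ _ _ => by ext; simp [mul_assoc])
    (fun _ _ _ => by ext; simp [mul_add]) (fun _ _ _ => by ext; simp [mul_left_comm]))

theorem boxTimes_tmul (F : Type u) [Field F] (k l : ℕ) (a : C F k) (b : C F l) (x : gl F k) (y : gl F l) :
    (boxTimes F k l (a ⊗ₜ b)).1 (x, y) = a.1 x * b.1 y := rfl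

section Box

variable (F : Type u) [Field F] [Fintype F] [DecidableEq F]

/-- The average, over the conjugation action, of the indicator function of `x`. -/
noncomputable def avg (n : ℕ) (x : gl F n) : C F n :=
  ⟨fun y => (Fintype.card (G F n) : ℂ)⁻¹ * ∑ g : G F n, if ad g y = x then 1 else 0, by
    intro h y
    simp only [← ad_mul]
    congr 1
    exact Fintype.sum_equiv (Equiv.mulRight h) _ _ (fun g => rfl)⟩

theorem sum_avg (n : ℕ) (a : C F n) : ∑ x : gl F n, a.1 x • avg F n x = a := by
  ext y
  have h : ∀ g : G F n, a.1 (ad g y) = a.1 y := fun g => a.2 g y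
  have hc : (Fintype.card (G F n) : ℂ) ≠ 0 := Nat.cast_ne_zero.2 Fintype.card_ne_zero
  have e : (∑ x : gl F n, a.1 x • avg F n x : C F n).1 y =
      ∑ x : gl F n, a.1 x * ((Fintype.card (G F n) : ℂ)⁻¹ *
        ∑ g : G F n, if ad g y = x then 1 else 0) := by
    simp [avg]
  rw [e]
  calc _ = (Fintype.card (G F n) : ℂ)⁻¹ *
        ∑ g : G F n, ∑ x : gl F n, if ad g y = x then a.1 x else 0 := by
        rw [Finset.sum_comm, Finset.mul_sum]
        refine Finset.sum_congr rfl fun x _ => ?_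
        rw [mul_left_comm, Finset.mul_sum]
        simp
    _ = a.1 y := by
        simp only [Finset.sum_ite_eq, Finset.mem_univ, if_true, h]
        simp [hc]

/-- The isomorphism `C(gl_k) ⊗ C(gl_l) ≅ C(gl_k × gl_l)`, `f ⊗ g ↦ f ⊠ g`. -/
noncomputable def boxEquiv (k l : ℕ) : C F k ⊗[ℂ] C F l ≃ₗ[ℂ] C₂ F k l :=
  LinearEquiv.ofLinearMap (boxTimes F k l)
    { toFun := fun f => ∑ x : gl F k, ∑ y : gl F l, f.1 (x, y) • (avg F k x ⊗ₜ avg F l y)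
      map_add' := fun f g => by simp [add_smul, Finset.sum_add_distrib]
      map_smul' := fun c f => by simp [mul_smul, Finset.smul_sum] }
    (by
      ext f ⟨x, y⟩
      have e : (boxTimes F k l (∑ x' : gl F k, ∑ y' : gl F l,
          f.1 (x', y') • (avg F k x' ⊗ₜ avg F l y'))).1 (x, y) =
          ∑ x' : gl F k, ∑ y' : gl F l,
            f.1 (x', y') * ((avg F k x').1 x * (avg F l y').1 y) := by
        simp [map_sum, boxTimes_tmul]
      refine e.trans ?_
      have h1 : ∀ x' : gl F k, ∑ y' : gl F l, f.1 (x', y') * (avg F l y').1 y = f.1 (x', y) := by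
        intro x'
        have := congrArg (fun c : C F l => c.1 y) (sum_avg F l ⟨fun y' => f.1 (x', y'), fun g z => by
          simpa [ad] using f.2 1 g x' z⟩)
        simpa using this
      have h2 : ∑ x' : gl F k, f.1 (x', y) * (avg F k x').1 x = f.1 (x, y) := by
        have := congrArg (fun c : C F k => c.1 x) (sum_avg F k ⟨fun x' => f.1 (x', y), fun g z => by
          simpa [ad] using f.2 g 1 z y⟩)
        simpa using this
      change _ = f.1 (x, y)
      rw [← h2]
      refine Finset.sum_congr rfl fun x' _ => ?_
      rw [← h1 x', Finset.sum_mul]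
      exact Finset.sum_congr rfl fun y' _ => by ring)
    (by
      refine TensorProduct.ext' fun a b => ?_
      change ∑ x : gl F k, ∑ y : gl F l, (a.1 x * b.1 y) • (avg F k x ⊗ₜ[ℂ] avg F l y) = a ⊗ₜ b
      conv_rhs => rw [← sum_avg F k a, ← sum_avg F l b]
      rw [TensorProduct.sum_tmul]
      refine Finset.sum_congr rfl fun x _ => ?_
      rw [TensorProduct.tmul_sum]
      refine Finset.sum_congr rfl fun y _ => ?_
      rw [TensorProduct.smul_tmul_smul])

end Box

/-! ### Harish-Chandra induction and restriction for `gl_k × gl_l ⊆ gl_n`, `k + l = n` -/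

section HarishChandra

variable {F : Type u} [Field F]

/-- An `n × n` matrix, `n = k + l`, seen as a `2 × 2` block matrix. -/
def toBlock {k l n : ℕ} (h : k + l = n) :
    gl F n ≃ Matrix (Fin k ⊕ Fin l) (Fin k ⊕ Fin l) F :=
  (Matrix.reindex (finSumFinEquiv.trans (finCongr h)) (finSumFinEquiv.trans (finCongr h))).symm

/-- The block upper triangular matrices (the standard parabolic subalgebra, and its parabolic
subgroup when applied to invertible matrices). -/
def IsParabolic {k l n : ℕ} (h : k + l = n) (x : gl F n) : Prop :=
  (toBlock h x).toBlocks₂₁ = 0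

instance [DecidableEq F] {k l n : ℕ} (h : k + l = n) (x : gl F n) :
    Decidable (IsParabolic h x) :=
  inferInstanceAs (Decidable ((toBlock h x).toBlocks₂₁ = 0))

/-- The projection to the block diagonal Levi subalgebra `gl_k × gl_l`. -/
def leviProj {k l n : ℕ} (h : k + l = n) (x : gl F n) : gl F k × gl F l :=
  ((toBlock h x).toBlocks₁₁, (toBlock h x).toBlocks₂₂)

/-- The matrix with diagonal blocks `x`, `y`, upper right block `u` and lower left block `0`. -/
def ofBlocks {k l n : ℕ} (h : k + l = n) (x : gl F k) (u : Matrix (Fin k) (Fin l) F)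
    (y : gl F l) : gl F n :=
  (toBlock h).symm (Matrix.fromBlocks x u 0 y)

theorem ofBlocks_mul {k l n : ℕ} (h : k + l = n) (x x' : gl F k) (u u' : Matrix (Fin k) (Fin l) F)
    (y y' : gl F l) : ofBlocks h x u y * ofBlocks h x' u' y' =
      ofBlocks h (x * x') (x * u' + u * y') (y * y') := by
  simp only [ofBlocks, toBlock, Equiv.symm_symm, Matrix.reindex_apply]
  rw [Matrix.submatrix_mul_equiv, Matrix.fromBlocks_multiply]
  simp

theorem ofBlocks_one {k l n : ℕ} (h : k + l = n) :
    ofBlocks h (1 : gl F k) 0 (1 : gl F l) = 1 := by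
  simp only [ofBlocks, toBlock, Equiv.symm_symm, Matrix.reindex_apply, Matrix.fromBlocks_one]
  exact Matrix.submatrix_one_equiv _

/-- The block diagonal element of `GL_n` with diagonal blocks `a` and `d`. -/
def leviElt {k l n : ℕ} (h : k + l = n) (a : G F k) (d : G F l) : G F n where
  val := ofBlocks h (a : gl F k) 0 (d : gl F l)
  inv := ofBlocks h ((a⁻¹ : G F k) : gl F k) 0 ((d⁻¹ : G F l) : gl F l)
  val_inv := by rw [ofBlocks_mul, ← ofBlocks_one h]; simp
  inv_val := by rw [ofBlocks_mul, ← ofBlocks_one h]; simp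

theorem ad_leviElt {k l n : ℕ} (h : k + l = n) (a : G F k) (d : G F l) (x : gl F k)
    (u : Matrix (Fin k) (Fin l) F) (y : gl F l) :
    ad (leviElt h a d) (ofBlocks h x u y) =
      ofBlocks h (ad a x) ((a : gl F k) * u * ((d⁻¹ : G F l) : gl F l)) (ad d y) := by
  change ofBlocks h _ _ _ * ofBlocks h _ _ _ * ofBlocks h _ _ _ = _
  simp [ofBlocks_mul, ad]

variable [Fintype F] [DecidableEq F]

/-- Harish-Chandra induction `R_{k,l}^n`:
`R(f)(x) = |P|⁻¹ ∑_{g ∈ GL_n, g x g⁻¹ ∈ 𝒫} f(π(g x g⁻¹))`. -/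
noncomputable def hcInd {k l n : ℕ} (h : k + l = n) : C₂ F k l →ₗ[ℂ] C F n where
  toFun f := ⟨fun x => (Fintype.card {g : G F n // IsParabolic h (g : gl F n)} : ℂ)⁻¹ *
      ∑ g : G F n with IsParabolic h (ad g x), f.1 (leviProj h (ad g x)), by
    intro s x
    simp only [← ad_mul, Finset.sum_filter]
    congr 1
    exact Fintype.sum_equiv (Equiv.mulRight s) _ _ (fun g => rfl)⟩
  map_add' f g := by ext x; simp [Finset.sum_add_distrib, mul_add]
  map_smul' c f := by ext x; simp [← Finset.mul_sum, mul_left_comm]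

/-- Harish-Chandra restriction `*R_{k,l}^n`:
`*R(f)(x, y) = |U|⁻¹ ∑_{u ∈ 𝒰} f((x, y) + u)`; here `𝒰` is the space of `k × l` matrices, and
`|U| = |𝒰|` as `U = 1 + 𝒰`. -/
noncomputable def hcRes {k l n : ℕ} (h : k + l = n) : C F n →ₗ[ℂ] C₂ F k l where
  toFun f := ⟨fun p => (Fintype.card (Matrix (Fin k) (Fin l) F) : ℂ)⁻¹ *
      ∑ u : Matrix (Fin k) (Fin l) F, f.1 (ofBlocks h p.1 u p.2), by
    intro a d x y
    dsimp only
    congr 1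
    let e : Matrix (Fin k) (Fin l) F ≃ Matrix (Fin k) (Fin l) F :=
      { toFun := fun u => (a : gl F k) * u * ((d⁻¹ : G F l) : gl F l)
        invFun := fun u => ((a⁻¹ : G F k) : gl F k) * u * (d : gl F l)
        left_inv := fun u => by
          have h1 : ((a⁻¹ : G F k) : gl F k) * (a : gl F k) = 1 := a.inv_val
          have h2 : ((d⁻¹ : G F l) : gl F l) * (d : gl F l) = 1 := d.inv_val
          simp only [Matrix.mul_assoc, h2, Matrix.mul_one]
          rw [← Matrix.mul_assoc, h1, Matrix.one_mul]
        right_inv := fun u => by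
          have h1 : (a : gl F k) * ((a⁻¹ : G F k) : gl F k) = 1 := a.val_inv
          have h2 : (d : gl F l) * ((d⁻¹ : G F l) : gl F l) = 1 := d.val_inv
          simp only [Matrix.mul_assoc, h2, Matrix.mul_one]
          rw [← Matrix.mul_assoc, h1, Matrix.one_mul] }
    refine (Fintype.sum_equiv e _ _ fun u => ?_).symm
    have := f.2 (leviElt h a d) (ofBlocks h x u y)
    rw [ad_leviElt] at this
    exact this.symm⟩
  map_add' f g := by ext x; simp [Finset.sum_add_distrib, mul_add]
  map_smul' c f := by ext x; simp [← Finset.mul_sum, mul_left_comm]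

end HarishChandra

/-! ### The operations on `C(q)` -/

section Operations

variable (F : Type u) [Field F] [Fintype F] [DecidableEq F]

/-- The multiplication `m`, the sum of the `R_{k,l}^{k+l}`. -/
noncomputable def mul : CC F →ₗ[ℂ] CC F →ₗ[ℂ] CC F :=
  DirectSum.toModule ℂ ℕ _ fun k => LinearMap.flip <| DirectSum.toModule ℂ ℕ _ fun l =>
    LinearMap.flip <| TensorProduct.curry <|
      inDeg F (k + l) ∘ₗ hcInd rfl ∘ₗ (boxEquiv F k l).toLinearMap

/-- The comultiplication `m^*`, given on `C_n(q)` as the sum of the `*R_{k,l}^n`, `k + l = n`. -/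
noncomputable def comul : CC F →ₗ[ℂ] CC F ⊗[ℂ] CC F :=
  DirectSum.toModule ℂ ℕ _ fun n => ∑ p : {p // p ∈ Finset.HasAntidiagonal.antidiagonal n},
    TensorProduct.map (inDeg F p.1.1) (inDeg F p.1.2) ∘ₗ
      (boxEquiv F p.1.1 p.1.2).symm.toLinearMap ∘ₗ hcRes (Finset.HasAntidiagonal.mem_antidiagonal.1 p.2)

/-- The image of `1` under the unit `ℂ = C_0(q) → C(q)`. -/
noncomputable def unit : CC F := inDeg F 0 (one F 0)

/-- The counit `C(q) → C_0(q) = ℂ`. -/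
noncomputable def counit : CC F →ₗ[ℂ] ℂ :=
  LinearMap.proj (0 : gl F 0) ∘ₗ (C F 0).subtype ∘ₗ DirectSum.component ℂ ℕ (fun n => C F n) 0

end Operations

/-! ### Invariant characters and the lattice `𝔠(q)` -/

section Characters

variable {F : Type u} [Field F]

/-- An invariant function is an invariant character if it is the character of a
(finite-dimensional, complex) representation of the additive group `gl_n(F)`. -/
def IsInvChar {n : ℕ} (f : C F n) : Prop :=
  ∃ (d : ℕ) (ρ : Representation ℂ (Multiplicative (gl F n)) (Fin d → ℂ)),
    ∀ x : gl F n, f.1 x = ρ.character (Multiplicative.ofAdd x)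

/-- An irreducible invariant character: a non-zero invariant character that is not a sum of two
non-zero invariant characters. -/
def IsIrrInvChar {n : ℕ} (f : C F n) : Prop :=
  IsInvChar f ∧ f ≠ 0 ∧
    ∀ g h : C F n, IsInvChar g → IsInvChar h → f = g + h → g = 0 ∨ h = 0

end Characters

section Lattice

variable (F : Type u) [Field F] [Fintype F] [DecidableEq F]

/-- The hermitian form `(f, g) = |GL_n|⁻¹ ∑_x f(x) conj(g(x))`. -/
noncomputable def herm {n : ℕ} (f g : C F n) : ℂ :=
  (Fintype.card (G F n) : ℂ)⁻¹ * ∑ x : gl F n, f.1 x * (starRingEnd ℂ) (g.1 x)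

/-- The degree `n` part of `Ω(q)`: the irreducible invariant characters of `gl_n(F)`, divided by
their norm. -/
noncomputable def OmegaDeg (n : ℕ) : Set (CC F) :=
  {w | ∃ χ : C F n, IsIrrInvChar χ ∧ w = inDeg F n ((((√(herm F χ χ).re)⁻¹ : ℝ) : ℂ) • χ)}

/-- `Ω(q)`. -/
noncomputable def Omega : Set (CC F) := ⋃ n, OmegaDeg F n

/-- The degree `n` part of `𝔠(q)`. -/
noncomputable def realSpanDeg (n : ℕ) : Submodule ℝ (CC F) := Submodule.span ℝ (OmegaDeg F n)

/-- `𝔠(q)`, the real span of `Ω(q)`. -/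
noncomputable def realSpan : Submodule ℝ (CC F) := Submodule.span ℝ (Omega F)

/-- The map `H ⊗_ℝ H → C(q) ⊗_ℂ C(q)` induced by a real linear map `H → C(q)`. -/
noncomputable def tensorIncl {H : Type*} [AddCommGroup H] [Module ℝ H] (j : H →ₗ[ℝ] CC F) :
    H ⊗[ℝ] H →ₗ[ℝ] CC F ⊗[ℂ] CC F :=
  (TensorProduct.mapOfCompatibleSMul ℂ ℝ ℝ (CC F) (CC F)).restrictScalars ℝ ∘ₗ
    TensorProduct.map j j

/-- The Hopf algebra `H` over `ℝ` is the space `𝔠(q) ⊆ C(q)`, embedded by `j`, with the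
restrictions of the operations of `C(q)`. -/
structure IsRestriction {H : Type*} [Ring H] [HopfAlgebra ℝ H] (j : H →ₗ[ℝ] CC F) : Prop where
  injective : Function.Injective j
  range_eq : LinearMap.range j = realSpan F
  map_mul : ∀ x y : H, j (x * y) = mul F (j x) (j y)
  map_one : j 1 = unit F
  map_comul : ∀ x : H, tensorIncl F j (Coalgebra.comul (R := ℝ) x) = comul F (j x)
  map_counit : ∀ x : H, ((Coalgebra.counit (R := ℝ) x : ℝ) : ℂ) = counit F (j x)

end Lattice

end InvFun

/-! An element of `C(q)` is a function on isomorphism classes of pairs `(V, x)`, with `x` an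
endomorphism of a finite-dimensional space. In this language the multiplication is a Hall product:
the value of `m(a ⊗ b)` at `(V, x)` is the sum of `a(x|W) b(x|V/W)` over the `x`-stable subspaces
`W` (`evalEnd_mul`). The value of `m^*(a)` at a pair `(x, y)` is the average of `a` over the block
triangular endomorphisms with diagonal blocks `x`, `y` (`evalEnd₂_comul`). Associativity is then a
sum over stable flags (`mul_assoc'`).

Multiplicativity of `m^*` is the Mackey formula `evalEnd₂_comul_mul`. A subspace of `V × V'` is a
shear of a product `W × W'`. The number of subspaces belonging to `(W, W')` exactly cancels the
normalisation of the averages over extensions, so no power of `q` remains as a twist.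

By Fourier analysis on the finite abelian group `gl_n`, the irreducible invariant characters are the
sums over the `GL_n`-orbits of additive characters (`isIrrInvChar_iff`). Hence `Ω(q)` is an
orthonormal basis of `C(q)`. Harish-Chandra induction preserves nonnegativity of Fourier
coefficients (`isPos_hcInd`) and is adjoint to restriction (`herm_hcInd`). So multiplication and
comultiplication have the same structure constants with respect to `Ω(q)`, and these are nonnegative
reals. Therefore both operations restrict to the real span, coassociativity and the counit laws are
dual to the ring axioms (`coalgebraOfAdjoint`), and the antipode comes from connectedness.

For a descending algebra all structure constants would be integers
(`repr_mul_mem_range_of_isBaseChangeOf`). But restriction sends the constant function 1 to `1 ⊠ 1`,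
so by adjointness the coefficient of `h` in `f²` is determined by the norms of trivial characters.
It equals `√((q+1)/q)`, irrational because `q(q+1)` lies strictly between consecutive squares. -/

set_option linter.unusedSectionVars false

namespace InvFun

/-! ### Elements of `C(q)` as functions on pairs `(V, x)`; the terms of the Hall product -/

section Evaluation

variable {F : Type u} [Field F]

/-- A change of basis conjugates the matrix by an element of `GL_n`. This makes evaluation at an
abstract endomorphism independent of the basis used. -/
theorem apply_toMatrix_eq {V : Type*} [AddCommGroup V] [Module F V] {n : ℕ} (a : C F n)
    (b b' : Module.Basis (Fin n) F V) (x : Module.End F V) :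
    a.1 (LinearMap.toMatrix b b x) = a.1 (LinearMap.toMatrix b' b' x) := by
  let g : G F n :=
    { val := b.toMatrix b'
      inv := b'.toMatrix b
      val_inv := b.toMatrix_mul_toMatrix_flip b'
      inv_val := b'.toMatrix_mul_toMatrix_flip b }
  have h := a.2 g (LinearMap.toMatrix b' b' x)
  have e : ad g (LinearMap.toMatrix b' b' x) = LinearMap.toMatrix b b x :=
    basis_toMatrix_mul_linearMap_toMatrix_mul_basis_toMatrix b b' b b' x
  rw [← h, e]

/-- The value of an element of `C(q)` at an endomorphism of a finite-dimensional space. -/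
noncomputable def evalEnd {V : Type*} [AddCommGroup V] [Module F V] [Module.Finite F V]
    (x : Module.End F V) : CC F →ₗ[ℂ] ℂ :=
  LinearMap.proj (LinearMap.toMatrix (Module.finBasis F V) (Module.finBasis F V) x) ∘ₗ
    (C F (Module.finrank F V)).subtype ∘ₗ
      DirectSum.component ℂ ℕ (fun n => C F n) (Module.finrank F V)

theorem evalEnd_eq_of_basis {V : Type*} [AddCommGroup V] [Module F V] [Module.Finite F V]
    {n : ℕ} (b : Module.Basis (Fin n) F V) (x : Module.End F V) (a : CC F) :
    evalEnd x a = (a n).1 (LinearMap.toMatrix b b x) := by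
  obtain rfl : Module.finrank F V = n := (Module.finrank_eq_card_basis b).trans (Fintype.card_fin n)
  exact apply_toMatrix_eq _ _ _ _

theorem evalEnd_congr {V V' : Type*} [AddCommGroup V] [Module F V] [Module.Finite F V]
    [AddCommGroup V'] [Module F V'] [Module.Finite F V'] (e : V ≃ₗ[F] V') {x : Module.End F V}
    {y : Module.End F V'} (h : ∀ v, e (x v) = y (e v)) (a : CC F) :
    evalEnd x a = evalEnd y a := by
  rw [evalEnd_eq_of_basis (Module.finBasis F V), evalEnd_eq_of_basis ((Module.finBasis F V).map e)]
  refine congrArg _ (Matrix.ext fun i j => ?_)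
  simp [LinearMap.toMatrix_apply, ← h]

theorem evalEnd_toLin' {n : ℕ} (x : gl F n) (a : CC F) :
    evalEnd (Matrix.toLin' x) a = (a n).1 x := by
  rw [evalEnd_eq_of_basis (Pi.basisFun F (Fin n))]
  exact congrArg _ (LinearMap.toMatrix'_toLin' x)

theorem evalEnd_eq_zero {V : Type*} [AddCommGroup V] [Module F V] [Module.Finite F V] {n : ℕ}
    (h : Module.finrank F V ≠ n) (x : Module.End F V) (a : C F n) :
    evalEnd x (inDeg F n a) = 0 := by
  have : (inDeg F n a) (Module.finrank F V) = 0 :=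
    DirectSum.of_eq_of_ne (β := fun n => C F n) _ _ _ h
  rw [evalEnd_eq_of_basis (Module.finBasis F V), this]
  rfl

theorem evalEnd_toLin'_inDeg {n : ℕ} (x : gl F n) (a : C F n) :
    evalEnd (Matrix.toLin' x) (inDeg F n a) = a.1 x := by
  rw [evalEnd_toLin']
  exact congrArg (fun c : C F n => c.1 x) (DirectSum.of_eq_same (β := fun n => C F n) _ _)

theorem ext_evalEnd {a b : CC F}
    (h : ∀ (n : ℕ) (x : gl F n), evalEnd (Matrix.toLin' x) a = evalEnd (Matrix.toLin' x) b) :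
    a = b := by
  refine DFinsupp.ext fun n => Subtype.ext (funext fun x => ?_)
  simpa only [evalEnd_toLin'] using h n x

open Classical in
/-- The summand of the Hall product of `a` and `b` at `(V, x)` given by the subspace `W`. -/
noncomputable def hallTerm (a b : CC F) {V : Type*} [AddCommGroup V] [Module F V]
    [Module.Finite F V] (x : Module.End F V) (W : Submodule F V) : ℂ :=
  if h : W ≤ W.comap x then evalEnd (x.restrict h) a * evalEnd (W.mapQ W x h) b else 0

theorem hallTerm_of_not_le (a b : CC F) {V : Type*} [AddCommGroup V] [Module F V]
    [Module.Finite F V] {x : Module.End F V} {W : Submodule F V} (h : ¬ W ≤ W.comap x) :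
    hallTerm a b x W = 0 := dif_neg h

/-- Any short exact sequence compatible with the endomorphisms may replace `W → V → V/W`. Later
computations of Hall terms go through this lemma, with models of the subspace and the quotient
chosen to suit. -/
theorem hallTerm_of_exact (a b : CC F) {V Z Y : Type*} [AddCommGroup V] [Module F V]
    [Module.Finite F V] [AddCommGroup Z] [Module F Z] [Module.Finite F Z] [AddCommGroup Y]
    [Module F Y] [Module.Finite F Y] {x : Module.End F V} {z : Module.End F Z}
    {y : Module.End F Y} {W : Submodule F V} (i : Z →ₗ[F] V) (p : V →ₗ[F] Y)
    (hi : Function.Injective i) (hp : Function.Surjective p) (hiW : LinearMap.range i = W)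
    (hpW : LinearMap.ker p = W) (hz : ∀ v, i (z v) = x (i v)) (hy : ∀ v, p (x v) = y (p v)) :
    hallTerm a b x W = evalEnd z a * evalEnd y b := by
  have h : W ≤ W.comap x := by
    subst hiW
    rintro _ ⟨v, rfl⟩
    exact ⟨z v, hz v⟩
  rw [hallTerm, dif_pos h]
  congr 1
  · subst hiW
    refine (evalEnd_congr (LinearEquiv.ofInjective i hi) (fun v => ?_) a).symm
    exact Subtype.ext (hz v)
  · subst hpW
    refine evalEnd_congr (p.quotKerEquivOfSurjective hp) (fun v => ?_) b
    obtain ⟨v, rfl⟩ := Submodule.Quotient.mk_surjective _ v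
    exact hy v

theorem hallTerm_congr (a b : CC F) {V V' : Type*} [AddCommGroup V] [Module F V]
    [Module.Finite F V] [AddCommGroup V'] [Module F V'] [Module.Finite F V']
    {x : Module.End F V} {y : Module.End F V'} (e : V ≃ₗ[F] V') (he : ∀ v, e (x v) = y (e v))
    (W : Submodule F V) : hallTerm a b x W = hallTerm a b y (W.map e.toLinearMap) := by
  by_cases h : W ≤ W.comap x
  · rw [hallTerm, dif_pos h]
    refine (hallTerm_of_exact a b (e.toLinearMap ∘ₗ W.subtype) (W.mkQ ∘ₗ e.symm.toLinearMap)
      (e.injective.comp W.subtype_injective) (W.mkQ_surjective.comp e.symm.surjective) ?_ ?_ ?_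
      ?_).symm
    · rw [LinearMap.range_comp, Submodule.range_subtype]
    · rw [LinearMap.ker_comp, Submodule.ker_mkQ, Submodule.map_equiv_eq_comap_symm]
    · intro v
      exact he v
    · intro v
      obtain ⟨v, rfl⟩ := e.surjective v
      simp [← he]
  · rw [hallTerm_of_not_le a b h, hallTerm_of_not_le]
    intro h'
    refine h fun v hv => ?_
    obtain ⟨w, hw, e1⟩ := h' (Submodule.mem_map_of_mem hv)
    have : w = x v := e.injective (by simpa [he] using e1)
    rw [Submodule.mem_comap, ← this]
    exact hw

theorem hallTerm_inDeg_eq_zero {V : Type*} [AddCommGroup V] [Module F V] [Module.Finite F V]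
    {k : ℕ} (a : C F k) (b : CC F) (x : Module.End F V) {W : Submodule F V}
    (h : Module.finrank F W ≠ k) : hallTerm (inDeg F k a) b x W = 0 := by
  unfold hallTerm
  split
  · rw [evalEnd_eq_zero h, zero_mul]
  · rfl

theorem hallTerm_add_left (a a' b : CC F) {V : Type*} [AddCommGroup V] [Module F V]
    [Module.Finite F V] (x : Module.End F V) (W : Submodule F V) :
    hallTerm (a + a') b x W = hallTerm a b x W + hallTerm a' b x W := by
  unfold hallTerm
  split <;> simp [add_mul]

theorem hallTerm_add_right (a b b' : CC F) {V : Type*} [AddCommGroup V] [Module F V]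
    [Module.Finite F V] (x : Module.End F V) (W : Submodule F V) :
    hallTerm a (b + b') x W = hallTerm a b x W + hallTerm a b' x W := by
  unfold hallTerm
  split <;> simp [mul_add]

end Evaluation

/-! ### Block matrices as stabilisers of a coordinate subspace -/

section Blocks

variable {F : Type u} [Field F]

/-- The splitting `F ^ n ≃ F ^ k × F ^ l` for `k + l = n`. -/
def blockEquiv {k l n : ℕ} (h : k + l = n) : (Fin n → F) ≃ₗ[F] (Fin k → F) × (Fin l → F) :=
  LinearEquiv.funCongrLeft F F (finSumFinEquiv.trans (finCongr h)) ≪≫ₗ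
    LinearEquiv.sumArrowLequivProdArrow (Fin k) (Fin l) F F

theorem blockEquiv_toLin' {k l n : ℕ} (h : k + l = n) (z : gl F n) (v : Fin n → F) :
    blockEquiv h (Matrix.toLin' z v) =
      (Matrix.toLin' (toBlock h z).toBlocks₁₁ (blockEquiv h v).1 +
          Matrix.toLin' (toBlock h z).toBlocks₁₂ (blockEquiv h v).2,
        Matrix.toLin' (toBlock h z).toBlocks₂₁ (blockEquiv h v).1 +
          Matrix.toLin' (toBlock h z).toBlocks₂₂ (blockEquiv h v).2) := by
  set e := finSumFinEquiv.trans (finCongr h)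
  have h1 : (toBlock h z).mulVec (v ∘ e) = (z.mulVec v) ∘ e := by
    change (z.submatrix e e).mulVec (v ∘ e) = _
    rw [Matrix.submatrix_mulVec_equiv]
    congr 2
    ext
    simp
  have h2 : v ∘ e = Sum.elim (blockEquiv h v).1 (blockEquiv h v).2 := by
    ext (i | i) <;> rfl
  rw [h2, ← Matrix.fromBlocks_toBlocks (toBlock h z), Matrix.fromBlocks_mulVec] at h1
  refine Prod.ext (funext fun i => ?_) (funext fun i => ?_)
  · exact (congrFun h1 (Sum.inl i)).symm
  · exact (congrFun h1 (Sum.inr i)).symm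

/-- The span of the first `k` coordinate vectors of `F ^ n`. -/
def firstBlock {k l n : ℕ} (h : k + l = n) : Submodule F (Fin n → F) :=
  LinearMap.ker (LinearMap.snd F _ _ ∘ₗ (blockEquiv (F := F) h).toLinearMap)

theorem mem_firstBlock {k l n : ℕ} (h : k + l = n) (v : Fin n → F) :
    v ∈ firstBlock h ↔ (blockEquiv h v).2 = 0 := Iff.rfl

theorem firstBlock_eq_range {k l n : ℕ} (h : k + l = n) :
    LinearMap.range ((blockEquiv (F := F) h).symm.toLinearMap ∘ₗ LinearMap.inl F _ _) =
      firstBlock h := by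
  ext v
  rw [mem_firstBlock]
  constructor
  · rintro ⟨w, rfl⟩
    simp
  · intro hv
    exact ⟨(blockEquiv h v).1, (blockEquiv h).symm_apply_eq.2 (Prod.ext rfl hv.symm)⟩

theorem isParabolic_iff {k l n : ℕ} (h : k + l = n) (z : gl F n) :
    IsParabolic h z ↔ firstBlock h ≤ (firstBlock h).comap (Matrix.toLin' z) := by
  constructor
  · intro hz v hv
    rw [Submodule.mem_comap, mem_firstBlock, blockEquiv_toLin', (mem_firstBlock h v).1 hv,
      show (toBlock h z).toBlocks₂₁ = 0 from hz]
    simp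
  · intro hz
    refine Matrix.toLin'.injective (LinearMap.ext fun w => ?_)
    have hv : (blockEquiv h).symm (w, 0) ∈ firstBlock (F := F) h := by
      rw [mem_firstBlock, LinearEquiv.apply_symm_apply]
    have := hz hv
    rw [Submodule.mem_comap, mem_firstBlock, blockEquiv_toLin', LinearEquiv.apply_symm_apply] at this
    simpa using this

theorem hallTerm_firstBlock {k l n : ℕ} (h : k + l = n) (a : C F k) (b : C F l) (z : gl F n)
    (hz : IsParabolic h z) :
    hallTerm (inDeg F k a) (inDeg F l b) (Matrix.toLin' z) (firstBlock h) =
      a.1 (leviProj h z).1 * b.1 (leviProj h z).2 := by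
  rw [hallTerm_of_exact (z := Matrix.toLin' (toBlock h z).toBlocks₁₁)
    (y := Matrix.toLin' (toBlock h z).toBlocks₂₂) _ _
    ((blockEquiv (F := F) h).symm.toLinearMap ∘ₗ LinearMap.inl F _ _)
    (LinearMap.snd F _ _ ∘ₗ (blockEquiv (F := F) h).toLinearMap)
    ((blockEquiv h).symm.injective.comp LinearMap.inl_injective)
    (Prod.snd_surjective.comp (blockEquiv (F := F) h).surjective)
    (firstBlock_eq_range h) rfl ?_ ?_, evalEnd_toLin'_inDeg, evalEnd_toLin'_inDeg]
  · rfl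
  · intro v
    refine (blockEquiv h).injective ?_
    simp [blockEquiv_toLin', show (toBlock h z).toBlocks₂₁ = 0 from hz, - Matrix.toLin'_apply]
  · intro v
    simp [blockEquiv_toLin', show (toBlock h z).toBlocks₂₁ = 0 from hz, - Matrix.toLin'_apply]

/-- The linear automorphism of `F ^ n` given by an element of `GL_n`. -/
noncomputable def glEquiv {n : ℕ} (g : G F n) : (Fin n → F) ≃ₗ[F] (Fin n → F) :=
  LinearMap.GeneralLinearGroup.generalLinearEquiv F _ (Matrix.GeneralLinearGroup.toLin g)

theorem glEquiv_apply {n : ℕ} (g : G F n) (v : Fin n → F) :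
    glEquiv g v = Matrix.toLin' (g : gl F n) v := rfl

theorem glEquiv_toLin'_ad {n : ℕ} (g : G F n) (x : gl F n) (v : Fin n → F) :
    glEquiv g (Matrix.toLin' x v) = Matrix.toLin' (ad g x) (glEquiv g v) := by
  simp [glEquiv_apply, ad, Matrix.mul_assoc]

theorem glEquiv_mul {n : ℕ} (g g' : G F n) (v : Fin n → F) :
    glEquiv (g * g') v = glEquiv g (glEquiv g' v) := by
  simp [glEquiv_apply]

theorem exists_glEquiv {n : ℕ} (e : (Fin n → F) ≃ₗ[F] (Fin n → F)) : ∃ g : G F n, glEquiv g = e := by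
  refine ⟨Matrix.GeneralLinearGroup.toLin.symm
    ((LinearMap.GeneralLinearGroup.generalLinearEquiv F _).symm e), ?_⟩
  simp [glEquiv]

/-- Transitivity of `GL_n` on the subspaces of dimension `k`: a complement of `W` is chosen and both
summands are matched with the coordinate blocks. -/
theorem exists_comap_glEquiv_eq {k l n : ℕ} (h : k + l = n) (W : Submodule F (Fin n → F))
    (hW : Module.finrank F W = k) :
    ∃ g : G F n, (firstBlock h).comap (glEquiv g).toLinearMap = W := by
  obtain ⟨W', hW'⟩ := Submodule.exists_isCompl W
  have hl : Module.finrank F W' = l := by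
    have := Submodule.finrank_add_eq_of_isCompl hW'
    rw [hW, Module.finrank_fin_fun] at this
    omega
  let e1 : W ≃ₗ[F] (Fin k → F) := LinearEquiv.ofFinrankEq _ _ (by simp [hW])
  let e2 : W' ≃ₗ[F] (Fin l → F) := LinearEquiv.ofFinrankEq _ _ (by simp [hl])
  let e := (Submodule.prodEquivOfIsCompl W W' hW').symm ≪≫ₗ (e1.prodCongr e2) ≪≫ₗ
    (blockEquiv h).symm
  obtain ⟨g, hg⟩ := exists_glEquiv e
  refine ⟨g, ?_⟩
  ext v
  rw [hg, Submodule.mem_comap, mem_firstBlock]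
  simp [e]

end Blocks

/-! ### Harish-Chandra induction is the Hall product -/

section HallProduct

variable {F : Type u} [Field F] [Fintype F] [DecidableEq F]

noncomputable instance fintypeSubmodule {V : Type*} [AddCommGroup V] [Module F V]
    [Module.Finite F V] : Fintype (Submodule F V) :=
  have := Module.finite_of_finite F (M := V)
  Fintype.ofFinite _

-- The elements carrying `W` onto the first block form a coset `P g₀`, and an element maps the first
-- block into itself exactly when it preserves it, by equality of dimensions.
open Classical in
theorem card_filter_comap_glEquiv {k l n : ℕ} (h : k + l = n) (W : Submodule F (Fin n → F))
    (hW : Module.finrank F W = k) :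
    (Finset.univ.filter fun g : G F n => (firstBlock h).comap (glEquiv g).toLinearMap = W).card =
      Fintype.card {g : G F n // IsParabolic h (g : gl F n)} := by
  obtain ⟨g₀, hg₀⟩ := exists_comap_glEquiv_eq h W hW
  rw [Fintype.card_subtype]
  refine Finset.card_equiv (Equiv.mulRight g₀⁻¹) fun g => ?_
  simp only [Finset.mem_filter, Finset.mem_univ, true_and, Equiv.coe_mulRight, isParabolic_iff]
  have hle : ∀ p : G F n, firstBlock h ≤ (firstBlock h).comap (Matrix.toLin' (p : gl F n)) ↔
      firstBlock h = (firstBlock h).comap (glEquiv p).toLinearMap := by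
    intro p
    refine ⟨fun hp => Submodule.eq_of_le_of_finrank_eq hp ?_, fun hp => hp.le⟩
    rw [Submodule.comap_equiv_eq_map_symm]
    exact (LinearEquiv.finrank_map_eq _ _).symm
  rw [hle, ← hg₀]
  constructor
  · intro hg
    ext v
    have := SetLike.ext_iff.1 hg (glEquiv g₀⁻¹ v)
    simp only [Submodule.mem_comap, LinearEquiv.coe_coe, ← glEquiv_mul] at this ⊢
    rw [this]
    simp [glEquiv_apply]
  · intro hg
    ext v
    have := SetLike.ext_iff.1 hg (glEquiv g₀ v)
    simp only [Submodule.mem_comap, LinearEquiv.coe_coe, ← glEquiv_mul] at this ⊢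
    rw [this]
    simp

/-- The summand of `g` depends only on the subspace `W` that `g` carries onto the first block.
Grouping by `W` produces `|P|` equal terms, which the factor `|P|⁻¹` absorbs; subspaces of dimension
other than `k` contribute zero. -/
theorem hcInd_boxTimes_apply {k l n : ℕ} (h : k + l = n) (a : C F k) (b : C F l) (x : gl F n) :
    (hcInd h (boxTimes F k l (a ⊗ₜ b))).1 x =
      ∑ W : Submodule F (Fin n → F),
        hallTerm (inDeg F k a) (inDeg F l b) (Matrix.toLin' x) W := by
  classical
  set P := Fintype.card {g : G F n // IsParabolic h (g : gl F n)}
  have hP : (P : ℂ) ≠ 0 := by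
    have : Nonempty {g : G F n // IsParabolic h (g : gl F n)} :=
      ⟨⟨1, (isParabolic_iff h _).2 (by simp)⟩⟩
    exact Nat.cast_ne_zero.2 Fintype.card_ne_zero
  have h1 : (hcInd h (boxTimes F k l (a ⊗ₜ b))).1 x = (P : ℂ)⁻¹ * ∑ g : G F n,
      hallTerm (inDeg F k a) (inDeg F l b) (Matrix.toLin' x)
        ((firstBlock h).comap (glEquiv g).toLinearMap) := by
    change (P : ℂ)⁻¹ * ∑ g : G F n with IsParabolic h (ad g x), _ = _
    rw [Finset.sum_filter]
    congr 1
    refine Finset.sum_congr rfl fun g _ => ?_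
    rw [hallTerm_congr _ _ (glEquiv g) (glEquiv_toLin'_ad g x), Submodule.map_comap_eq_of_surjective
      (glEquiv g).surjective]
    split_ifs with hz
    · rw [hallTerm_firstBlock h a b _ hz, ← boxTimes_tmul]
    · rw [hallTerm_of_not_le]
      rwa [← isParabolic_iff]
  rw [h1, ← Finset.sum_fiberwise (s := Finset.univ)
    (g := fun g : G F n => (firstBlock h).comap (glEquiv g).toLinearMap), Finset.mul_sum]
  refine Finset.sum_congr rfl fun W _ => ?_
  rw [Finset.sum_congr rfl (g := fun _ =>
    hallTerm (inDeg F k a) (inDeg F l b) (Matrix.toLin' x) W)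
    (fun g hg => by rw [(Finset.mem_filter.1 hg).2]), Finset.sum_const, nsmul_eq_mul]
  by_cases hW : Module.finrank F W = k
  · rw [card_filter_comap_glEquiv h W hW, inv_mul_cancel_left₀ hP]
  · rw [hallTerm_inDeg_eq_zero _ _ _ hW, mul_zero, mul_zero]

theorem mul_inDeg (k l : ℕ) (a : C F k) (b : C F l) :
    mul F (inDeg F k a) (inDeg F l b) =
      inDeg F (k + l) (hcInd rfl (boxTimes F k l (a ⊗ₜ b))) := by
  simp only [mul, inDeg, DirectSum.toModule_lof, LinearMap.flip_apply]
  rfl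

theorem evalEnd_mul_inDeg (k l : ℕ) (a : C F k) (b : C F l) {V : Type*} [AddCommGroup V]
    [Module F V] [Module.Finite F V] (x : Module.End F V) :
    evalEnd x (mul F (inDeg F k a) (inDeg F l b)) =
      ∑ W : Submodule F V, hallTerm (inDeg F k a) (inDeg F l b) x W := by
  rw [mul_inDeg]
  by_cases hn : Module.finrank F V = k + l
  · let e : V ≃ₗ[F] (Fin (k + l) → F) := LinearEquiv.ofFinrankEq _ _ (by simp [hn])
    let y : gl F (k + l) := LinearMap.toMatrix' (e.conj x)
    have hy : ∀ v, e (x v) = Matrix.toLin' y (e v) := fun v => by simp [y]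
    rw [evalEnd_congr e hy, evalEnd_toLin'_inDeg, hcInd_boxTimes_apply]
    exact (Fintype.sum_equiv (Submodule.orderIsoMapComap e).toEquiv _ _
      fun W => hallTerm_congr _ _ e hy W).symm
  · rw [evalEnd_eq_zero hn]
    refine (Finset.sum_eq_zero fun W _ => ?_).symm
    unfold hallTerm
    split
    · by_cases h1 : Module.finrank F W = k
      · rw [evalEnd_eq_zero (V := V ⧸ W) (n := l), mul_zero]
        have := W.finrank_quotient_add_finrank
        omega
      · rw [evalEnd_eq_zero h1, zero_mul]
    · rfl

/-- The multiplication of `C(q)` is the Hall product. -/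
theorem evalEnd_mul (a b : CC F) {V : Type*} [AddCommGroup V] [Module F V] [Module.Finite F V]
    (x : Module.End F V) :
    evalEnd x (mul F a b) = ∑ W : Submodule F V, hallTerm a b x W := by
  induction a using DirectSum.induction_on with
  | zero => simp [hallTerm]
  | add a a' ha ha' => simp [ha, ha', hallTerm_add_left, Finset.sum_add_distrib]
  | of k a =>
    induction b using DirectSum.induction_on with
    | zero => simp [hallTerm]
    | add b b' hb hb' => simp [hb, hb', hallTerm_add_right, Finset.sum_add_distrib]
    | of l b => exact evalEnd_mul_inDeg k l a b x

end HallProduct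

/-! ### Associativity and unit of the Hall product -/

section Associativity

variable {F : Type u} [Field F] [Fintype F] [DecidableEq F]

open Classical in
theorem sum_submodule_coe {V : Type*} [AddCommGroup V] [Module F V] [Module.Finite F V]
    (W : Submodule F V) (φ : Submodule F W → ℂ) :
    ∑ U : Submodule F W, φ U = ∑ U : Submodule F V with U ≤ W, φ (U.comap W.subtype) := by
  refine Finset.sum_nbij' (fun U => U.map W.subtype) (fun U => U.comap W.subtype) ?_ ?_ ?_ ?_ ?_
  · intro U _
    simpa using Submodule.map_subtype_le W U
  · simp
  · intro U _
    exact Submodule.comap_map_eq_of_injective W.subtype_injective U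
  · intro U hU
    simpa using (Finset.mem_filter.1 hU).2
  · intro U _
    rw [Submodule.comap_map_eq_of_injective W.subtype_injective U]

open Classical in
theorem sum_submodule_quotient {V : Type*} [AddCommGroup V] [Module F V] [Module.Finite F V]
    (W : Submodule F V) (φ : Submodule F (V ⧸ W) → ℂ) :
    ∑ U : Submodule F (V ⧸ W), φ U = ∑ U : Submodule F V with W ≤ U, φ (U.map W.mkQ) := by
  have h1 : ∀ U : Submodule F (V ⧸ W), (U.comap W.mkQ).map W.mkQ = U := fun U =>
    Submodule.map_comap_eq_of_surjective W.mkQ_surjective U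
  refine Finset.sum_nbij' (fun U => U.comap W.mkQ) (fun U => U.map W.mkQ) ?_ ?_ ?_ ?_ ?_
  · intro U _
    simpa using Submodule.le_comap_mkQ W U
  · simp
  · intro U _
    exact h1 U
  · intro U hU
    simpa using (Finset.mem_filter.1 hU).2
  · intro U _
    rw [h1]

/-- Both sides are the contribution `a(U) b(W/U) c(V/W)` of the stable flag `U ≤ W`. The quotient
`W/U` is realised as the image of `W` in `V/U`, and `V/W` as the quotient of `V/U` by that image. -/
theorem hallTerm_restrict_mul {V : Type*} [AddCommGroup V] [Module F V] [Module.Finite F V]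
    (a b c : CC F) (x : Module.End F V) {U W : Submodule F V} (hUW : U ≤ W)
    (hU : U ≤ U.comap x) (hW : W ≤ W.comap x) :
    hallTerm a b (x.restrict hW) (U.comap W.subtype) * evalEnd (W.mapQ W x hW) c =
      evalEnd (x.restrict hU) a * hallTerm b c (U.mapQ U x hU) (W.map U.mkQ) := by
  have hY : W.map U.mkQ ≤ (W.map U.mkQ).comap (U.mapQ U x hU) := by
    rintro _ ⟨w, hw, rfl⟩
    exact ⟨x w, hW hw, rfl⟩
  rw [hallTerm_of_exact a b (x := x.restrict hW) (z := x.restrict hU)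
      (y := (U.mapQ U x hU).restrict hY) (Submodule.inclusion hUW) (U.mkQ.submoduleMap W)
      (Submodule.inclusion_injective hUW) (LinearMap.submoduleMap_surjective _ _),
    hallTerm_of_exact b c (x := U.mapQ U x hU) (z := (U.mapQ U x hU).restrict hY)
      (y := W.mapQ W x hW) (W.map U.mkQ).subtype (Submodule.factor hUW)
      (Submodule.subtype_injective _) (Submodule.factor_surjective hUW), mul_assoc]
  · exact Submodule.range_subtype _
  · ext v
    obtain ⟨v, rfl⟩ := Submodule.Quotient.mk_surjective _ v
    rw [LinearMap.mem_ker]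
    change (Submodule.Quotient.mk v : V ⧸ W) = 0 ↔ _
    rw [Submodule.Quotient.mk_eq_zero]
    constructor
    · exact fun hv => ⟨v, hv, rfl⟩
    · rintro ⟨w, hw, e⟩
      have := (Submodule.Quotient.eq U).1 e
      simpa using W.sub_mem hw (hUW this)
  · intro v
    rfl
  · intro v
    obtain ⟨v, rfl⟩ := Submodule.Quotient.mk_surjective _ v
    rfl
  · exact Submodule.range_inclusion _ _ hUW
  · ext v
    rw [LinearMap.mem_ker, Subtype.ext_iff]
    exact Submodule.Quotient.mk_eq_zero U
  · intro v
    rfl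
  · intro v
    rfl

/-- Each bracketing unfolds to a sum over flags `U ≤ W` of stable subspaces. One sums over `W` on
the outside and the other over `U`, so they agree after exchanging the sums. -/
theorem mul_assoc' (a b c : CC F) : mul F (mul F a b) c = mul F a (mul F b c) := by
  classical
  refine ext_evalEnd fun n x => ?_
  generalize Matrix.toLin' x = x
  have h1 : ∀ W : Submodule F (Fin n → F), hallTerm (mul F a b) c x W =
      ∑ U : Submodule F (Fin n → F), if h : U ≤ W ∧ U ≤ U.comap x ∧ W ≤ W.comap x then
        hallTerm a b (x.restrict h.2.2) (U.comap W.subtype) * evalEnd (W.mapQ W x h.2.2) c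
        else 0 := by
    intro W
    by_cases hW : W ≤ W.comap x
    · rw [hallTerm, dif_pos hW, evalEnd_mul, sum_submodule_coe, Finset.sum_mul, Finset.sum_filter]
      refine Finset.sum_congr rfl fun U _ => ?_
      by_cases hUW : U ≤ W
      · rw [if_pos hUW]
        by_cases hU : U ≤ U.comap x
        · rw [dif_pos ⟨hUW, hU, hW⟩]
        · rw [dif_neg (by tauto), hallTerm_of_not_le, zero_mul]
          intro h
          exact hU fun v hv => h (x := ⟨v, hUW hv⟩) hv
      · rw [if_neg hUW, dif_neg (by tauto)]
    · rw [hallTerm_of_not_le _ _ hW]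
      exact (Finset.sum_eq_zero fun U _ => dif_neg (by tauto)).symm
  have h2 : ∀ U : Submodule F (Fin n → F), hallTerm a (mul F b c) x U =
      ∑ W : Submodule F (Fin n → F), if h : U ≤ W ∧ U ≤ U.comap x ∧ W ≤ W.comap x then
        evalEnd (x.restrict h.2.1) a * hallTerm b c (U.mapQ U x h.2.1) (W.map U.mkQ)
        else 0 := by
    intro U
    by_cases hU : U ≤ U.comap x
    · rw [hallTerm, dif_pos hU, evalEnd_mul, sum_submodule_quotient, Finset.mul_sum,
        Finset.sum_filter]
      refine Finset.sum_congr rfl fun W _ => ?_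
      by_cases hUW : U ≤ W
      · rw [if_pos hUW]
        by_cases hW : W ≤ W.comap x
        · rw [dif_pos ⟨hUW, hU, hW⟩]
        · rw [dif_neg (by tauto), hallTerm_of_not_le, mul_zero]
          intro h
          refine hW fun v hv => ?_
          obtain ⟨w, hw, e⟩ := h (Submodule.mem_map_of_mem hv)
          have : w - x v ∈ U := (Submodule.Quotient.eq U).1 e
          simpa using W.sub_mem hw (hUW this)
      · rw [if_neg hUW, dif_neg (by tauto)]
    · rw [hallTerm_of_not_le _ _ hU]
      exact (Finset.sum_eq_zero fun W _ => dif_neg (by tauto)).symm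
  rw [evalEnd_mul, evalEnd_mul, Finset.sum_congr rfl fun W _ => h1 W,
    Finset.sum_congr rfl fun U _ => h2 U, Finset.sum_comm]
  refine Finset.sum_congr rfl fun U _ => Finset.sum_congr rfl fun W _ => ?_
  split_ifs with h
  · exact hallTerm_restrict_mul a b c x h.1 h.2.1 h.2.2
  · rfl

theorem evalEnd_unit {V : Type*} [AddCommGroup V] [Module F V] [Module.Finite F V]
    (hV : Module.finrank F V = 0) (x : Module.End F V) : evalEnd x (unit F) = 1 := by
  let e : V ≃ₗ[F] (Fin 0 → F) := LinearEquiv.ofFinrankEq _ _ (by simp [hV])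
  rw [evalEnd_congr e (y := Matrix.toLin' 0) (fun v => Subsingleton.elim _ _), unit,
    evalEnd_toLin'_inDeg]
  rfl

theorem unit_mul (a : CC F) : mul F (unit F) a = a := by
  refine ext_evalEnd fun n x => ?_
  generalize Matrix.toLin' x = x
  rw [evalEnd_mul, Finset.sum_eq_single ⊥]
  · rw [hallTerm_of_exact (x := x) (unit F) a (z := (0 : Module.End F (Fin 0 → F))) (y := x) 0
      LinearMap.id (fun _ _ _ => Subsingleton.elim _ _) Function.surjective_id
      LinearMap.range_zero LinearMap.ker_id, evalEnd_unit (by simp), one_mul] <;> simp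
  · intro W _ hW
    exact hallTerm_inDeg_eq_zero _ _ _ fun h => hW (Submodule.finrank_eq_zero.1 h)
  · simp

theorem mul_unit (a : CC F) : mul F a (unit F) = a := by
  refine ext_evalEnd fun n x => ?_
  generalize Matrix.toLin' x = x
  rw [evalEnd_mul, Finset.sum_eq_single ⊤]
  · rw [hallTerm_of_exact (x := x) a (unit F) (z := x) (y := (0 : Module.End F (Fin 0 → F)))
      LinearMap.id 0 Function.injective_id (fun _ => ⟨0, Subsingleton.elim _ _⟩)
      LinearMap.range_id LinearMap.ker_zero, evalEnd_unit (by simp), mul_one] <;> simp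
  · intro W _ hW
    unfold hallTerm
    split
    · rw [unit, evalEnd_eq_zero (V := (Fin n → F) ⧸ W) (n := 0), mul_zero]
      intro h
      have := W.finrank_quotient_add_finrank
      exact hW (Submodule.eq_top_of_finrank_eq (by omega))
    · rfl
  · simp

end Associativity

/-! ### Harish-Chandra restriction as an average over extensions -/

section ComulEvaluation

variable {F : Type u} [Field F]

/-- The endomorphism of `V × V'` with diagonal blocks `x`, `y` and upper right block `u`. -/
def extEnd {V V' : Type*} [AddCommGroup V] [Module F V] [AddCommGroup V'] [Module F V']
    (x : Module.End F V) (y : Module.End F V') (u : V' →ₗ[F] V) : Module.End F (V × V') :=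
  LinearMap.prod (x ∘ₗ LinearMap.fst F V V' + u ∘ₗ LinearMap.snd F V V')
    (y ∘ₗ LinearMap.snd F V V')

@[simp]
theorem extEnd_apply {V V' : Type*} [AddCommGroup V] [Module F V] [AddCommGroup V'] [Module F V']
    (x : Module.End F V) (y : Module.End F V') (u : V' →ₗ[F] V) (v : V × V') :
    extEnd x y u v = (x v.1 + u v.2, y v.2) := rfl

/-- The value of an element of `C(q) ⊗ C(q)` at a pair of endomorphisms. -/
noncomputable def evalEnd₂ {V V' : Type*} [AddCommGroup V] [Module F V] [Module.Finite F V]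
    [AddCommGroup V'] [Module F V'] [Module.Finite F V'] (x : Module.End F V)
    (y : Module.End F V') : CC F ⊗[ℂ] CC F →ₗ[ℂ] ℂ :=
  LinearMap.mul' ℂ ℂ ∘ₗ TensorProduct.map (evalEnd x) (evalEnd y)

@[simp]
theorem evalEnd₂_tmul {V V' : Type*} [AddCommGroup V] [Module F V] [Module.Finite F V]
    [AddCommGroup V'] [Module F V'] [Module.Finite F V'] (x : Module.End F V)
    (y : Module.End F V') (a b : CC F) :
    evalEnd₂ x y (a ⊗ₜ b) = evalEnd x a * evalEnd y b := rfl

theorem evalEnd₂_map_inDeg {k l : ℕ} (x : gl F k) (y : gl F l) (t : C F k ⊗[ℂ] C F l) :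
    evalEnd₂ (Matrix.toLin' x) (Matrix.toLin' y) (TensorProduct.map (inDeg F k) (inDeg F l) t) =
      (boxTimes F k l t).1 (x, y) := by
  induction t with
  | zero => simp
  | add s t hs ht => simp [hs, ht]
  | tmul a b =>
    rw [TensorProduct.map_tmul, evalEnd₂_tmul, evalEnd_toLin'_inDeg, evalEnd_toLin'_inDeg,
      boxTimes_tmul]

theorem evalEnd₂_map_inDeg_of_ne {k l i j : ℕ} (h : (i, j) ≠ (k, l)) (x : gl F k) (y : gl F l)
    (t : C F i ⊗[ℂ] C F j) :
    evalEnd₂ (Matrix.toLin' x) (Matrix.toLin' y) (TensorProduct.map (inDeg F i) (inDeg F j) t) =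
      0 := by
  induction t with
  | zero => simp
  | add s t hs ht => simp [hs, ht]
  | tmul a b =>
    rw [TensorProduct.map_tmul, evalEnd₂_tmul]
    by_cases hi : k = i
    · rw [evalEnd_eq_zero (n := j), mul_zero]
      rw [Module.finrank_fin_fun]
      rintro rfl
      exact h (by rw [hi])
    · rw [evalEnd_eq_zero (n := i), zero_mul]
      rwa [Module.finrank_fin_fun]

theorem evalEnd_extEnd_toLin' {k l n : ℕ} (h : k + l = n) (x : gl F k)
    (u : Matrix (Fin k) (Fin l) F) (y : gl F l) (a : C F n) :
    evalEnd (extEnd (Matrix.toLin' x) (Matrix.toLin' y) (Matrix.toLin' u)) (inDeg F n a) =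
      a.1 (ofBlocks h x u y) := by
  rw [← evalEnd_toLin'_inDeg]
  refine (evalEnd_congr (blockEquiv h) (fun v => ?_) _).symm
  rw [blockEquiv_toLin', ofBlocks, Equiv.apply_symm_apply]
  simp

variable [Fintype F] [DecidableEq F]

noncomputable instance fintypeLinearMap {V V' : Type*} [AddCommGroup V] [Module F V]
    [Module.Finite F V] [AddCommGroup V'] [Module F V'] [Module.Finite F V'] :
    Fintype (V →ₗ[F] V') :=
  have := Module.finite_of_finite F (M := V →ₗ[F] V')
  Fintype.ofFinite _

theorem comul_inDeg (n : ℕ) (a : C F n) :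
    comul F (inDeg F n a) = ∑ p : {p // p ∈ Finset.HasAntidiagonal.antidiagonal n},
      TensorProduct.map (inDeg F p.1.1) (inDeg F p.1.2) ((boxEquiv F p.1.1 p.1.2).symm
        (hcRes (Finset.HasAntidiagonal.mem_antidiagonal.1 p.2) a)) := by
  simp only [comul, inDeg, DirectSum.toModule_lof, LinearMap.sum_apply]
  rfl

theorem boxTimes_boxEquiv_symm (k l : ℕ) (φ : C₂ F k l) :
    boxTimes F k l ((boxEquiv F k l).symm φ) = φ := (boxEquiv F k l).apply_symm_apply φ

theorem evalEnd₂_comul_toLin' {k l n : ℕ} (a : C F n) (x : gl F k) (y : gl F l) :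
    evalEnd₂ (Matrix.toLin' x) (Matrix.toLin' y) (comul F (inDeg F n a)) =
      (Fintype.card ((Fin l → F) →ₗ[F] (Fin k → F)) : ℂ)⁻¹ * ∑ u : (Fin l → F) →ₗ[F] (Fin k → F),
        evalEnd (extEnd (Matrix.toLin' x) (Matrix.toLin' y) u) (inDeg F n a) := by
  rw [comul_inDeg, map_sum]
  by_cases h : k + l = n
  · rw [Finset.sum_eq_single ⟨(k, l), Finset.HasAntidiagonal.mem_antidiagonal.2 h⟩]
    · rw [evalEnd₂_map_inDeg, boxTimes_boxEquiv_symm]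
      change (Fintype.card (Matrix (Fin k) (Fin l) F) : ℂ)⁻¹ *
        ∑ u : Matrix (Fin k) (Fin l) F, a.1 (ofBlocks h x u y) = _
      rw [Fintype.card_congr (Matrix.toLin' (R := F) (m := Fin k) (n := Fin l)).toEquiv]
      congr 1
      exact Fintype.sum_equiv (Matrix.toLin' (R := F) (m := Fin k) (n := Fin l)).toEquiv _ _
        fun u => (evalEnd_extEnd_toLin' h x u y a).symm
    · intro p _ hp
      exact evalEnd₂_map_inDeg_of_ne (fun e => hp (Subtype.ext e)) _ _ _
    · simp
  · rw [Finset.sum_eq_zero, Finset.sum_eq_zero, mul_zero]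
    · intro u _
      exact evalEnd_eq_zero (by simpa using h) _ _
    · intro p _
      refine evalEnd₂_map_inDeg_of_ne (fun e => h ?_) _ _ _
      have := Finset.HasAntidiagonal.mem_antidiagonal.1 p.2
      rwa [(Prod.ext_iff.1 e).1, (Prod.ext_iff.1 e).2] at this

theorem evalEnd₂_congr {V V' W W' : Type*} [AddCommGroup V] [Module F V] [Module.Finite F V]
    [AddCommGroup V'] [Module F V'] [Module.Finite F V'] [AddCommGroup W] [Module F W]
    [Module.Finite F W] [AddCommGroup W'] [Module F W'] [Module.Finite F W'] (e : V ≃ₗ[F] W)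
    (e' : V' ≃ₗ[F] W') {x : Module.End F V} {y : Module.End F V'} {z : Module.End F W}
    {w : Module.End F W'} (h : ∀ v, e (x v) = z (e v)) (h' : ∀ v, e' (y v) = w (e' v))
    (t : CC F ⊗[ℂ] CC F) : evalEnd₂ x y t = evalEnd₂ z w t := by
  refine LinearMap.congr_fun (TensorProduct.ext' fun a b => ?_) t
  simp [evalEnd_congr e h, evalEnd_congr e' h']

/-- The comultiplication of `C(q)` averages over extensions. -/
theorem evalEnd₂_comul {V V' : Type*} [AddCommGroup V] [Module F V] [Module.Finite F V]
    [AddCommGroup V'] [Module F V'] [Module.Finite F V'] (x : Module.End F V)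
    (y : Module.End F V') (a : CC F) :
    evalEnd₂ x y (comul F a) =
      (Fintype.card (V' →ₗ[F] V) : ℂ)⁻¹ * ∑ u : V' →ₗ[F] V, evalEnd (extEnd x y u) a := by
  induction a using DirectSum.induction_on with
  | zero => simp
  | add a b ha hb => simp [ha, hb, Finset.sum_add_distrib, mul_add]
  | of n a =>
    change evalEnd₂ x y (comul F (inDeg F n a)) =
      _ * ∑ u : V' →ₗ[F] V, evalEnd (extEnd x y u) (inDeg F n a)
    let e := (Module.finBasis F V).equivFun
    let e' := (Module.finBasis F V').equivFun
    have h : ∀ v, e (x v) = Matrix.toLin' (LinearMap.toMatrix' (e.conj x)) (e v) :=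
      fun v => by simp
    have h' : ∀ v, e' (y v) = Matrix.toLin' (LinearMap.toMatrix' (e'.conj y)) (e' v) :=
      fun v => by simp
    rw [evalEnd₂_congr e e' h h', evalEnd₂_comul_toLin',
      Fintype.card_congr (e'.arrowCongr e).toEquiv]
    congr 1
    refine (Fintype.sum_equiv (e'.arrowCongr e).toEquiv _ _ fun u => ?_).symm
    refine evalEnd_congr (e.prodCongr e') (fun v => ?_) _
    refine Prod.ext ?_ (h' v.2)
    change e (x v.1 + u v.2) = _
    rw [map_add, h]
    simp

end ComulEvaluation

/-! ### The Mackey formula: subspaces of `V × V'` as shears of products -/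

section Mackey

/-- A surjective homomorphism pushes the uniform average to the uniform average. Both sides count
the double sum of `f (φ a + b)`, which translation invariance evaluates in either order. -/
theorem card_mul_sum_comp_of_surjective {A B : Type*} [AddGroup A] [AddGroup B] [Fintype A]
    [Fintype B] (φ : A →+ B) (hφ : Function.Surjective φ) (f : B → ℂ) :
    (Fintype.card B : ℂ) * ∑ a, f (φ a) = Fintype.card A * ∑ b, f b := by
  have h1 : ∀ b, ∑ a, f (φ a + b) = ∑ a, f (φ a) := by
    intro b
    obtain ⟨c, rfl⟩ := hφ b
    exact Fintype.sum_equiv (Equiv.addRight c) _ _ fun a => by simp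
  have h2 : ∀ a, ∑ b, f (φ a + b) = ∑ b, f b := fun a =>
    Fintype.sum_equiv (Equiv.addLeft (φ a)) _ _ fun b => rfl
  calc _ = ∑ b, ∑ a, f (φ a + b) := by simp [h1]
    _ = _ := by rw [Finset.sum_comm]; simp [h2]

variable {F : Type u} [Field F] {V V' : Type*} [AddCommGroup V] [Module F V]
  [AddCommGroup V'] [Module F V']

/-- The unipotent automorphism `(v, v') ↦ (v + s v', v')` of `V × V'`. -/
def shear (s : V' →ₗ[F] V) : (V × V') ≃ₗ[F] V × V' where
  toFun v := (v.1 + s v.2, v.2)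
  invFun v := (v.1 - s v.2, v.2)
  map_add' v w := by ext <;> simp; abel
  map_smul' c v := by simp
  left_inv v := by simp
  right_inv v := by simp

@[simp]
theorem shear_apply (s : V' →ₗ[F] V) (v : V × V') : shear s v = (v.1 + s v.2, v.2) := rfl

theorem mem_map_shear_prod (s : V' →ₗ[F] V) (W : Submodule F V) (W' : Submodule F V')
    (v : V × V') :
    v ∈ (W.prod W').map (shear s).toLinearMap ↔ v.1 - s v.2 ∈ W ∧ v.2 ∈ W' := by
  rw [Submodule.mem_map_equiv]
  exact Iff.rfl

theorem map_shear_prod_eq_iff (s t : V' →ₗ[F] V) (W : Submodule F V) (W' : Submodule F V') :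
    (W.prod W').map (shear s).toLinearMap = (W.prod W').map (shear t).toLinearMap ↔
      s - t ∈ Submodule.compatibleMaps W' W := by
  constructor
  · intro h v hv
    have : (s v, v) ∈ (W.prod W').map (shear t).toLinearMap := by
      rw [← h, mem_map_shear_prod]
      exact ⟨by simp, hv⟩
    exact ((mem_map_shear_prod t W W' _).1 this).1
  · intro h
    ext v
    rw [mem_map_shear_prod, mem_map_shear_prod]
    refine and_congr_left fun hv => ?_
    have h1 : s v.2 - t v.2 ∈ W := h hv
    rw [← W.add_mem_iff_left h1]
    congr! 1
    abel

/-- A linear section of the projection from `W` onto its image in `V'` gives, through its first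
component, a map from this image to `V`. Any extension of that map to `V'` is a suitable `s`. -/
theorem exists_map_shear_prod_eq (W : Submodule F (V × V')) :
    ∃ s : V' →ₗ[F] V, ((W.comap (LinearMap.inl F V V')).prod
      (W.map (LinearMap.snd F V V'))).map (shear s).toLinearMap = W := by
  obtain ⟨σ, hσ⟩ := ((LinearMap.snd F V V').submoduleMap W).exists_rightInverse_of_surjective
    (LinearMap.range_eq_top.2 (LinearMap.submoduleMap_surjective _ _))
  obtain ⟨s, hs⟩ := (LinearMap.fst F V V' ∘ₗ W.subtype ∘ₗ σ).exists_extend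
  refine ⟨s, ?_⟩
  have key : ∀ v (hv : v ∈ W.map (LinearMap.snd F V V')), (s v, v) ∈ W := by
    intro v hv
    have h1 : ((σ ⟨v, hv⟩ : W) : V × V').2 = v :=
      congrArg Subtype.val (LinearMap.congr_fun hσ ⟨v, hv⟩)
    have h2 : s v = ((σ ⟨v, hv⟩ : W) : V × V').1 := LinearMap.congr_fun hs ⟨v, hv⟩
    have : (s v, v) = ((σ ⟨v, hv⟩ : W) : V × V') := Prod.ext h2 h1.symm
    rw [this]
    exact (σ ⟨v, hv⟩).2
  ext v
  rw [mem_map_shear_prod, Submodule.mem_comap]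
  have e : (LinearMap.inl F V V') (v.1 - s v.2) = v - (s v.2, v.2) := by
    ext <;> simp
  rw [e]
  constructor
  · rintro ⟨h1, h2⟩
    exact (W.sub_mem_iff_left (key _ h2)).1 h1
  · intro h
    have h2 : v.2 ∈ W.map (LinearMap.snd F V V') := ⟨v, h, rfl⟩
    exact ⟨W.sub_mem h (key _ h2), h2⟩

theorem comap_inl_map_shear_prod (s : V' →ₗ[F] V) (W : Submodule F V) (W' : Submodule F V') :
    ((W.prod W').map (shear s).toLinearMap).comap (LinearMap.inl F V V') = W := by
  ext v
  rw [Submodule.mem_comap, mem_map_shear_prod]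
  simp

theorem map_snd_map_shear_prod (s : V' →ₗ[F] V) (W : Submodule F V) (W' : Submodule F V') :
    ((W.prod W').map (shear s).toLinearMap).map (LinearMap.snd F V V') = W' := by
  ext v
  constructor
  · rintro ⟨w, hw, rfl⟩
    exact ((mem_map_shear_prod s W W' w).1 hw).2
  · intro hv
    exact ⟨(s v, v), (mem_map_shear_prod s W W' _).2 (by simpa using hv), rfl⟩

/-- The map `u ↦ (u|W', u mod W)` on the linear maps `V' → V` sending `W'` to `W`. -/
def compatibleMapsSplit (W' : Submodule F V') (W : Submodule F V) :
    Submodule.compatibleMaps W' W →ₗ[F] (W' →ₗ[F] W) × (V' ⧸ W' →ₗ[F] V ⧸ W) :=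
  LinearMap.prod
    { toFun := fun u => u.1.restrict fun _ hv => u.2 hv
      map_add' := fun _ _ => rfl
      map_smul' := fun _ _ => rfl }
    (Submodule.mapQLinear W' W)

/-- A retraction of `V'` onto `W'` and a section of `V → V/W` allow the two components to be
prescribed independently. -/
theorem compatibleMapsSplit_surjective (W' : Submodule F V') (W : Submodule F V) :
    Function.Surjective (compatibleMapsSplit W' W) := by
  rintro ⟨r, q⟩
  obtain ⟨p, hp⟩ := W'.subtype.exists_leftInverse_of_injective W'.ker_subtype
  obtain ⟨σ, hσ⟩ := W.mkQ.exists_rightInverse_of_surjective W.range_mkQ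
  have hp' : ∀ w : W', p w = w := fun w => LinearMap.congr_fun hp w
  have hσ' : ∀ w, W.mkQ (σ w) = w := fun w => LinearMap.congr_fun hσ w
  let u : V' →ₗ[F] V := W.subtype ∘ₗ r ∘ₗ p + σ ∘ₗ q ∘ₗ W'.mkQ
  have hu : ∀ w : W', u w = r w := by
    intro w
    simp [u, hp', (Submodule.Quotient.mk_eq_zero W').2 w.2]
  refine ⟨⟨u, fun v hv => ?_⟩, Prod.ext (LinearMap.ext fun w => Subtype.ext (hu w))
    (LinearMap.ext fun v => ?_)⟩
  · rw [Submodule.mem_comap, hu ⟨v, hv⟩]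
    exact (r _).2
  · obtain ⟨v, rfl⟩ := Submodule.Quotient.mk_surjective _ v
    change W.mkQ (u v) = q (Submodule.Quotient.mk v)
    have : W.mkQ (r (p v) : V) = 0 := (Submodule.Quotient.mk_eq_zero W).2 (r (p v)).2
    simp only [u, LinearMap.add_apply, map_add, LinearMap.comp_apply, hσ', Submodule.subtype_apply,
      this, zero_add, Submodule.mkQ_apply]

variable [Module.Finite F V] [Module.Finite F V'] [Fintype F] [DecidableEq F]

noncomputable instance (W' : Submodule F V') (W : Submodule F V) :
    Fintype (Submodule.compatibleMaps W' W) :=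
  have := Module.finite_of_finite F (M := Submodule.compatibleMaps W' W)
  Fintype.ofFinite _

-- Orbit counting for the group of shears: it acts transitively on the subspaces with intersection
-- `W` and image `W'`, and two shears of `W × W'` agree exactly when they differ by a map sending
-- `W'` into `W`.
open Classical in
theorem card_fiber_mul (W : Submodule F V) (W' : Submodule F V') :
    (Finset.univ.filter fun X : Submodule F (V × V') =>
      (X.comap (LinearMap.inl F V V'), X.map (LinearMap.snd F V V')) = (W, W')).card *
      Fintype.card (Submodule.compatibleMaps W' W) = Fintype.card (V' →ₗ[F] V) := by
  rw [← Finset.card_univ (α := V' →ₗ[F] V), Finset.card_eq_sum_card_fiberwise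
    (f := fun s : V' →ₗ[F] V => (W.prod W').map (shear s).toLinearMap)
    (t := Finset.univ.filter fun X : Submodule F (V × V') =>
      (X.comap (LinearMap.inl F V V'), X.map (LinearMap.snd F V V')) = (W, W')),
    Finset.sum_const_nat]
  · intro X hX
    obtain ⟨h1, h2⟩ := Prod.ext_iff.1 (Finset.mem_filter.1 hX).2
    obtain ⟨t, ht⟩ := exists_map_shear_prod_eq X
    dsimp only at h1 h2
    rw [h1, h2] at ht
    rw [← ht, ← Finset.card_univ]
    refine Finset.card_bij' (fun s hs => ⟨s - t, ?_⟩) (fun r _ => r.1 + t) ?_ ?_ ?_ ?_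
    · exact (map_shear_prod_eq_iff s t W W').1 (Finset.mem_filter.1 hs).2
    · simp
    · intro r _
      refine Finset.mem_filter.2 ⟨Finset.mem_univ _, (map_shear_prod_eq_iff _ t W W').2 ?_⟩
      simpa only [add_sub_cancel_right] using r.2
    · simp
    · simp
  · intro s _
    exact Finset.mem_coe.2 (Finset.mem_filter.2 ⟨Finset.mem_univ _,
      Prod.ext (comap_inl_map_shear_prod s W W') (map_snd_map_shear_prod s W W')⟩)

/-- A shear-invariant function is constant on the set of subspaces with given intersection and
image, so it can be evaluated at the product; the weight is the size of that set from
`card_fiber_mul`. -/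
theorem sum_submodule_prod (Φ : Submodule F (V × V') → ℂ)
    (hΦ : ∀ s X, Φ (X.map (shear s).toLinearMap) = Φ X) :
    ∑ X, Φ X = ∑ p : Submodule F V × Submodule F V',
      Fintype.card (V' →ₗ[F] V) * (Fintype.card (Submodule.compatibleMaps p.2 p.1) : ℂ)⁻¹ *
        Φ (p.1.prod p.2) := by
  classical
  rw [← Finset.sum_fiberwise (s := Finset.univ) (g := fun X : Submodule F (V × V') =>
    (X.comap (LinearMap.inl F V V'), X.map (LinearMap.snd F V V')))]
  refine Finset.sum_congr rfl fun p _ => ?_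
  rw [Finset.sum_congr rfl (g := fun _ => Φ (p.1.prod p.2)), Finset.sum_const, nsmul_eq_mul,
    ← card_fiber_mul p.1 p.2, Nat.cast_mul, mul_inv_cancel_right₀]
  · exact Nat.cast_ne_zero.2 Fintype.card_ne_zero
  · intro X hX
    obtain ⟨t, ht⟩ := exists_map_shear_prod_eq X
    rw [(Finset.mem_filter.1 hX).2.symm]
    dsimp only
    conv_lhs => rw [← ht, hΦ]

/-- Conjugation by a shear `s` preserves the diagonal blocks and only translates the upper right
block by a multiple `±1` of `x s - s y`. The sum over all upper right blocks absorbs this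
translation. -/
theorem sum_hallTerm_extEnd_map_shear (a b : CC F) (x : Module.End F V) (y : Module.End F V')
    (s : V' →ₗ[F] V) (X : Submodule F (V × V')) :
    ∑ u : V' →ₗ[F] V, hallTerm a b (extEnd x y u) (X.map (shear s).toLinearMap) =
      ∑ u : V' →ₗ[F] V, hallTerm a b (extEnd x y u) X := by
  refine Fintype.sum_equiv (Equiv.addRight (x ∘ₗ s - s ∘ₗ y)) _ _ fun u => ?_
  refine (hallTerm_congr a b (shear s) (fun v => ?_) X).symm
  ext
  · simp only [Equiv.coe_addRight, extEnd_apply, shear_apply, LinearMap.add_apply,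
      LinearMap.sub_apply, LinearMap.comp_apply, map_add]
    abel
  · rfl

theorem hallTerm_extEnd_prod (a b : CC F) (x : Module.End F V) (y : Module.End F V')
    {W : Submodule F V} {W' : Submodule F V'} (hW : W ≤ W.comap x) (hW' : W' ≤ W'.comap y)
    (u : Submodule.compatibleMaps W' W) :
    hallTerm a b (extEnd x y u.1) (W.prod W') =
      evalEnd (extEnd (x.restrict hW) (y.restrict hW') (compatibleMapsSplit W' W u).1) a *
        evalEnd (extEnd (W.mapQ W x hW) (W'.mapQ W' y hW') (compatibleMapsSplit W' W u).2) b := by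
  refine hallTerm_of_exact a b (W.subtype.prodMap W'.subtype) (W.mkQ.prodMap W'.mkQ)
    (Prod.map_injective.2 ⟨W.subtype_injective, W'.subtype_injective⟩)
    (Prod.map_surjective.2 ⟨W.mkQ_surjective, W'.mkQ_surjective⟩) ?_ ?_ ?_ ?_
  · rw [LinearMap.range_prodMap, Submodule.range_subtype, Submodule.range_subtype]
  · rw [LinearMap.ker_prodMap, Submodule.ker_mkQ, Submodule.ker_mkQ]
  · intro v
    rfl
  · intro v
    rfl

/-- Only the `u` with `u(W') ⊆ W` leave `W × W'` stable. For these the term depends on `u` through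
the induced maps `W' → W` and `V'/W' → V/W`, and by surjectivity of `compatibleMapsSplit` the
average factors into two independent averages. -/
theorem sum_hallTerm_extEnd_prod (a b : CC F) (x : Module.End F V) (y : Module.End F V')
    {W : Submodule F V} {W' : Submodule F V'} (hW : W ≤ W.comap x) (hW' : W' ≤ W'.comap y) :
    (Fintype.card (Submodule.compatibleMaps W' W) : ℂ)⁻¹ *
      ∑ u : V' →ₗ[F] V, hallTerm a b (extEnd x y u) (W.prod W') =
      evalEnd₂ (x.restrict hW) (y.restrict hW') (comul F a) *
        evalEnd₂ (W.mapQ W x hW) (W'.mapQ W' y hW') (comul F b) := by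
  classical
  have h1 : ∑ u : V' →ₗ[F] V, hallTerm a b (extEnd x y u) (W.prod W') =
      ∑ u : Submodule.compatibleMaps W' W, hallTerm a b (extEnd x y u.1) (W.prod W') := by
    rw [← Finset.sum_filter_of_ne (p := fun u => u ∈ Submodule.compatibleMaps W' W)]
    · exact Finset.sum_subtype _ (by simp) _
    · intro u _ hu v hv
      by_contra h
      refine hu (hallTerm_of_not_le a b fun h' => h ?_)
      simpa using (h' (x := ((0 : V), v)) ⟨W.zero_mem, hv⟩).1
  rw [h1, Finset.sum_congr rfl fun u _ => hallTerm_extEnd_prod a b x y hW hW' u]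
  have h2 := card_mul_sum_comp_of_surjective (compatibleMapsSplit W' W).toAddMonoidHom
    (compatibleMapsSplit_surjective W' W) (fun p =>
      evalEnd (extEnd (x.restrict hW) (y.restrict hW') p.1) a *
        evalEnd (extEnd (W.mapQ W x hW) (W'.mapQ W' y hW') p.2) b)
  rw [Fintype.sum_prod_type] at h2
  dsimp only at h2
  rw [← Finset.sum_mul_sum, Fintype.card_prod] at h2
  rw [evalEnd₂_comul, evalEnd₂_comul]
  have c1 : (Fintype.card (Submodule.compatibleMaps W' W) : ℂ) ≠ 0 :=
    Nat.cast_ne_zero.2 Fintype.card_ne_zero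
  have c2 : (Fintype.card (W' →ₗ[F] W) : ℂ) ≠ 0 := Nat.cast_ne_zero.2 Fintype.card_ne_zero
  have c3 : (Fintype.card (V' ⧸ W' →ₗ[F] V ⧸ W) : ℂ) ≠ 0 :=
    Nat.cast_ne_zero.2 Fintype.card_ne_zero
  rw [inv_mul_eq_iff_eq_mul₀ c1]
  refine mul_left_cancel₀ (mul_ne_zero c2 c3) ?_
  push_cast at h2
  refine h2.trans ?_
  field_simp

open Classical in
/-- The Mackey formula. -/
theorem evalEnd₂_comul_mul (a b : CC F) (x : Module.End F V) (y : Module.End F V') :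
    evalEnd₂ x y (comul F (mul F a b)) = ∑ p : Submodule F V × Submodule F V',
      if h : p.1 ≤ p.1.comap x ∧ p.2 ≤ p.2.comap y then
        evalEnd₂ (x.restrict h.1) (y.restrict h.2) (comul F a) *
          evalEnd₂ (p.1.mapQ p.1 x h.1) (p.2.mapQ p.2 y h.2) (comul F b) else 0 := by
  rw [evalEnd₂_comul]
  simp only [evalEnd_mul]
  rw [Finset.sum_comm, sum_submodule_prod _ (sum_hallTerm_extEnd_map_shear a b x y),
    Finset.mul_sum]
  refine Finset.sum_congr rfl fun p _ => ?_
  have c : (Fintype.card (V' →ₗ[F] V) : ℂ) ≠ 0 := Nat.cast_ne_zero.2 Fintype.card_ne_zero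
  rw [mul_assoc, inv_mul_cancel_left₀ c]
  split_ifs with h
  · exact sum_hallTerm_extEnd_prod a b x y h.1 h.2
  · rw [Finset.sum_eq_zero, mul_zero]
    intro u _
    refine hallTerm_of_not_le a b fun h' => h ⟨fun v hv => ?_, fun v hv => ?_⟩
    · simpa using (h' (x := (v, (0 : V'))) ⟨hv, p.2.zero_mem⟩).1
    · exact (h' (x := ((0 : V), v)) ⟨p.1.zero_mem, hv⟩).2

end Mackey

/-! ### Fourier analysis on `gl_n` and the classification of irreducible invariant characters -/

section Fourier

variable {F : Type u} [Field F] [Fintype F] [DecidableEq F] {n : ℕ}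

/-- The unnormalised Fourier coefficient of an invariant function at an additive character. -/
noncomputable def fourier (ψ : AddChar (gl F n) ℂ) : C F n →ₗ[ℂ] ℂ where
  toFun a := ∑ x : gl F n, a.1 x * ψ (-x)
  map_add' a b := by simp [add_mul, Finset.sum_add_distrib]
  map_smul' c a := by simp [Finset.mul_sum, mul_assoc]

theorem fourier_apply (ψ : AddChar (gl F n) ℂ) (a : C F n) :
    fourier ψ a = ∑ x : gl F n, a.1 x * ψ (-x) := rfl

theorem card_gl_ne_zero : (Fintype.card (gl F n) : ℂ) ≠ 0 := Nat.cast_ne_zero.2 Fintype.card_ne_zero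

/-- Fourier inversion, from the orthogonality of additive characters summed over the dual group. -/
theorem sum_fourier_mul (a : C F n) (x : gl F n) :
    ∑ ψ : AddChar (gl F n) ℂ, fourier ψ a * ψ x = Fintype.card (gl F n) * a.1 x := by
  have h : ∀ y : gl F n, ∑ ψ : AddChar (gl F n) ℂ, ψ (-y) * ψ x =
      if y = x then (Fintype.card (gl F n) : ℂ) else 0 := by
    intro y
    simp only [← AddChar.map_add_eq_mul, AddChar.sum_apply_eq_ite, neg_add_eq_zero]
  simp only [fourier_apply, Finset.sum_mul, mul_assoc]
  rw [Finset.sum_comm]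
  simp only [← Finset.mul_sum, h]
  simp [mul_comm]

theorem ext_fourier {a b : C F n} (h : ∀ ψ, fourier ψ a = fourier ψ b) : a = b := by
  ext x
  refine mul_left_cancel₀ card_gl_ne_zero ((sum_fourier_mul a x).symm.trans ?_)
  simp only [h]
  exact sum_fourier_mul b x

theorem sum_char_mul_char (φ ψ : AddChar (gl F n) ℂ) :
    ∑ x : gl F n, φ x * ψ (-x) = if φ = ψ then (Fintype.card (gl F n) : ℂ) else 0 := by
  have := AddChar.sum_eq_ite (φ - ψ)
  simp only [AddChar.sub_apply, sub_eq_zero] at this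
  exact this

/-- The action of `GL_n` on the additive characters of `gl_n`. -/
def adChar (g : G F n) (ψ : AddChar (gl F n) ℂ) : AddChar (gl F n) ℂ where
  toFun x := ψ (ad g x)
  map_zero_eq_one' := by simp [ad]
  map_add_eq_mul' x y := by rw [← AddChar.map_add_eq_mul]; simp [ad, mul_add, add_mul]

@[simp]
theorem adChar_apply (g : G F n) (ψ : AddChar (gl F n) ℂ) (x : gl F n) :
    adChar g ψ x = ψ (ad g x) := rfl

theorem ad_one (x : gl F n) : ad 1 x = x := by simp [ad]

theorem adChar_one (ψ : AddChar (gl F n) ℂ) : adChar 1 ψ = ψ := by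
  ext x
  simp [ad_one]

theorem adChar_mul (g h : G F n) (ψ : AddChar (gl F n) ℂ) :
    adChar (g * h) ψ = adChar h (adChar g ψ) := by
  ext x
  simp [ad_mul]

/-- The adjoint action of an element of `GL_n` is a bijection. -/
def adEquiv (g : G F n) : gl F n ≃ gl F n where
  toFun := ad g
  invFun := ad g⁻¹
  left_inv x := by rw [← ad_mul, inv_mul_cancel, ad_one]
  right_inv x := by rw [← ad_mul, mul_inv_cancel, ad_one]

theorem ad_neg (g : G F n) (x : gl F n) : ad g (-x) = -ad g x := by simp [ad]

theorem fourier_adChar (g : G F n) (ψ : AddChar (gl F n) ℂ) (a : C F n) :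
    fourier (adChar g ψ) a = fourier ψ a := by
  refine Fintype.sum_equiv (adEquiv g) _ _ fun x => ?_
  rw [adChar_apply, ad_neg]
  exact congrArg (· * _) (a.2 g x).symm

open Classical in
/-- The orbit of an additive character. -/
noncomputable def charOrbit (ψ : AddChar (gl F n) ℂ) : Finset (AddChar (gl F n) ℂ) :=
  Finset.univ.image fun g => adChar g ψ

theorem mem_charOrbit {φ ψ : AddChar (gl F n) ℂ} : φ ∈ charOrbit ψ ↔ ∃ g, adChar g ψ = φ := by
  simp [charOrbit]

theorem self_mem_charOrbit (ψ : AddChar (gl F n) ℂ) : ψ ∈ charOrbit ψ :=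
  mem_charOrbit.2 ⟨1, adChar_one ψ⟩

theorem adChar_mem_charOrbit_iff (g : G F n) {φ ψ : AddChar (gl F n) ℂ} :
    adChar g φ ∈ charOrbit ψ ↔ φ ∈ charOrbit ψ := by
  simp only [mem_charOrbit]
  constructor
  · rintro ⟨h, hh⟩
    exact ⟨h * g⁻¹, by rw [adChar_mul, hh, ← adChar_mul, mul_inv_cancel, adChar_one]⟩
  · rintro ⟨h, rfl⟩
    exact ⟨h * g, adChar_mul _ _ _⟩

theorem charOrbit_eq_of_mem {φ ψ : AddChar (gl F n) ℂ} (h : φ ∈ charOrbit ψ) :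
    charOrbit φ = charOrbit ψ := by
  obtain ⟨g, rfl⟩ := mem_charOrbit.1 h
  ext χ
  constructor
  · intro hχ
    obtain ⟨h, rfl⟩ := mem_charOrbit.1 hχ
    simp [adChar_mem_charOrbit_iff, self_mem_charOrbit]
  · intro hχ
    obtain ⟨h, rfl⟩ := mem_charOrbit.1 hχ
    refine mem_charOrbit.2 ⟨g⁻¹ * h, ?_⟩
    rw [← adChar_mul, mul_inv_cancel_left]

/-- The sum of the orbit of an additive character. -/
noncomputable def orbitSum (ψ : AddChar (gl F n) ℂ) : C F n :=
  ⟨fun x => ∑ φ ∈ charOrbit ψ, φ x, by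
    intro g x
    refine Finset.sum_bij' (fun φ _ => adChar g φ) (fun φ _ => adChar g⁻¹ φ) ?_ ?_ ?_ ?_ ?_
    · exact fun φ hφ => (adChar_mem_charOrbit_iff g).2 hφ
    · exact fun φ hφ => (adChar_mem_charOrbit_iff _).2 hφ
    · intro φ _
      rw [← adChar_mul, mul_inv_cancel, adChar_one]
    · intro φ _
      rw [← adChar_mul, inv_mul_cancel, adChar_one]
    · intro φ _
      rfl⟩

open Classical in
theorem fourier_orbitSum (φ ψ : AddChar (gl F n) ℂ) :
    fourier φ (orbitSum ψ) = if φ ∈ charOrbit ψ then (Fintype.card (gl F n) : ℂ) else 0 := by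
  change ∑ x, (∑ χ ∈ charOrbit ψ, χ x) * φ (-x) = _
  simp only [Finset.sum_mul]
  rw [Finset.sum_comm]
  simp only [sum_char_mul_char]
  rw [Finset.sum_ite_eq' (charOrbit ψ) φ]

/-- Invariant characters are the invariant functions with multiplicities in `ℕ`. -/
theorem isInvChar_iff (a : C F n) :
    IsInvChar a ↔ ∃ m : AddChar (gl F n) ℂ → ℕ,
      ∀ ψ, fourier ψ a = Fintype.card (gl F n) * m ψ := by
  constructor
  · rintro ⟨d, ρ, hρ⟩
    have h : ∀ ψ : AddChar (gl F n) ℂ, ∃ m : ℕ, fourier ψ a = Fintype.card (gl F n) * m := by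
      intro ψ
      -- Twisting by the inverse of `ψ` turns the `ψ`-isotypic part into invariants, so the
      -- multiplicity is the dimension of a space of invariants.
      let ρ' : Representation ℂ (Multiplicative (gl F n)) (Fin d → ℂ) :=
        { toFun := fun x => ψ (-x.toAdd) • ρ x
          map_one' := by simp
          map_mul' := fun x y => by
            rw [map_mul ρ, show (x * y).toAdd = x.toAdd + y.toAdd from rfl, neg_add,
              AddChar.map_add_eq_mul, smul_mul_smul_comm] }
      have : Invertible (Nat.card (Multiplicative (gl F n)) : ℂ) :=
        invertibleOfNonzero (Nat.cast_ne_zero.2 Nat.card_pos.ne')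
      refine ⟨Module.finrank ℂ ρ'.invariants, ?_⟩
      · rw [← Representation.card_inv_mul_sum_char_eq_finrank ρ', Nat.card_eq_fintype_card,
          Fintype.card_multiplicative, mul_inv_cancel_left₀ card_gl_ne_zero]
        refine Fintype.sum_equiv Multiplicative.ofAdd _ _ fun x => ?_
        rw [hρ, Representation.character, Representation.character]
        change _ = LinearMap.trace ℂ _ (ψ (-x) • ρ (Multiplicative.ofAdd x))
        rw [map_smul, smul_eq_mul, mul_comm]
    choose m hm using h
    exact ⟨m, hm⟩
  · rintro ⟨m, hm⟩
    -- The representation is diagonal, with one coordinate for each character counted with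
    -- multiplicity.
    let e := Fintype.equivFin (Σ ψ : AddChar (gl F n) ℂ, Fin (m ψ))
    let ρ : Representation ℂ (Multiplicative (gl F n)) (Fin _ → ℂ) :=
      { toFun := fun x => Matrix.toLin' (Matrix.diagonal fun i => (e.symm i).1 x.toAdd)
        map_one' := by
          simp only [toAdd_one, AddChar.map_zero_eq_one, Matrix.diagonal_one, Matrix.toLin'_one]
          rfl
        map_mul' := fun x y => by
          rw [Module.End.mul_eq_comp, ← Matrix.toLin'_mul, Matrix.diagonal_mul_diagonal]
          simp only [show (x * y).toAdd = x.toAdd + y.toAdd from rfl, AddChar.map_add_eq_mul] }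
    refine ⟨_, ρ, fun x => ?_⟩
    have h1 : ρ.character (Multiplicative.ofAdd x) = ∑ i, (e.symm i).1 x := by
      change LinearMap.trace ℂ _ (Matrix.toLin' _) = _
      rw [Matrix.trace_toLin'_eq, Matrix.trace_diagonal]
      rfl
    rw [h1, Fintype.sum_equiv e.symm _ (fun p => p.1 x) (fun _ => rfl), Fintype.sum_sigma]
    refine mul_left_cancel₀ card_gl_ne_zero ((sum_fourier_mul a x).symm.trans ?_)
    simp [hm, Finset.mul_sum, mul_assoc]

theorem isInvChar_orbitSum (ψ : AddChar (gl F n) ℂ) : IsInvChar (orbitSum ψ) := by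
  classical
  refine (isInvChar_iff _).2 ⟨fun φ => if φ ∈ charOrbit ψ then 1 else 0, fun φ => ?_⟩
  rw [fourier_orbitSum]
  split_ifs with h <;> simp [h]

theorem orbitSum_ne_zero (ψ : AddChar (gl F n) ℂ) : orbitSum ψ ≠ 0 := by
  classical
  intro h
  have := fourier_orbitSum ψ ψ
  rw [h, map_zero, if_pos (self_mem_charOrbit ψ)] at this
  exact card_gl_ne_zero this.symm

/-- An invariant character splits off the orbit sum of each of its constituents. -/
theorem exists_eq_orbitSum_add {a : C F n} (ha : IsInvChar a) {ψ : AddChar (gl F n) ℂ}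
    (hψ : fourier ψ a ≠ 0) : ∃ b, IsInvChar b ∧ a = orbitSum ψ + b := by
  classical
  obtain ⟨m, hm⟩ := (isInvChar_iff a).1 ha
  refine ⟨a - orbitSum ψ, (isInvChar_iff _).2
    ⟨fun φ => m φ - if φ ∈ charOrbit ψ then 1 else 0, fun φ => ?_⟩, by abel⟩
  rw [map_sub, fourier_orbitSum]
  split_ifs with h
  -- Fourier coefficients are constant on orbits, so the multiplicity is nonzero on the whole orbit
  -- of `ψ` and the natural subtraction there does not truncate.
  · have h1 : 1 ≤ m φ := by
      obtain ⟨g, rfl⟩ := mem_charOrbit.1 h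
      rw [Nat.one_le_iff_ne_zero]
      intro h0
      have := hm (adChar g ψ)
      rw [fourier_adChar, h0, Nat.cast_zero, mul_zero] at this
      exact hψ this
    simp only [hm, if_pos h]
    rw [Nat.cast_sub h1]
    ring
  · simp [hm, h]

theorem exists_fourier_ne_zero {a : C F n} (ha : a ≠ 0) : ∃ ψ, fourier ψ a ≠ 0 := by
  by_contra! h
  exact ha (ext_fourier fun ψ => by rw [h, map_zero])

theorem isIrrInvChar_iff (a : C F n) : IsIrrInvChar a ↔ ∃ ψ, a = orbitSum ψ := by
  classical
  constructor
  · rintro ⟨h1, h2, h3⟩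
    obtain ⟨ψ, hψ⟩ := exists_fourier_ne_zero h2
    obtain ⟨b, hb, e⟩ := exists_eq_orbitSum_add h1 hψ
    rcases h3 _ _ (isInvChar_orbitSum ψ) hb e with h | h
    · exact absurd h (orbitSum_ne_zero ψ)
    · exact ⟨ψ, by rw [e, h, add_zero]⟩
  · rintro ⟨ψ, rfl⟩
    refine ⟨isInvChar_orbitSum ψ, orbitSum_ne_zero ψ, fun g h hg hh e => ?_⟩
    by_contra! hne
    obtain ⟨φ, hφ⟩ := exists_fourier_ne_zero hne.1
    obtain ⟨χ, hχ⟩ := exists_fourier_ne_zero hne.2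
    obtain ⟨m, hm⟩ := (isInvChar_iff g).1 hg
    obtain ⟨l, hl⟩ := (isInvChar_iff h).1 hh
    -- The two multiplicities add up to the indicator of the orbit and each is constant on it. Hence
    -- they cannot both be nonzero.
    have key : ∀ θ : AddChar (gl F n) ℂ, m θ + l θ = if θ ∈ charOrbit ψ then 1 else 0 := by
      intro θ
      have := fourier_orbitSum θ ψ
      rw [e, map_add, hm, hl, ← mul_add, ← mul_one (Fintype.card (gl F n) : ℂ), mul_assoc, one_mul,
        ← mul_zero (Fintype.card (gl F n) : ℂ), ← mul_ite] at this
      exact_mod_cast mul_left_cancel₀ card_gl_ne_zero this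
    have hmφ : m φ ≠ 0 := fun h0 => hφ (by rw [hm, h0, Nat.cast_zero, mul_zero])
    have hlχ : l χ ≠ 0 := fun h0 => hχ (by rw [hl, h0, Nat.cast_zero, mul_zero])
    have hφ' : φ ∈ charOrbit ψ := by
      by_contra h'
      have := key φ
      rw [if_neg h'] at this
      omega
    have hχ' : χ ∈ charOrbit ψ := by
      by_contra h'
      have := key χ
      rw [if_neg h'] at this
      omega
    rw [← charOrbit_eq_of_mem hφ'] at hχ'
    obtain ⟨s, rfl⟩ := mem_charOrbit.1 hχ'
    rw [fourier_adChar] at hχ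
    have h1 := key φ
    rw [if_pos hφ'] at h1
    have hl0 : l φ = 0 := by omega
    exact hχ (by rw [hl, hl0, Nat.cast_zero, mul_zero])

theorem charOrbit_zero : charOrbit (0 : AddChar (gl F n) ℂ) = {0} := by
  ext φ
  rw [mem_charOrbit, Finset.mem_singleton]
  have h : ∀ g : G F n, adChar g (0 : AddChar (gl F n) ℂ) = 0 := fun g => by ext; simp
  simp [h, eq_comm]

theorem orbitSum_zero : orbitSum (0 : AddChar (gl F n) ℂ) = one F n := by
  ext x
  change ∑ φ ∈ charOrbit (0 : AddChar (gl F n) ℂ), φ x = 1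
  rw [charOrbit_zero]
  simp

end Fourier

/-! ### Adjointness and positivity of Harish-Chandra induction -/

section Adjointness

variable {F : Type u} [Field F]

@[simp]
theorem toBlock_ofBlocks {k l n : ℕ} (h : k + l = n) (x : gl F k) (u : Matrix (Fin k) (Fin l) F)
    (y : gl F l) : toBlock h (ofBlocks h x u y) = Matrix.fromBlocks x u 0 y :=
  (toBlock h).apply_symm_apply _

theorem isParabolic_ofBlocks {k l n : ℕ} (h : k + l = n) (x : gl F k)
    (u : Matrix (Fin k) (Fin l) F) (y : gl F l) : IsParabolic h (ofBlocks h x u y) := by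
  rw [IsParabolic, toBlock_ofBlocks]
  rfl

theorem leviProj_ofBlocks {k l n : ℕ} (h : k + l = n) (x : gl F k)
    (u : Matrix (Fin k) (Fin l) F) (y : gl F l) : leviProj h (ofBlocks h x u y) = (x, y) := by
  rw [leviProj, toBlock_ofBlocks]
  rfl

theorem ofBlocks_add {k l n : ℕ} (h : k + l = n) (x x' : gl F k) (u u' : Matrix (Fin k) (Fin l) F)
    (y y' : gl F l) :
    ofBlocks h (x + x') (u + u') (y + y') = ofBlocks h x u y + ofBlocks h x' u' y' := by
  refine (toBlock h).injective ?_
  have : ∀ a b : gl F n, toBlock h (a + b) = toBlock h a + toBlock h b := fun _ _ => rfl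
  rw [this]
  simp [Matrix.fromBlocks_add]

theorem ofBlocks_toBlock {k l n : ℕ} (h : k + l = n) {z : gl F n} (hz : IsParabolic h z) :
    ofBlocks h (toBlock h z).toBlocks₁₁ (toBlock h z).toBlocks₁₂ (toBlock h z).toBlocks₂₂ = z := by
  refine (toBlock h).injective ?_
  rw [toBlock_ofBlocks, ← show (toBlock h z).toBlocks₂₁ = 0 from hz, Matrix.fromBlocks_toBlocks]

theorem det_ofBlocks {k l n : ℕ} (h : k + l = n) (x : gl F k) (u : Matrix (Fin k) (Fin l) F)
    (y : gl F l) : (ofBlocks h x u y).det = x.det * y.det := by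
  rw [ofBlocks, toBlock, Equiv.symm_symm, Matrix.det_reindex_self, Matrix.det_fromBlocks_zero₂₁]

variable [Fintype F] [DecidableEq F]

theorem sum_filter_isParabolic {k l n : ℕ} (h : k + l = n) (f : gl F n → ℂ) :
    ∑ z : gl F n with IsParabolic h z, f z =
      ∑ p : gl F k × gl F l, ∑ u : Matrix (Fin k) (Fin l) F, f (ofBlocks h p.1 u p.2) := by
  rw [← Fintype.sum_prod_type' (f := fun (p : gl F k × gl F l) (u : Matrix (Fin k) (Fin l) F) =>
    f (ofBlocks h p.1 u p.2))]
  refine Finset.sum_bij' (fun z _ => (leviProj h z, (toBlock h z).toBlocks₁₂))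
    (fun p _ => ofBlocks h p.1.1 p.2 p.1.2) ?_ ?_ ?_ ?_ ?_
  · simp
  · intro p _
    simp [isParabolic_ofBlocks]
  · intro z hz
    exact ofBlocks_toBlock h (Finset.mem_filter.1 hz).2
  · intro p _
    simp [leviProj_ofBlocks]
  · intro z hz
    exact congrArg f (ofBlocks_toBlock h (Finset.mem_filter.1 hz).2).symm

theorem card_parabolic {k l n : ℕ} (h : k + l = n) :
    Fintype.card {g : G F n // IsParabolic h (g : gl F n)} =
      Fintype.card (G F k) * Fintype.card (G F l) * Fintype.card (Matrix (Fin k) (Fin l) F) := by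
  rw [← Fintype.card_prod, ← Fintype.card_prod]
  have hdet : ∀ p : (G F k × G F l) × Matrix (Fin k) (Fin l) F,
      (ofBlocks h (p.1.1 : gl F k) p.2 (p.1.2 : gl F l)).det ≠ 0 := fun p => by
    rw [det_ofBlocks]
    exact mul_ne_zero p.1.1.det_ne_zero p.1.2.det_ne_zero
  refine (Fintype.card_congr (Equiv.ofBijective (fun p =>
    ⟨Matrix.GeneralLinearGroup.mkOfDetNeZero _ (hdet p), isParabolic_ofBlocks h _ _ _⟩) ⟨?_, ?_⟩)).symm
  · rintro ⟨⟨a, d⟩, u⟩ ⟨⟨a', d'⟩, u'⟩ e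
    have e1 : ofBlocks h (a : gl F k) u (d : gl F l) = ofBlocks h (a' : gl F k) u' (d' : gl F l) :=
      congrArg (fun g : {g : G F n // IsParabolic h (g : gl F n)} => (g.1 : gl F n)) e
    have e2 := congrArg (toBlock h) e1
    rw [toBlock_ofBlocks, toBlock_ofBlocks, Matrix.fromBlocks_inj] at e2
    rw [Units.ext e2.1, Units.ext e2.2.2.2, e2.2.1]
  · rintro ⟨g, hg⟩
    have e := ofBlocks_toBlock h hg
    have hd : (toBlock h (g : gl F n)).toBlocks₁₁.det * (toBlock h (g : gl F n)).toBlocks₂₂.det ≠ 0 := by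
      rw [← det_ofBlocks h _ (toBlock h (g : gl F n)).toBlocks₁₂, e]
      exact g.det_ne_zero
    refine ⟨⟨⟨Matrix.GeneralLinearGroup.mkOfDetNeZero _ (left_ne_zero_of_mul hd),
      Matrix.GeneralLinearGroup.mkOfDetNeZero _ (right_ne_zero_of_mul hd)⟩,
      (toBlock h (g : gl F n)).toBlocks₁₂⟩, Subtype.ext (Units.ext e)⟩

theorem card_G_ne_zero (n : ℕ) : (Fintype.card (G F n) : ℂ) ≠ 0 :=
  Nat.cast_ne_zero.2 Fintype.card_ne_zero

/-- For each `g` the variable `x` is replaced by its conjugate, which then runs over the block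
triangular matrices. The test function `β` is arbitrary so that the formula serves both the
hermitian form and the Fourier coefficients. -/
theorem sum_hcInd_mul {k l n : ℕ} (h : k + l = n) (φ : C₂ F k l) (β : gl F n → ℂ) :
    ∑ x, (hcInd h φ).1 x * β x =
      (Fintype.card {g : G F n // IsParabolic h (g : gl F n)} : ℂ)⁻¹ *
        ∑ g : G F n, ∑ p : gl F k × gl F l, φ.1 p *
          ∑ u : Matrix (Fin k) (Fin l) F, β (ad g (ofBlocks h p.1 u p.2)) := by
  have h1 : ∀ x, (hcInd h φ).1 x * β x =
      (Fintype.card {g : G F n // IsParabolic h (g : gl F n)} : ℂ)⁻¹ *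
        ∑ g : G F n, (if IsParabolic h (ad g x) then φ.1 (leviProj h (ad g x)) else 0) * β x := by
    intro x
    rw [← Finset.sum_mul, ← mul_assoc, ← Finset.sum_filter]
    rfl
  rw [Finset.sum_congr rfl fun x _ => h1 x, ← Finset.mul_sum, Finset.sum_comm,
    -- Summing over `g⁻¹` instead of `g` leaves `ad g`, rather than its inverse, in the argument of
    -- `β`.
    ← Equiv.sum_comp (Equiv.inv (G F n))]
  congr 1
  refine Finset.sum_congr rfl fun g _ => ?_
  rw [← Equiv.sum_comp (adEquiv g)]
  have h2 : ∀ x : gl F n, ad ((Equiv.inv (G F n)) g) (adEquiv g x) = x :=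
    (adEquiv g).left_inv
  simp only [h2, ite_mul, zero_mul]
  rw [← Finset.sum_filter, sum_filter_isParabolic]
  simp only [leviProj_ofBlocks, Finset.mul_sum]
  rfl

/-- The hermitian form on the invariant functions on `gl_k × gl_l`. -/
noncomputable def herm₂ {k l : ℕ} (φ ψ : C₂ F k l) : ℂ :=
  (Fintype.card (G F k) : ℂ)⁻¹ * (Fintype.card (G F l) : ℂ)⁻¹ *
    ∑ p : gl F k × gl F l, φ.1 p * (starRingEnd ℂ) (ψ.1 p)

theorem herm₂_boxTimes {k l : ℕ} (a a' : C F k) (b b' : C F l) :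
    herm₂ (boxTimes F k l (a ⊗ₜ b)) (boxTimes F k l (a' ⊗ₜ b')) = herm F a a' * herm F b b' := by
  rw [herm₂, herm, herm, mul_mul_mul_comm, Finset.sum_mul_sum, Fintype.sum_prod_type]
  congr 1
  refine Finset.sum_congr rfl fun x _ => Finset.sum_congr rfl fun y _ => ?_
  rw [boxTimes_tmul, boxTimes_tmul, map_mul]
  ring

/-- Harish-Chandra induction is adjoint to Harish-Chandra restriction. -/
theorem herm_hcInd {k l n : ℕ} (h : k + l = n) (φ : C₂ F k l) (a : C F n) :
    herm F (hcInd h φ) a = herm₂ φ (hcRes h a) := by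
  rw [herm, sum_hcInd_mul h φ (fun x => (starRingEnd ℂ) (a.1 x)), herm₂, card_parabolic]
  have h1 : ∀ p : gl F k × gl F l, (starRingEnd ℂ) ((hcRes h a).1 p) =
      (Fintype.card (Matrix (Fin k) (Fin l) F) : ℂ)⁻¹ *
        ∑ u : Matrix (Fin k) (Fin l) F, (starRingEnd ℂ) (a.1 (ofBlocks h p.1 u p.2)) := by
    intro p
    change (starRingEnd ℂ) (_ * _) = _
    simp
  have h2 : ∀ (g : G F n) (x : gl F n), a.1 (ad g x) = a.1 x := fun g x => a.2 g x
  simp only [h1, h2, Finset.sum_const, Finset.card_univ, nsmul_eq_mul]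
  have c := card_G_ne_zero (F := F) n
  rw [mul_left_comm, inv_mul_cancel_left₀ c]
  push_cast
  simp only [mul_inv, mul_left_comm _ (_⁻¹ : ℂ), ← Finset.mul_sum]
  ring

open scoped ComplexOrder in
/-- Nonnegativity of all Fourier coefficients. -/
def IsPos {n : ℕ} (a : C F n) : Prop := ∀ ψ, 0 ≤ fourier ψ a

-- For each `g`, the character `ψ ∘ ad g` restricted to block triangular matrices is a product of
-- characters of the two diagonal blocks and of the upper right block. The sum becomes a Fourier
-- coefficient of `a`, times one of `b`, times a full character sum that is either zero or the
-- number of `k × l` matrices.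
open scoped ComplexOrder in
theorem isPos_hcInd {k l n : ℕ} (h : k + l = n) {a : C F k} {b : C F l} (ha : IsPos a)
    (hb : IsPos b) : IsPos (hcInd h (boxTimes F k l (a ⊗ₜ b))) := by
  intro ψ
  rw [fourier_apply, sum_hcInd_mul h _ (fun x => ψ (-x))]
  refine mul_nonneg (by positivity) (Finset.sum_nonneg fun g _ => ?_)
  let ψ₁ : AddChar (gl F k) ℂ :=
    { toFun := fun x => ψ (ad g (ofBlocks h x 0 0))
      map_zero_eq_one' := by simp [ad, ofBlocks, toBlock]
      map_add_eq_mul' := fun x y => by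
        rw [← AddChar.map_add_eq_mul]
        congr 1
        have := ofBlocks_add h x y 0 0 0 0
        rw [add_zero, add_zero] at this
        rw [this]
        simp [ad, mul_add, add_mul] }
  let ψ₂ : AddChar (gl F l) ℂ :=
    { toFun := fun x => ψ (ad g (ofBlocks h 0 0 x))
      map_zero_eq_one' := by simp [ad, ofBlocks, toBlock]
      map_add_eq_mul' := fun x y => by
        rw [← AddChar.map_add_eq_mul]
        congr 1
        have := ofBlocks_add h 0 0 0 0 x y
        rw [add_zero, add_zero] at this
        rw [this]
        simp [ad, mul_add, add_mul] }
  let ψ₃ : AddChar (Matrix (Fin k) (Fin l) F) ℂ :=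
    { toFun := fun x => ψ (ad g (ofBlocks h 0 x 0))
      map_zero_eq_one' := by simp [ad, ofBlocks, toBlock]
      map_add_eq_mul' := fun x y => by
        rw [← AddChar.map_add_eq_mul]
        congr 1
        have := ofBlocks_add h 0 0 x y 0 0
        rw [add_zero, add_zero] at this
        rw [this]
        simp [ad, mul_add, add_mul] }
  have key : ∀ (x : gl F k) (u : Matrix (Fin k) (Fin l) F) (y : gl F l),
      ψ (-(ad g (ofBlocks h x u y))) = ψ₁ (-x) * ψ₂ (-y) * ψ₃ (-u) := by
    intro x u y
    change _ = ψ _ * ψ _ * ψ _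
    rw [← AddChar.map_add_eq_mul, ← AddChar.map_add_eq_mul]
    congr 1
    have h1 : ofBlocks h (-x) (-u) (-y) =
        ofBlocks h (-x) 0 0 + ofBlocks h 0 0 (-y) + ofBlocks h 0 (-u) 0 := by
      rw [← ofBlocks_add, ← ofBlocks_add]
      simp
    have h2 : ofBlocks h (-x) (-u) (-y) = - ofBlocks h x u y := by
      refine eq_neg_of_add_eq_zero_left ?_
      rw [← ofBlocks_add]
      simp [ofBlocks, toBlock]
    have h3 : ∀ s t : gl F n, ad g (s + t) = ad g s + ad g t := fun s t => by
      simp [ad, mul_add, add_mul]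
    rw [← h3, ← h3, ← h1, h2, ad_neg]
  have e : ∑ p : gl F k × gl F l, (boxTimes F k l (a ⊗ₜ b)).1 p *
      ∑ u : Matrix (Fin k) (Fin l) F, ψ (-(ad g (ofBlocks h p.1 u p.2))) =
        fourier ψ₁ a * fourier ψ₂ b * ∑ u, ψ₃ u := by
    simp only [key, ← Finset.mul_sum]
    rw [← Equiv.sum_comp (Equiv.neg (Matrix (Fin k) (Fin l) F)) ψ₃, fourier_apply, fourier_apply,
      Finset.sum_mul_sum, Finset.sum_mul, Fintype.sum_prod_type]
    refine Finset.sum_congr rfl fun x _ => ?_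
    rw [Finset.sum_mul]
    refine Finset.sum_congr rfl fun y _ => ?_
    rw [boxTimes_tmul]
    simp only [Equiv.neg_apply]
    ring
  rw [e]
  refine mul_nonneg (mul_nonneg (ha _) (hb _)) ?_
  rw [AddChar.sum_eq_ite]
  split_ifs <;> simp

end Adjointness

/-! ### The orthonormal basis `Ω(q)` and its structure constants -/

section OrthonormalBasis

variable {F : Type u} [Field F] [Fintype F] [DecidableEq F]

/-- The conjugate of a character is its value at the negative, so each member of the orbit
contributes a Fourier coefficient of `a`, and these all coincide by invariance. -/
theorem herm_orbitSum {n : ℕ} (a : C F n) (ψ : AddChar (gl F n) ℂ) :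
    herm F a (orbitSum ψ) =
      (Fintype.card (G F n) : ℂ)⁻¹ * ((charOrbit ψ).card * fourier ψ a) := by
  rw [herm]
  congr 1
  have h1 : ∀ φ ∈ charOrbit ψ, fourier φ a = fourier ψ a := by
    intro φ hφ
    obtain ⟨g, rfl⟩ := mem_charOrbit.1 hφ
    exact fourier_adChar g ψ a
  rw [← nsmul_eq_mul, ← Finset.sum_const, ← Finset.sum_congr rfl h1]
  simp only [fourier_apply]
  rw [Finset.sum_comm]
  refine Finset.sum_congr rfl fun x _ => ?_
  change a.1 x * (starRingEnd ℂ) (∑ φ ∈ charOrbit ψ, φ x) = _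
  rw [map_sum, Finset.mul_sum]
  simp only [AddChar.map_neg_eq_conj]

/-- The squared norm of `orbitSum ψ`. -/
noncomputable def orbitNormSq {n : ℕ} (ψ : AddChar (gl F n) ℂ) : ℝ :=
  (Fintype.card (G F n) : ℝ)⁻¹ * ((charOrbit ψ).card * Fintype.card (gl F n))

theorem orbitNormSq_pos {n : ℕ} (ψ : AddChar (gl F n) ℂ) : 0 < orbitNormSq ψ := by
  have h1 : 0 < (charOrbit ψ).card := Finset.card_pos.2 ⟨ψ, self_mem_charOrbit ψ⟩
  have h2 : 0 < Fintype.card (gl F n) := Fintype.card_pos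
  have h3 : 0 < Fintype.card (G F n) := Fintype.card_pos
  unfold orbitNormSq
  positivity

theorem herm_orbitSum_self {n : ℕ} (ψ : AddChar (gl F n) ℂ) :
    herm F (orbitSum ψ) (orbitSum ψ) = orbitNormSq ψ := by
  rw [herm_orbitSum, fourier_orbitSum, if_pos (self_mem_charOrbit ψ), orbitNormSq]
  push_cast
  rfl

/-- The normalised irreducible invariant character given by the orbit of `ψ`. -/
noncomputable def normChar {n : ℕ} (ψ : AddChar (gl F n) ℂ) : C F n :=
  (((√(orbitNormSq ψ))⁻¹ : ℝ) : ℂ) • orbitSum ψ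

theorem inDeg_normChar_mem {n : ℕ} (ψ : AddChar (gl F n) ℂ) :
    inDeg F n (normChar ψ) ∈ OmegaDeg F n := by
  refine ⟨orbitSum ψ, (isIrrInvChar_iff _).2 ⟨ψ, rfl⟩, ?_⟩
  rw [herm_orbitSum_self, Complex.ofReal_re]
  rfl

/-- The element of `Ω(q)` given by an additive character. -/
noncomputable def mkOmega (n : ℕ) (ψ : AddChar (gl F n) ℂ) : Omega F :=
  ⟨inDeg F n (normChar ψ), Set.mem_iUnion.2 ⟨n, inDeg_normChar_mem ψ⟩⟩

theorem coe_mkOmega (n : ℕ) (ψ : AddChar (gl F n) ℂ) :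
    (mkOmega n ψ : CC F) = inDeg F n (normChar ψ) := rfl

theorem mem_OmegaDeg {n : ℕ} {w : CC F} (hw : w ∈ OmegaDeg F n) :
    ∃ ψ : AddChar (gl F n) ℂ, w = mkOmega n ψ := by
  obtain ⟨χ, hχ, rfl⟩ := hw
  obtain ⟨ψ, rfl⟩ := (isIrrInvChar_iff _).1 hχ
  refine ⟨ψ, ?_⟩
  rw [herm_orbitSum_self, Complex.ofReal_re]
  rfl

theorem exists_eq_mkOmega (w : Omega F) : ∃ (n : ℕ) (ψ : AddChar (gl F n) ℂ), w = mkOmega n ψ := by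
  obtain ⟨n, hn⟩ := Set.mem_iUnion.1 w.2
  obtain ⟨ψ, hψ⟩ := mem_OmegaDeg hn
  exact ⟨n, ψ, Subtype.ext hψ⟩

theorem herm_smul_right {n : ℕ} (r : ℝ) (a b : C F n) :
    herm F a ((r : ℂ) • b) = r * herm F a b := by
  rw [herm, herm, mul_left_comm]
  congr 1
  rw [Finset.mul_sum]
  refine Finset.sum_congr rfl fun x _ => ?_
  change a.1 x * (starRingEnd ℂ) ((r : ℂ) * b.1 x) = _
  rw [map_mul, Complex.conj_ofReal]
  ring

/-- The hermitian form, as a linear form in the first variable. -/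
noncomputable def hermLeft {n : ℕ} (b : C F n) : C F n →ₗ[ℂ] ℂ where
  toFun a := herm F a b
  map_add' a a' := by simp [herm, add_mul, Finset.sum_add_distrib, mul_add]
  map_smul' c a := by
    rw [RingHom.id_apply, smul_eq_mul, herm, herm, mul_left_comm]
    congr 1
    rw [Finset.mul_sum]
    refine Finset.sum_congr rfl fun x _ => ?_
    exact mul_assoc c (a.1 x) _

theorem herm_normChar {n : ℕ} (a : C F n) (ψ : AddChar (gl F n) ℂ) :
    herm F a (normChar ψ) = ((√(orbitNormSq ψ))⁻¹ : ℝ) *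
      ((Fintype.card (G F n) : ℂ)⁻¹ * ((charOrbit ψ).card * fourier ψ a)) := by
  rw [normChar, herm_smul_right, herm_orbitSum]

theorem herm_normChar_self {n : ℕ} (ψ : AddChar (gl F n) ℂ) :
    herm F (normChar ψ) (normChar ψ) = 1 := by
  have h0 := orbitNormSq_pos ψ
  have h : herm F (normChar ψ) (orbitSum ψ) =
      ((√(orbitNormSq ψ))⁻¹ : ℝ) * herm F (orbitSum ψ) (orbitSum ψ) :=
    (hermLeft (orbitSum ψ)).map_smul _ _
  rw [show herm F (normChar ψ) (normChar ψ) = herm F (normChar ψ)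
    ((((√(orbitNormSq ψ))⁻¹ : ℝ) : ℂ) • orbitSum ψ) from rfl, herm_smul_right, h, herm_orbitSum_self, ← Complex.ofReal_mul, ← Complex.ofReal_mul,
    ← Complex.ofReal_one]
  congr 1
  have h1 := Real.mul_self_sqrt h0.le
  have h2 := (Real.sqrt_pos.2 h0).ne'
  field_simp
  rw [sq, h1]

theorem herm_normChar_of_notMem {n : ℕ} {φ ψ : AddChar (gl F n) ℂ} (h : ψ ∉ charOrbit φ) :
    herm F (normChar φ) (normChar ψ) = 0 := by
  rw [herm_normChar, normChar, map_smul, fourier_orbitSum, if_neg h]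
  simp

theorem normChar_eq_of_mem {n : ℕ} {φ ψ : AddChar (gl F n) ℂ} (h : ψ ∈ charOrbit φ) :
    normChar ψ = normChar φ := by
  have h1 := charOrbit_eq_of_mem h
  have h2 : orbitSum ψ = orbitSum φ := Subtype.ext (funext fun x => by
    change ∑ χ ∈ charOrbit ψ, χ x = ∑ χ ∈ charOrbit φ, χ x
    rw [h1])
  rw [normChar, normChar, h2, orbitNormSq, orbitNormSq, h1]

theorem normChar_ne_zero {n : ℕ} (ψ : AddChar (gl F n) ℂ) : normChar ψ ≠ 0 := by
  intro h
  have h1 := herm_normChar_self ψ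
  rw [h] at h1
  exact zero_ne_one ((hermLeft (0 : C F n)).map_zero.symm.trans h1)

/-- The degree of an element of `Ω(q)`. -/
noncomputable def omegaDegree (w : Omega F) : ℕ := (exists_eq_mkOmega w).choose

theorem inDeg_apply_self {n : ℕ} (a : C F n) : inDeg F n a n = a :=
  DirectSum.of_eq_same (β := fun n => C F n) _ _

theorem inDeg_apply_of_ne {n m : ℕ} (h : m ≠ n) (a : C F n) : inDeg F n a m = 0 :=
  DirectSum.of_eq_of_ne (β := fun n => C F n) _ _ _ h

@[simp]
theorem omegaDegree_mkOmega (n : ℕ) (ψ : AddChar (gl F n) ℂ) : omegaDegree (mkOmega n ψ) = n := by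
  obtain ⟨φ, hφ⟩ := (exists_eq_mkOmega (mkOmega n ψ)).choose_spec
  change (exists_eq_mkOmega (mkOmega n ψ)).choose = n
  by_contra h
  have h1 := congrArg (fun w : Omega F => (w : CC F) n) hφ
  dsimp only at h1
  rw [coe_mkOmega, coe_mkOmega, inDeg_apply_self, inDeg_apply_of_ne (Ne.symm h)] at h1
  exact normChar_ne_zero ψ h1

theorem exists_mkOmega_degree (w : Omega F) :
    ∃ ψ : AddChar (gl F (omegaDegree w)) ℂ, w = mkOmega (omegaDegree w) ψ :=
  (exists_eq_mkOmega w).choose_spec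

/-- The coefficient of `w` in an element of `C(q)`. -/
noncomputable def omegaCoeff (w : Omega F) : CC F →ₗ[ℂ] ℂ :=
  hermLeft ((w : CC F) (omegaDegree w)) ∘ₗ
    DirectSum.component ℂ ℕ (fun n => C F n) (omegaDegree w)

theorem omegaCoeff_mkOmega (n : ℕ) (ψ : AddChar (gl F n) ℂ) (a : CC F) :
    omegaCoeff (mkOmega n ψ) a = herm F (a n) (normChar ψ) := by
  change herm F (a _) ((mkOmega n ψ : CC F) _) = _
  rw [omegaDegree_mkOmega, coe_mkOmega, inDeg_apply_self]

theorem omegaCoeff_inDeg_of_ne {n : ℕ} {w : Omega F} (h : omegaDegree w ≠ n) (a : C F n) :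
    omegaCoeff w (inDeg F n a) = 0 := by
  change hermLeft ((w : CC F) (omegaDegree w)) (inDeg F n a (omegaDegree w)) = 0
  rw [inDeg_apply_of_ne h, map_zero]

open Classical in
theorem omegaCoeff_coe (w w' : Omega F) : omegaCoeff w w' = if w = w' then 1 else 0 := by
  obtain ⟨n, ψ, rfl⟩ := exists_eq_mkOmega w
  obtain ⟨m, φ, rfl⟩ := exists_eq_mkOmega w'
  by_cases hnm : n = m
  · subst hnm
    rw [omegaCoeff_mkOmega, coe_mkOmega, inDeg_apply_self]
    by_cases h : ψ ∈ charOrbit φ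
    · have e : mkOmega n ψ = mkOmega n φ := Subtype.ext (by
        rw [coe_mkOmega, coe_mkOmega, normChar_eq_of_mem h])
      rw [if_pos e, normChar_eq_of_mem h, herm_normChar_self]
    · rw [herm_normChar_of_notMem h, if_neg]
      intro e
      have e1 := congrArg (fun w : Omega F => (w : CC F) n) e
      dsimp only at e1
      rw [coe_mkOmega, coe_mkOmega, inDeg_apply_self, inDeg_apply_self] at e1
      have := herm_normChar_of_notMem h
      rw [e1, herm_normChar_self] at this
      exact one_ne_zero this
  · rw [coe_mkOmega, omegaCoeff_inDeg_of_ne (by simpa using hnm), if_neg]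
    intro e
    exact hnm (by simpa using congrArg omegaDegree e)

open Classical in
/-- The elements of `Ω(q)` of degree `n`. -/
noncomputable def omegaFin (F : Type u) [Field F] [Fintype F] [DecidableEq F] (n : ℕ) :
    Finset (Omega F) := Finset.univ.image (mkOmega n)

open Classical in
theorem mem_omegaFin {n : ℕ} {w : Omega F} : w ∈ omegaFin F n ↔ omegaDegree w = n := by
  rw [omegaFin, Finset.mem_image]
  constructor
  · rintro ⟨ψ, _, rfl⟩
    simp
  · rintro rfl
    obtain ⟨ψ, hψ⟩ := exists_mkOmega_degree w
    exact ⟨ψ, Finset.mem_univ _, hψ.symm⟩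

theorem eq_zero_of_omegaCoeff {n : ℕ} {a : C F n}
    (h : ∀ w ∈ omegaFin F n, omegaCoeff w (inDeg F n a) = 0) : a = 0 := by
  refine ext_fourier fun ψ => ?_
  have h1 := h (mkOmega n ψ) (mem_omegaFin.2 (by simp))
  rw [omegaCoeff_mkOmega, inDeg_apply_self, herm_normChar] at h1
  rw [map_zero]
  have c1 : (((√(orbitNormSq ψ))⁻¹ : ℝ) : ℂ) ≠ 0 :=
    Complex.ofReal_ne_zero.2 (inv_ne_zero (Real.sqrt_pos.2 (orbitNormSq_pos ψ)).ne')
  have c2 : ((charOrbit ψ).card : ℂ) ≠ 0 :=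
    Nat.cast_ne_zero.2 (Finset.card_pos.2 ⟨ψ, self_mem_charOrbit ψ⟩).ne'
  exact (mul_eq_zero.1 ((mul_eq_zero.1 ((mul_eq_zero.1 h1).resolve_left c1)).resolve_left
    (inv_ne_zero (card_G_ne_zero n)))).resolve_left c2

theorem coe_eq_inDeg {n : ℕ} {w : Omega F} (hw : w ∈ omegaFin F n) :
    inDeg F n ((w : CC F) n) = w := by
  obtain ⟨m, ψ, rfl⟩ := exists_eq_mkOmega w
  obtain rfl : m = n := by simpa using mem_omegaFin.1 hw
  rw [coe_mkOmega, inDeg_apply_self]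

/-- Completeness: the difference of the two sides is orthogonal to every orbit sum, so all its
Fourier coefficients vanish. -/
theorem inDeg_eq_sum {n : ℕ} (a : C F n) :
    inDeg F n a = ∑ w ∈ omegaFin F n, omegaCoeff w (inDeg F n a) • (w : CC F) := by
  classical
  set b : C F n := a - ∑ w ∈ omegaFin F n, omegaCoeff w (inDeg F n a) • ((w : CC F) n) with hb
  have e : inDeg F n b = inDeg F n a -
      ∑ w ∈ omegaFin F n, omegaCoeff w (inDeg F n a) • (w : CC F) := by
    rw [hb, map_sub, map_sum]
    congr 1
    refine Finset.sum_congr rfl fun w hw => ?_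
    rw [map_smul, coe_eq_inDeg hw]
  have h0 : b = 0 := by
    refine eq_zero_of_omegaCoeff fun w hw => ?_
    rw [e, map_sub, map_sum, Finset.sum_eq_single w]
    · rw [map_smul, omegaCoeff_coe, if_pos rfl, smul_eq_mul, mul_one, sub_self]
    · intro w' _ hw'
      rw [map_smul, omegaCoeff_coe, if_neg hw'.symm, smul_zero]
    · exact fun h => absurd hw h
  rw [h0, map_zero] at e
  exact (sub_eq_zero.1 e.symm)

open scoped ComplexOrder in
theorem isPos_normChar {n : ℕ} (ψ : AddChar (gl F n) ℂ) : IsPos (normChar ψ) := by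
  intro φ
  rw [normChar, map_smul, fourier_orbitSum, smul_eq_mul]
  have : (0 : ℂ) ≤ (((√(orbitNormSq ψ))⁻¹ : ℝ) : ℂ) := Complex.zero_le_real.2 (by positivity)
  refine mul_nonneg this ?_
  split_ifs <;> positivity

open scoped ComplexOrder in
theorem omegaCoeff_nonneg {n : ℕ} {a : C F n} (ha : IsPos a) (w : Omega F) :
    0 ≤ omegaCoeff w (inDeg F n a) := by
  by_cases h : omegaDegree w = n
  · obtain ⟨ψ, hψ⟩ := exists_mkOmega_degree w
    rw [hψ, omegaCoeff_mkOmega, herm_normChar]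
    have : (0 : ℂ) ≤ (((√(orbitNormSq ψ))⁻¹ : ℝ) : ℂ) := Complex.zero_le_real.2 (by positivity)
    subst h
    rw [inDeg_apply_self]
    exact mul_nonneg this (mul_nonneg (by positivity) (mul_nonneg (by positivity) (ha ψ)))
  · rw [omegaCoeff_inDeg_of_ne h]

/-- The structure constant of `Ω(q)`: the coefficient of `w` in the product of `u` and `v`. -/
noncomputable def structConst (u v w : Omega F) : ℝ := (omegaCoeff w (mul F u v)).re

open scoped ComplexOrder in
theorem omegaCoeff_mul_nonneg (u v w : Omega F) : 0 ≤ omegaCoeff w (mul F u v) := by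
  obtain ⟨k, φ, rfl⟩ := exists_eq_mkOmega u
  obtain ⟨l, ψ, rfl⟩ := exists_eq_mkOmega v
  rw [coe_mkOmega, coe_mkOmega, mul_inDeg]
  exact omegaCoeff_nonneg (isPos_hcInd rfl (isPos_normChar φ) (isPos_normChar ψ)) w

theorem structConst_nonneg (u v w : Omega F) : 0 ≤ structConst u v w :=
  (Complex.nonneg_iff.1 (omegaCoeff_mul_nonneg u v w)).1

/-- In the order on `ℂ`, being nonnegative includes being real, so positivity of induction is also
what makes the structure constants real. -/
theorem coe_structConst (u v w : Omega F) : (structConst u v w : ℂ) = omegaCoeff w (mul F u v) :=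
  Complex.ext rfl (Complex.nonneg_iff.1 (omegaCoeff_mul_nonneg u v w)).2

theorem structConst_of_ne {u v w : Omega F} (h : omegaDegree w ≠ omegaDegree u + omegaDegree v) :
    structConst u v w = 0 := by
  obtain ⟨k, φ, rfl⟩ := exists_eq_mkOmega u
  obtain ⟨l, ψ, rfl⟩ := exists_eq_mkOmega v
  rw [omegaDegree_mkOmega, omegaDegree_mkOmega] at h
  rw [structConst, coe_mkOmega, coe_mkOmega, mul_inDeg, omegaCoeff_inDeg_of_ne h, Complex.zero_re]

theorem mul_coe_coe (u v : Omega F) : mul F u v =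
    ∑ w ∈ omegaFin F (omegaDegree u + omegaDegree v), (structConst u v w : ℂ) • (w : CC F) := by
  simp only [coe_structConst]
  obtain ⟨k, φ, rfl⟩ := exists_eq_mkOmega u
  obtain ⟨l, ψ, rfl⟩ := exists_eq_mkOmega v
  rw [coe_mkOmega, coe_mkOmega, mul_inDeg, omegaDegree_mkOmega, omegaDegree_mkOmega]
  exact inDeg_eq_sum _

theorem tensor_eq_sum {k l : ℕ} (t : C F k ⊗[ℂ] C F l) :
    TensorProduct.map (inDeg F k) (inDeg F l) t =
      ∑ u ∈ omegaFin F k, ∑ v ∈ omegaFin F l,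
        herm₂ (boxTimes F k l t) (boxTimes F k l (((u : CC F) k) ⊗ₜ ((v : CC F) l))) •
          ((u : CC F) ⊗ₜ[ℂ] (v : CC F)) := by
  have hadd : ∀ φ φ' χ : C₂ F k l, herm₂ (φ + φ') χ = herm₂ φ χ + herm₂ φ' χ := by
    intro φ φ' χ
    simp [herm₂, add_mul, Finset.sum_add_distrib, mul_add]
  induction t with
  | zero =>
    simp [herm₂]
  | add s t hs ht =>
    rw [map_add, hs, ht]
    simp only [map_add, hadd, add_smul, Finset.sum_add_distrib]
  | tmul a b =>
    rw [TensorProduct.map_tmul]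
    conv_lhs => rw [inDeg_eq_sum a, inDeg_eq_sum b]
    rw [TensorProduct.sum_tmul]
    refine Finset.sum_congr rfl fun u hu => ?_
    rw [TensorProduct.tmul_sum]
    refine Finset.sum_congr rfl fun v hv => ?_
    rw [TensorProduct.smul_tmul_smul, herm₂_boxTimes]
    have hu' := mem_omegaFin.1 hu
    have hv' := mem_omegaFin.1 hv
    subst hu' hv'
    congr 2
    · change hermLeft _ (inDeg F _ a _) = _
      rw [inDeg_apply_self]
      rfl
    · change hermLeft _ (inDeg F _ b _) = _
      rw [inDeg_apply_self]
      rfl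

theorem herm₂_conj {k l : ℕ} (φ χ : C₂ F k l) : (starRingEnd ℂ) (herm₂ φ χ) = herm₂ χ φ := by
  simp [herm₂, mul_comm]

/-- The coefficient of `u ⊗ v` is the hermitian product of the restriction of `w` with `u ⊠ v`.
Adjointness turns it into the conjugate of the coefficient of `w` in `u v`, and the conjugation is
harmless because that coefficient is real. -/
theorem comul_coe (w : Omega F) : comul F w =
    ∑ p ∈ Finset.HasAntidiagonal.antidiagonal (omegaDegree w),
      ∑ u ∈ omegaFin F p.1, ∑ v ∈ omegaFin F p.2,
        (structConst u v w : ℂ) • ((u : CC F) ⊗ₜ[ℂ] (v : CC F)) := by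
  obtain ⟨n, ψ, rfl⟩ := exists_eq_mkOmega w
  rw [omegaDegree_mkOmega, ← Finset.sum_coe_sort, coe_mkOmega, comul_inDeg]
  refine Finset.sum_congr rfl fun p _ => ?_
  rw [tensor_eq_sum]
  refine Finset.sum_congr rfl fun u hu => Finset.sum_congr rfl fun v hv => ?_
  congr 1
  rw [boxTimes_boxEquiv_symm, ← herm₂_conj, ← herm_hcInd, ← Complex.conj_ofReal, coe_structConst,
    omegaCoeff_mkOmega]
  congr 1
  conv_rhs => rw [← coe_eq_inDeg hu, ← coe_eq_inDeg hv, mul_inDeg]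
  obtain ⟨⟨k, l⟩, hp⟩ := p
  have hp' := Finset.HasAntidiagonal.mem_antidiagonal.1 hp
  dsimp only at hp' ⊢
  subst hp'
  rw [inDeg_apply_self]

end OrthonormalBasis

end InvFun

/-! ### Coalgebra structure dual to an algebra with an orthonormal basis -/

section Duality

variable {R : Type*} [CommRing R]

/-- The linear form `f ⊗ g` on `M ⊗ N`. -/
noncomputable def pairForm {M N : Type*} [AddCommGroup M] [Module R M] [AddCommGroup N] [Module R N]
    (f : M →ₗ[R] R) (g : N →ₗ[R] R) : M ⊗[R] N →ₗ[R] R :=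
  LinearMap.mul' R R ∘ₗ TensorProduct.map f g

@[simp]
theorem pairForm_tmul {M N : Type*} [AddCommGroup M] [Module R M] [AddCommGroup N] [Module R N]
    (f : M →ₗ[R] R) (g : N →ₗ[R] R) (x : M) (y : N) : pairForm f g (x ⊗ₜ y) = f x * g y := rfl

theorem pairForm_coord {M N I J : Type*} [AddCommGroup M] [Module R M] [AddCommGroup N]
    [Module R N] (b : Module.Basis I R M) (c : Module.Basis J R N) (i : I) (j : J) :
    pairForm (b.coord i) (c.coord j) = (b.tensorProduct c).coord (i, j) :=
  TensorProduct.ext' fun x y => by simp [mul_comm]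

theorem ext_pairForm {M N I J : Type*} [AddCommGroup M] [Module R M] [AddCommGroup N]
    [Module R N] (b : Module.Basis I R M) (c : Module.Basis J R N) {s t : M ⊗[R] N}
    (h : ∀ i j, pairForm (b.coord i) (c.coord j) s = pairForm (b.coord i) (c.coord j) t) :
    s = t := by
  refine (b.tensorProduct c).ext_elem fun p => ?_
  have := h p.1 p.2
  rwa [pairForm_coord] at this

variable {H I : Type*} [Ring H] [Algebra R H] (Ω : Module.Basis I R H)

theorem basisForm_apply_basis (i : I) : basisForm Ω (Ω i) = Ω.coord i := by
  classical
  exact Module.Basis.coe_toDual_self Ω i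

theorem basisForm_comm (x y : H) : basisForm Ω x y = basisForm Ω y x := by
  classical
  have : basisForm Ω = (basisForm Ω).flip := by
    refine Ω.ext fun i => Ω.ext fun j => ?_
    simp [basisForm_apply_basis, Finsupp.single_apply, eq_comm]
  exact LinearMap.congr_fun₂ this x y

theorem basisForm_tensorProduct_tmul (x y : H) :
    basisForm (Ω.tensorProduct Ω) (x ⊗ₜ y) = pairForm (basisForm Ω x) (basisForm Ω y) := by
  refine LinearMap.ext fun t => ?_
  induction t with
  | zero => simp
  | add s t hs ht => rw [map_add, map_add, hs, ht]
  | tmul z w =>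
    have key : (LinearMap.mk₂ R (fun x y => basisForm (Ω.tensorProduct Ω) (x ⊗ₜ y) (z ⊗ₜ[R] w))
        (by simp [TensorProduct.add_tmul]) (by simp [← TensorProduct.smul_tmul'])
        (by simp [TensorProduct.tmul_add]) (by simp)) =
        LinearMap.mk₂ R (fun x y => basisForm Ω x z * basisForm Ω y w)
        (by simp [add_mul]) (by simp [mul_assoc]) (by simp [mul_add])
        (by intro c a b; simp [mul_left_comm]) := by
      refine Ω.ext fun i => Ω.ext fun j => ?_
      classical
      simp only [LinearMap.mk₂_apply, basisForm_apply_basis, ← pairForm_tmul, pairForm_coord,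
        ← Module.Basis.tensorProduct_apply]
    exact LinearMap.congr_fun₂ key x y

variable {Ω} {Δ : H →ₗ[R] H ⊗[R] H}

/-- Pairing with triples of basis elements separates the points of the threefold tensor product, and
under this pairing the two sides become `(Ω i * Ω j) * Ω k` and `Ω i * (Ω j * Ω k)`. -/
theorem coassoc_of_adjoint
    (hΔ : ∀ a b x : H, pairForm (basisForm Ω a) (basisForm Ω b) (Δ x) = basisForm Ω (a * b) x) :
    TensorProduct.assoc R H H H ∘ₗ Δ.rTensor H ∘ₗ Δ = Δ.lTensor H ∘ₗ Δ := by
  refine LinearMap.ext fun x => ext_pairForm Ω (Ω.tensorProduct Ω) ?_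
  rintro i ⟨j, k⟩
  rw [← pairForm_coord]
  have h1 : ∀ f g h : H →ₗ[R] R, pairForm f (pairForm g h) ∘ₗ
      (TensorProduct.assoc R H H H).toLinearMap = pairForm (pairForm f g) h := fun f g h =>
    TensorProduct.ext_threefold fun a b c => by simp [mul_assoc]
  have h2 : ∀ (f : H ⊗[R] H →ₗ[R] R) (g : H →ₗ[R] R),
      pairForm f g ∘ₗ Δ.rTensor H = pairForm (f ∘ₗ Δ) g := fun f g =>
    TensorProduct.ext' fun a b => by simp
  have h3 : ∀ (f : H ⊗[R] H →ₗ[R] R) (g : H →ₗ[R] R),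
      pairForm g f ∘ₗ Δ.lTensor H = pairForm g (f ∘ₗ Δ) := fun f g =>
    TensorProduct.ext' fun a b => by simp
  have h4 : ∀ a b : H, pairForm (basisForm Ω a) (basisForm Ω b) ∘ₗ Δ = basisForm Ω (a * b) :=
    fun a b => LinearMap.ext fun x => hΔ a b x
  simp only [← basisForm_apply_basis]
  have e1 := LinearMap.congr_fun (h1 (basisForm Ω (Ω i)) (basisForm Ω (Ω j)) (basisForm Ω (Ω k)))
    (Δ.rTensor H (Δ x))
  have e2 := LinearMap.congr_fun (h2 (pairForm (basisForm Ω (Ω i)) (basisForm Ω (Ω j)))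
    (basisForm Ω (Ω k))) (Δ x)
  have e3 := LinearMap.congr_fun (h3 (pairForm (basisForm Ω (Ω j)) (basisForm Ω (Ω k)))
    (basisForm Ω (Ω i))) (Δ x)
  rw [h4] at e2 e3
  refine (e1.trans (e2.trans ?_)).trans e3.symm
  rw [hΔ, hΔ, mul_assoc]

theorem rTensor_counit_of_adjoint
    (hΔ : ∀ a b x : H, pairForm (basisForm Ω a) (basisForm Ω b) (Δ x) = basisForm Ω (a * b) x) :
    (basisForm Ω 1).rTensor H ∘ₗ Δ = TensorProduct.mk R _ _ 1 := by
  refine LinearMap.ext fun x => (TensorProduct.lid R H).injective (Ω.ext_elem fun i => ?_)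
  have h : ∀ f : H →ₗ[R] R, Ω.coord i ∘ₗ (TensorProduct.lid R H).toLinearMap ∘ₗ f.rTensor H =
      pairForm f (Ω.coord i) := fun f => TensorProduct.ext' fun a b => by simp
  have e := LinearMap.congr_fun (h (basisForm Ω 1)) (Δ x)
  rw [← basisForm_apply_basis, hΔ, one_mul, basisForm_apply_basis] at e
  refine e.trans ?_
  simp

theorem lTensor_counit_of_adjoint
    (hΔ : ∀ a b x : H, pairForm (basisForm Ω a) (basisForm Ω b) (Δ x) = basisForm Ω (a * b) x) :
    (basisForm Ω 1).lTensor H ∘ₗ Δ = (TensorProduct.mk R _ _).flip 1 := by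
  refine LinearMap.ext fun x => (TensorProduct.rid R H).injective (Ω.ext_elem fun i => ?_)
  have h : ∀ f : H →ₗ[R] R, Ω.coord i ∘ₗ (TensorProduct.rid R H).toLinearMap ∘ₗ f.lTensor H =
      pairForm (Ω.coord i) f := fun f => TensorProduct.ext' fun a b => by simp [mul_comm]
  have e := LinearMap.congr_fun (h (basisForm Ω 1)) (Δ x)
  rw [← basisForm_apply_basis, hΔ, mul_one, basisForm_apply_basis] at e
  refine e.trans ?_
  simp

/-- The adjoint of the multiplication of an algebra, with respect to a basis, is a coalgebra
structure. -/
@[reducible]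
noncomputable def coalgebraOfAdjoint (Ω : Module.Basis I R H) (Δ : H →ₗ[R] H ⊗[R] H)
    (hΔ : ∀ a b x : H, pairForm (basisForm Ω a) (basisForm Ω b) (Δ x) = basisForm Ω (a * b) x) :
    Coalgebra R H where
  comul := Δ
  counit := basisForm Ω 1
  coassoc := coassoc_of_adjoint hΔ
  rTensor_counit_comp_comul := rTensor_counit_of_adjoint hΔ
  lTensor_counit_comp_comul := lTensor_counit_of_adjoint hΔ

end Duality

/-! ### The antipode of a connected graded bialgebra -/

section Antipode

open WithConv LinearMap

variable {R H I : Type*} [CommRing R] [Ring H] [Bialgebra R H] (Ω : Module.Basis I R H)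
  (deg : I → ℕ) (c : I → I → I → R) (s : ℕ → Finset I)

/-- The difference, in the convolution ring, between the unit and the identity. -/
noncomputable def unitSubId (R H : Type*) [CommRing R] [Ring H] [Bialgebra R H] :
    WithConv (H →ₗ[R] H) := 1 - toConv LinearMap.id

theorem conv_apply_basis
    (hcomul : ∀ i, Coalgebra.comul (R := R) (Ω i) =
      ∑ p ∈ Finset.HasAntidiagonal.antidiagonal (deg i), ∑ j ∈ s p.1, ∑ k ∈ s p.2,
        c j k i • (Ω j ⊗ₜ[R] Ω k)) (f g : WithConv (H →ₗ[R] H)) (i : I) :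
    (f * g) (Ω i) = ∑ p ∈ Finset.HasAntidiagonal.antidiagonal (deg i), ∑ j ∈ s p.1, ∑ k ∈ s p.2,
      c j k i • (f (Ω j) * g (Ω k)) := by
  rw [convMul_apply, hcomul]
  simp only [map_sum, map_smul, TensorProduct.map_tmul, mul'_apply]

/-- `unitSubId` kills degree zero, so in a convolution power every factor must consume positive
degree. The `k`-th power therefore vanishes in degrees below `k`. -/
theorem unitSubId_pow_apply (hs : ∀ n, ∀ i ∈ s n, deg i = n)
    (hcomul : ∀ i, Coalgebra.comul (R := R) (Ω i) =
      ∑ p ∈ Finset.HasAntidiagonal.antidiagonal (deg i), ∑ j ∈ s p.1, ∑ k ∈ s p.2,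
        c j k i • (Ω j ⊗ₜ[R] Ω k)) (h0 : ∀ i, deg i = 0 → unitSubId R H (Ω i) = 0) (k : ℕ) :
    ∀ i, deg i < k → (unitSubId R H ^ k) (Ω i) = 0 := by
  induction k with
  | zero => intro i hi; omega
  | succ k ih =>
    intro i hi
    rw [pow_succ', conv_apply_basis Ω deg c s hcomul]
    refine Finset.sum_eq_zero fun p hp => Finset.sum_eq_zero fun j hj =>
      Finset.sum_eq_zero fun l hl => ?_
    have hp' := Finset.HasAntidiagonal.mem_antidiagonal.1 hp
    by_cases hj0 : deg j = 0
    · rw [h0 j hj0, zero_mul, smul_zero]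
    · rw [ih l, mul_zero, smul_zero]
      rw [hs _ l hl]
      rw [hs _ j hj] at hj0
      omega

/-- The antipode of a connected graded bialgebra, given by the geometric series in the convolution
ring. -/
noncomputable def geomAntipode : H →ₗ[R] H :=
  Ω.constr R fun i => (∑ k ∈ Finset.range (deg i + 1), unitSubId R H ^ k) (Ω i)

theorem withConv_sum_apply (N : Finset ℕ) (f : ℕ → WithConv (H →ₗ[R] H)) (x : H) :
    (∑ k ∈ N, f k) x = ∑ k ∈ N, f k x := by
  classical
  induction N using Finset.induction_on with
  | empty => simp
  | insert a N ha ih => rw [Finset.sum_insert ha, Finset.sum_insert ha, ← ih]; rfl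

/-- The extra powers vanish, so the truncation point may be raised. A single bound can then serve
all the factors occurring in a coproduct. -/
theorem geomAntipode_apply (hs : ∀ n, ∀ i ∈ s n, deg i = n)
    (hcomul : ∀ i, Coalgebra.comul (R := R) (Ω i) =
      ∑ p ∈ Finset.HasAntidiagonal.antidiagonal (deg i), ∑ j ∈ s p.1, ∑ k ∈ s p.2,
        c j k i • (Ω j ⊗ₜ[R] Ω k)) (h0 : ∀ i, deg i = 0 → unitSubId R H (Ω i) = 0) (N : ℕ) (i : I)
    (hi : deg i ≤ N) : geomAntipode Ω deg (Ω i) =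
      (∑ k ∈ Finset.range (N + 1), unitSubId R H ^ k) (Ω i) := by
  rw [geomAntipode, Module.Basis.constr_basis, withConv_sum_apply, withConv_sum_apply]
  refine Finset.sum_subset (Finset.range_subset_range.2 (by omega)) fun k _ hk => ?_
  rw [Finset.mem_range] at hk
  exact unitSubId_pow_apply Ω deg c s hs hcomul h0 k i (by omega)

theorem geomAntipode_mul_id (hs : ∀ n, ∀ i ∈ s n, deg i = n)
    (hcomul : ∀ i, Coalgebra.comul (R := R) (Ω i) =
      ∑ p ∈ Finset.HasAntidiagonal.antidiagonal (deg i), ∑ j ∈ s p.1, ∑ k ∈ s p.2,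
        c j k i • (Ω j ⊗ₜ[R] Ω k)) (h0 : ∀ i, deg i = 0 → unitSubId R H (Ω i) = 0) :
    toConv (geomAntipode Ω deg) * toConv LinearMap.id = (1 : WithConv (H →ₗ[R] H)) := by
  refine WithConv.ext (Ω.ext fun i => ?_)
  have hid : toConv LinearMap.id = 1 - unitSubId R H := by rw [unitSubId, sub_sub_cancel]
  -- The factors in the coproduct of `Ω i` have degree at most `deg i`, so one finite geometric sum
  -- replaces the antipode. It telescopes, and the remaining power vanishes at `Ω i`.
  have e : (toConv (geomAntipode Ω deg) * toConv LinearMap.id : WithConv (H →ₗ[R] H)) (Ω i) =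
      ((∑ k ∈ Finset.range (deg i + 1), unitSubId R H ^ k) * toConv LinearMap.id :
        WithConv (H →ₗ[R] H)) (Ω i) := by
    rw [conv_apply_basis Ω deg c s hcomul, conv_apply_basis Ω deg c s hcomul]
    refine Finset.sum_congr rfl fun p hp => Finset.sum_congr rfl fun j hj =>
      Finset.sum_congr rfl fun l hl => ?_
    have hp' := Finset.HasAntidiagonal.mem_antidiagonal.1 hp
    rw [← geomAntipode_apply Ω deg c s hs hcomul h0 (deg i) j (by rw [hs _ j hj]; omega)]
  refine e.trans ?_
  rw [hid, geom_sum_mul_neg]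
  change (1 : WithConv (H →ₗ[R] H)) (Ω i) - (unitSubId R H ^ (deg i + 1)) (Ω i) = _
  rw [unitSubId_pow_apply Ω deg c s hs hcomul h0 _ i (by omega), sub_zero]

theorem id_mul_geomAntipode (hs : ∀ n, ∀ i ∈ s n, deg i = n)
    (hcomul : ∀ i, Coalgebra.comul (R := R) (Ω i) =
      ∑ p ∈ Finset.HasAntidiagonal.antidiagonal (deg i), ∑ j ∈ s p.1, ∑ k ∈ s p.2,
        c j k i • (Ω j ⊗ₜ[R] Ω k)) (h0 : ∀ i, deg i = 0 → unitSubId R H (Ω i) = 0) :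
    toConv LinearMap.id * toConv (geomAntipode Ω deg) = (1 : WithConv (H →ₗ[R] H)) := by
  refine WithConv.ext (Ω.ext fun i => ?_)
  have hid : toConv LinearMap.id = 1 - unitSubId R H := by rw [unitSubId, sub_sub_cancel]
  have e : (toConv LinearMap.id * toConv (geomAntipode Ω deg) : WithConv (H →ₗ[R] H)) (Ω i) =
      (toConv LinearMap.id * (∑ k ∈ Finset.range (deg i + 1), unitSubId R H ^ k) :
        WithConv (H →ₗ[R] H)) (Ω i) := by
    rw [conv_apply_basis Ω deg c s hcomul, conv_apply_basis Ω deg c s hcomul]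
    refine Finset.sum_congr rfl fun p hp => Finset.sum_congr rfl fun j hj =>
      Finset.sum_congr rfl fun l hl => ?_
    have hp' := Finset.HasAntidiagonal.mem_antidiagonal.1 hp
    rw [← geomAntipode_apply Ω deg c s hs hcomul h0 (deg i) l (by rw [hs _ l hl]; omega)]
  refine e.trans ?_
  rw [hid, mul_neg_geom_sum]
  change (1 : WithConv (H →ₗ[R] H)) (Ω i) - (unitSubId R H ^ (deg i + 1)) (Ω i) = _
  rw [unitSubId_pow_apply Ω deg c s hs hcomul h0 _ i (by omega), sub_zero]

/-- A connected graded bialgebra is a Hopf algebra. -/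
@[reducible]
noncomputable def hopfAlgebraOfConnected (hs : ∀ n, ∀ i ∈ s n, deg i = n)
    (hcomul : ∀ i, Coalgebra.comul (R := R) (Ω i) =
      ∑ p ∈ Finset.HasAntidiagonal.antidiagonal (deg i), ∑ j ∈ s p.1, ∑ k ∈ s p.2,
        c j k i • (Ω j ⊗ₜ[R] Ω k))
    (h0 : ∀ i, deg i = 0 → unitSubId R H (Ω i) = 0) :
    HopfAlgebra R H where
  antipode := geomAntipode Ω deg
  mul_antipode_rTensor_comul :=
    congrArg ofConv (geomAntipode_mul_id Ω deg c s hs hcomul h0)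
  mul_antipode_lTensor_comul :=
    congrArg ofConv (id_mul_geomAntipode Ω deg c s hs hcomul h0)

end Antipode

/-! ### Cones spanned by a family -/

section Nonneg

variable {R : Type*} [CommRing R] [PartialOrder R] [IsOrderedRing R] {M I : Type*}
  [AddCommGroup M] [Module R M]

theorem basis_mem_nonnegSpan (b : I → M) (i : I) : b i ∈ nonnegSpan R b :=
  Submodule.subset_span ⟨i, rfl⟩

theorem smul_mem_nonnegSpan {b : I → M} {r : R} (hr : 0 ≤ r) {x : M} (hx : x ∈ nonnegSpan R b) :
    r • x ∈ nonnegSpan R b :=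
  PointedCone.smul_mem _ hr hx

theorem map_mem_nonnegSpan {N J : Type*} [AddCommGroup N] [Module R N] {b : I → M} {d : J → N}
    (f : M →ₗ[R] N) (hf : ∀ i, f (b i) ∈ nonnegSpan R d) {x : M} (hx : x ∈ nonnegSpan R b) :
    f x ∈ nonnegSpan R d := by
  induction hx using Submodule.span_induction with
  | mem x hx => obtain ⟨i, rfl⟩ := hx; exact hf i
  | zero => rw [map_zero]; exact zero_mem _
  | add x y _ _ hx hy => rw [map_add]; exact add_mem hx hy
  | smul r x _ hx =>
    have : f (r • x) = (r : R) • f x := f.map_smul (r : R) x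
    rw [this]
    exact smul_mem_nonnegSpan r.2 hx

theorem form_nonneg_of_mem_nonnegSpan {b : I → M} (f : M →ₗ[R] R) (hf : ∀ i, 0 ≤ f (b i)) {x : M}
    (hx : x ∈ nonnegSpan R b) : 0 ≤ f x := by
  induction hx using Submodule.span_induction with
  | mem x hx => obtain ⟨i, rfl⟩ := hx; exact hf i
  | zero => rw [map_zero]
  | add x y _ _ hx hy => rw [map_add]; exact add_nonneg hx hy
  | smul r x _ hx =>
    have : f (r • x) = (r : R) * f x := f.map_smul (r : R) x
    rw [this]
    exact mul_nonneg r.2 hx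

end Nonneg

namespace InvFun

/-! ### The Hopf algebra structure on the real span of `Ω(q)` -/

section RealForm

variable (F : Type u) [Field F] [Fintype F] [DecidableEq F]

theorem coe_real_smul {E : Type*} [AddCommMonoid E] [Module ℂ E] [Module ℝ E] [IsScalarTower ℝ ℂ E]
    (r : ℝ) (a : E) : (r : ℂ) • a = r • a := algebraMap_smul ℂ r a

theorem mul_mem_realSpan {a b : CC F} (ha : a ∈ realSpan F) (hb : b ∈ realSpan F) :
    mul F a b ∈ realSpan F := by
  refine LinearMap.BilinMap.apply_apply_mem_of_mem_span (realSpan F) (Omega F) (Omega F)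
    ((mul F).restrictScalars₁₂ ℝ ℝ) ?_ a b ha hb
  intro u hu v hv
  change mul F u v ∈ realSpan F
  rw [mul_coe_coe ⟨u, hu⟩ ⟨v, hv⟩]
  refine Submodule.sum_mem _ fun w _ => ?_
  rw [coe_real_smul]
  exact Submodule.smul_mem _ _ (Submodule.subset_span w.2)

theorem unit_eq_mkOmega : unit F = (mkOmega 0 0 : Omega F) := by
  have h : orbitNormSq (0 : AddChar (gl F 0) ℂ) = 1 := by
    have h1 : Fintype.card (gl F 0) = 1 := Fintype.card_eq_one_iff.2 ⟨0, fun _ => Subsingleton.elim _ _⟩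
    rw [orbitNormSq, charOrbit_zero, h1]
    simp
  rw [coe_mkOmega, normChar, h, orbitSum_zero, unit]
  simp

theorem unit_mem_realSpan : unit F ∈ realSpan F := by
  rw [unit_eq_mkOmega]
  exact Submodule.subset_span (mkOmega 0 0 : Omega F).2

/-- The real vector space `𝔠(q)`. -/
def RealAlg : Type u := realSpan F

/-- The additive group underlying `𝔠(q)`. -/
@[reducible]
noncomputable def realAlgAddCommGroup : AddCommGroup (RealAlg F) :=
  Module.addCommMonoidToAddCommGroup ℝ (M := realSpan F)

noncomputable instance : Ring (RealAlg F) :=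
  { realAlgAddCommGroup F with
    mul := fun a b => ⟨mul F a.1 b.1, mul_mem_realSpan F a.2 b.2⟩
    one := ⟨unit F, unit_mem_realSpan F⟩
    mul_assoc := fun a b c => Subtype.ext (mul_assoc' a.1 b.1 c.1)
    one_mul := fun a => Subtype.ext (unit_mul a.1)
    mul_one := fun a => Subtype.ext (mul_unit a.1)
    left_distrib := fun a b c => Subtype.ext ((mul F a.1).map_add b.1 c.1)
    right_distrib := fun a b c => Subtype.ext (LinearMap.map_add₂ (mul F) a.1 b.1 c.1)
    zero_mul := fun a => Subtype.ext (LinearMap.map_zero₂ (mul F) a.1)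
    mul_zero := fun a => Subtype.ext ((mul F a.1).map_zero) }

noncomputable instance : Algebra ℝ (RealAlg F) :=
  letI : Module ℝ (RealAlg F) := inferInstanceAs (Module ℝ (realSpan F))
  Algebra.ofModule
    (fun r a b => Subtype.ext (LinearMap.map_smul₂ ((mul F).restrictScalars₁₂ ℝ ℝ) r a.1 b.1))
    (fun r a b => Subtype.ext (((mul F).restrictScalars₁₂ ℝ ℝ a.1).map_smul r b.1))

/-- The inclusion `𝔠(q) → C(q)`. -/
noncomputable def realIncl : RealAlg F →ₗ[ℝ] CC F where
  toFun a := a.1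
  map_add' _ _ := rfl
  map_smul' _ _ := rfl

theorem realIncl_injective : Function.Injective (realIncl F) := Subtype.val_injective

theorem realIncl_mul (a b : RealAlg F) :
    realIncl F (a * b) = mul F (realIncl F a) (realIncl F b) := rfl

theorem realIncl_one : realIncl F 1 = unit F := rfl

theorem range_realIncl : LinearMap.range (realIncl F) = realSpan F := by
  ext a
  exact ⟨fun ⟨b, hb⟩ => hb ▸ b.2, fun ha => ⟨⟨a, ha⟩, rfl⟩⟩

variable {F}

/-- An element of `Ω(q)` as an element of `𝔠(q)`. -/
def omegaElt (w : Omega F) : RealAlg F := ⟨w, Submodule.subset_span w.2⟩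

theorem realIncl_omegaElt (w : Omega F) : realIncl F (omegaElt w) = w := rfl

theorem linearIndependent_omegaElt : LinearIndependent ℝ (omegaElt (F := F)) := by
  classical
  rw [linearIndependent_iff']
  intro s g hg w hw
  have h := congrArg (fun a => omegaCoeff w (realIncl F a)) hg
  simp only [map_sum, map_smul, realIncl_omegaElt, map_zero] at h
  rw [Finset.sum_eq_single w] at h
  · rw [← coe_real_smul, map_smul, omegaCoeff_coe, if_pos rfl, smul_eq_mul, mul_one] at h
    exact_mod_cast h
  · intro v _ hv
    rw [← coe_real_smul, map_smul, omegaCoeff_coe, if_neg hv.symm, smul_zero]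
  · exact fun h' => absurd hw h'

theorem span_omegaElt : ⊤ ≤ Submodule.span ℝ (Set.range (omegaElt (F := F))) := by
  intro a _
  have h : realIncl F a ∈ (Submodule.span ℝ (Set.range (omegaElt (F := F)))).map (realIncl F) := by
    rw [Submodule.map_span, ← Set.range_comp]
    have : Set.range (realIncl F ∘ omegaElt) = Omega F := Subtype.range_coe
    rw [this]
    exact a.2
  obtain ⟨b, hb, e⟩ := h
  rwa [← realIncl_injective F e]

/-- The basis `Ω(q)` of `𝔠(q)`. -/
noncomputable def omegaBasis (F : Type u) [Field F] [Fintype F] [DecidableEq F] :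
    Module.Basis (Omega F) ℝ (RealAlg F) :=
  Module.Basis.mk linearIndependent_omegaElt span_omegaElt

@[simp]
theorem omegaBasis_apply (w : Omega F) : omegaBasis F w = omegaElt w := Module.Basis.mk_apply _ _ w

theorem omegaCoeff_realIncl (w : Omega F) (a : RealAlg F) :
    omegaCoeff w (realIncl F a) = ((omegaBasis F).repr a w : ℝ) := by
  classical
  have h : (omegaCoeff w).restrictScalars ℝ ∘ₗ realIncl F =
      Complex.ofRealCLM.toLinearMap ∘ₗ (omegaBasis F).coord w := by
    refine (omegaBasis F).ext fun v => ?_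
    change omegaCoeff w (realIncl F (omegaBasis F v)) = ((omegaBasis F).repr (omegaBasis F v) w : ℝ)
    rw [Module.Basis.repr_self, omegaBasis_apply, realIncl_omegaElt, omegaCoeff_coe,
      Finsupp.single_apply]
    by_cases h : w = v
    · simp [h]
    · simp [h, Ne.symm h]
  exact LinearMap.congr_fun h a

theorem repr_mul_basis (u v w : Omega F) :
    (omegaBasis F).repr (omegaBasis F u * omegaBasis F v) w = structConst u v w := by
  have h := omegaCoeff_realIncl w (omegaBasis F u * omegaBasis F v)
  rw [realIncl_mul, omegaBasis_apply, omegaBasis_apply, realIncl_omegaElt, realIncl_omegaElt,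
    ← coe_structConst] at h
  rw [omegaBasis_apply, omegaBasis_apply]
  exact_mod_cast h.symm

theorem mul_basis (u v : Omega F) : omegaBasis F u * omegaBasis F v =
    ∑ w ∈ omegaFin F (omegaDegree u + omegaDegree v), structConst u v w • omegaBasis F w := by
  refine realIncl_injective F ?_
  simp only [omegaBasis_apply, realIncl_mul, map_sum, map_smul, realIncl_omegaElt, mul_coe_coe,
    coe_real_smul]

theorem one_eq_basis : (1 : RealAlg F) = omegaBasis F (mkOmega 0 0) := by
  refine realIncl_injective F ?_
  rw [realIncl_one, omegaBasis_apply, realIncl_omegaElt, unit_eq_mkOmega]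

/-- The comultiplication of `𝔠(q)`. -/
noncomputable def realComul : RealAlg F →ₗ[ℝ] RealAlg F ⊗[ℝ] RealAlg F :=
  (omegaBasis F).constr ℝ fun w =>
    ∑ p ∈ Finset.HasAntidiagonal.antidiagonal (omegaDegree w),
      ∑ u ∈ omegaFin F p.1, ∑ v ∈ omegaFin F p.2,
        structConst u v w • (omegaBasis F u ⊗ₜ[ℝ] omegaBasis F v)

theorem realComul_basis (w : Omega F) : realComul (omegaBasis F w) =
    ∑ p ∈ Finset.HasAntidiagonal.antidiagonal (omegaDegree w),
      ∑ u ∈ omegaFin F p.1, ∑ v ∈ omegaFin F p.2,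
        structConst u v w • (omegaBasis F u ⊗ₜ[ℝ] omegaBasis F v) :=
  Module.Basis.constr_basis _ _ _ _

theorem tensorIncl_tmul (a b : RealAlg F) :
    tensorIncl F (realIncl F) (a ⊗ₜ b) = realIncl F a ⊗ₜ[ℂ] realIncl F b := rfl

theorem tensorIncl_realComul (a : RealAlg F) :
    tensorIncl F (realIncl F) (realComul a) = comul F (realIncl F a) := by
  have h : tensorIncl F (realIncl F) ∘ₗ realComul =
      (comul F).restrictScalars ℝ ∘ₗ realIncl F := by
    refine (omegaBasis F).ext fun w => ?_
    change tensorIncl F (realIncl F) (realComul (omegaBasis F w)) =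
      comul F (realIncl F (omegaBasis F w))
    rw [realComul_basis, omegaBasis_apply, realIncl_omegaElt, comul_coe]
    simp only [map_sum, map_smul, omegaBasis_apply, tensorIncl_tmul, realIncl_omegaElt]
    refine Finset.sum_congr rfl fun p _ => Finset.sum_congr rfl fun u _ =>
      Finset.sum_congr rfl fun v _ => ?_
    exact (coe_real_smul _ _).symm
  exact LinearMap.congr_fun h a

/-- On basis elements both sides are the same structure constant, `realComul` being the transpose of
the multiplication. When the degrees do not match, both sides vanish. -/
theorem pairForm_realComul (a b x : RealAlg F) :
    pairForm (basisForm (omegaBasis F) a) (basisForm (omegaBasis F) b) (realComul x) =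
      basisForm (omegaBasis F) (a * b) x := by
  classical
  have hb : ∀ u v w : Omega F, pairForm (basisForm (omegaBasis F) (omegaBasis F u))
      (basisForm (omegaBasis F) (omegaBasis F v)) (realComul (omegaBasis F w)) =
      basisForm (omegaBasis F) (omegaBasis F u * omegaBasis F v) (omegaBasis F w) := by
    intro u v w
    rw [basisForm_comm, basisForm_apply_basis, basisForm_apply_basis, basisForm_apply_basis,
      Module.Basis.coord_apply, repr_mul_basis, realComul_basis]
    simp only [map_sum, map_smul, pairForm_tmul, Module.Basis.coord_apply,
      Module.Basis.repr_self, Finsupp.single_apply, smul_eq_mul, mul_ite, mul_one,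
      mul_zero]
    by_cases hd : omegaDegree w = omegaDegree u + omegaDegree v
    · rw [Finset.sum_eq_single (omegaDegree u, omegaDegree v), Finset.sum_eq_single u,
        Finset.sum_eq_single v]
      · simp
      · intro v' _ hv'
        simp [hv']
      · exact fun h => absurd (mem_omegaFin.2 rfl) h
      · intro u' _ hu'
        simp [hu']
      · exact fun h => absurd (mem_omegaFin.2 rfl) h
      · intro p _ hp
        refine Finset.sum_eq_zero fun u' hu' => Finset.sum_eq_zero fun v' hv' => ?_
        split_ifs with h1 h2
        · refine absurd ?_ hp
          rw [← h1, ← h2, mem_omegaFin.1 hu', mem_omegaFin.1 hv']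
        all_goals rfl
      · exact fun h => absurd (Finset.HasAntidiagonal.mem_antidiagonal.2 hd.symm) h
    · rw [structConst_of_ne hd]
      refine Finset.sum_eq_zero fun p hp => Finset.sum_eq_zero fun u' hu' =>
        Finset.sum_eq_zero fun v' hv' => ?_
      split_ifs with h1 h2
      · refine absurd ?_ hd
        rw [← h1, ← h2, mem_omegaFin.1 hu', mem_omegaFin.1 hv',
          Finset.HasAntidiagonal.mem_antidiagonal.1 hp]
      all_goals rfl
  have h1 : ∀ u v : Omega F, pairForm (basisForm (omegaBasis F) (omegaBasis F u))
      (basisForm (omegaBasis F) (omegaBasis F v)) ∘ₗ realComul =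
      basisForm (omegaBasis F) (omegaBasis F u * omegaBasis F v) :=
    fun u v => (omegaBasis F).ext fun w => hb u v w
  have key : (LinearMap.mk₂ ℝ (fun a b => pairForm (basisForm (omegaBasis F) a)
      (basisForm (omegaBasis F) b) (realComul x))
      (by simp [pairForm, TensorProduct.map_add_left]) (by simp [pairForm, TensorProduct.map_smul_left])
      (by simp [pairForm, TensorProduct.map_add_right])
      (by simp [pairForm, TensorProduct.map_smul_right])) =
      LinearMap.mk₂ ℝ (fun a b => basisForm (omegaBasis F) (a * b) x)
      (by simp [add_mul]) (by simp) (by simp [mul_add]) (by simp) :=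
    (omegaBasis F).ext fun u => (omegaBasis F).ext fun v => LinearMap.congr_fun (h1 u v) x
  exact LinearMap.congr_fun₂ key a b

noncomputable instance : Coalgebra ℝ (RealAlg F) :=
  coalgebraOfAdjoint (omegaBasis F) realComul pairForm_realComul

theorem counit_eq_basisForm (a : RealAlg F) :
    Coalgebra.counit (R := ℝ) a = basisForm (omegaBasis F) 1 a := rfl

theorem counit_eq_evalEnd (a : CC F) :
    counit F a = evalEnd (Matrix.toLin' (0 : gl F 0)) a := (evalEnd_toLin' 0 a).symm

theorem coe_counit (a : RealAlg F) :
    ((Coalgebra.counit (R := ℝ) a : ℝ) : ℂ) = counit F (realIncl F a) := by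
  rw [counit_eq_basisForm, one_eq_basis, basisForm_apply_basis, Module.Basis.coord_apply,
    ← omegaCoeff_realIncl, omegaCoeff_mkOmega]
  have h1 : normChar (0 : AddChar (gl F 0) ℂ) = one F 0 := by
    have := congrArg (fun a : CC F => a 0) (unit_eq_mkOmega F)
    dsimp only at this
    rw [coe_mkOmega, unit, inDeg_apply_self, inDeg_apply_self] at this
    exact this.symm
  have h2 : Fintype.card (G F 0) = 1 :=
    Fintype.card_eq_one_iff.2 ⟨1, fun _ => Subsingleton.elim _ _⟩
  rw [h1, herm, h2, Fintype.sum_subsingleton _ (0 : gl F 0)]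
  simp [one]
  rfl

theorem counit_mul (a b : CC F) : counit F (mul F a b) = counit F a * counit F b := by
  rw [counit_eq_evalEnd, counit_eq_evalEnd, counit_eq_evalEnd, evalEnd_mul,
    Fintype.sum_subsingleton _ (⊤ : Submodule F (Fin 0 → F))]
  exact hallTerm_of_exact a b LinearMap.id LinearMap.id Function.injective_id
    Function.surjective_id LinearMap.range_id (Subsingleton.elim _ _) (fun _ => rfl) fun _ => rfl

-- The product in the tensor square is evaluated in the shape of the right-hand side of
-- `evalEnd₂_comul_mul`, so that multiplicativity of the comultiplication becomes a comparison of
-- summands.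
open Classical in
theorem evalEnd₂_tensorIncl_mul (s t : RealAlg F ⊗[ℝ] RealAlg F) {V V' : Type*} [AddCommGroup V]
    [Module F V] [Module.Finite F V] [AddCommGroup V'] [Module F V'] [Module.Finite F V']
    (x : Module.End F V) (y : Module.End F V') :
    evalEnd₂ x y (tensorIncl F (realIncl F) (s * t)) = ∑ p : Submodule F V × Submodule F V',
      if h : p.1 ≤ p.1.comap x ∧ p.2 ≤ p.2.comap y then
        evalEnd₂ (x.restrict h.1) (y.restrict h.2) (tensorIncl F (realIncl F) s) *
          evalEnd₂ (p.1.mapQ p.1 x h.1) (p.2.mapQ p.2 y h.2) (tensorIncl F (realIncl F) t)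
      else 0 := by
  induction s with
  | zero => simp
  | add s s' hs hs' =>
    rw [add_mul, map_add, map_add, hs, hs', ← Finset.sum_add_distrib]
    refine Finset.sum_congr rfl fun p _ => ?_
    split_ifs
    · simp only [map_add, add_mul]
    · rw [add_zero]
  | tmul a b =>
    induction t with
    | zero => simp
    | add t t' ht ht' =>
      rw [mul_add, map_add, map_add, ht, ht', ← Finset.sum_add_distrib]
      refine Finset.sum_congr rfl fun p _ => ?_
      split_ifs
      · simp only [map_add, mul_add]
      · rw [add_zero]
    | tmul c d =>
      rw [Algebra.TensorProduct.tmul_mul_tmul]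
      simp only [tensorIncl_tmul, evalEnd₂_tmul, realIncl_mul, evalEnd_mul]
      rw [Finset.sum_mul_sum, Fintype.sum_prod_type]
      refine Finset.sum_congr rfl fun W _ => Finset.sum_congr rfl fun W' _ => ?_
      unfold hallTerm
      by_cases h1 : W ≤ W.comap x
      · by_cases h2 : W' ≤ W'.comap y
        · rw [dif_pos h1, dif_pos h2, dif_pos ⟨h1, h2⟩]
          ring
        · rw [dif_neg h2, mul_zero, dif_neg (fun h => h2 h.2)]
      · rw [dif_neg h1, zero_mul, dif_neg (fun h => h1 h.1)]

theorem coe_pairForm_coord (u v : Omega F) (t : RealAlg F ⊗[ℝ] RealAlg F) :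
    ((pairForm ((omegaBasis F).coord u) ((omegaBasis F).coord v) t : ℝ) : ℂ) =
      (Fintype.card (G F (omegaDegree u)) : ℂ)⁻¹ * (Fintype.card (G F (omegaDegree v)) : ℂ)⁻¹ *
        ∑ x : gl F (omegaDegree u), ∑ y : gl F (omegaDegree v),
          evalEnd₂ (Matrix.toLin' x) (Matrix.toLin' y) (tensorIncl F (realIncl F) t) *
            ((starRingEnd ℂ) (((u : CC F) (omegaDegree u)).1 x) *
              (starRingEnd ℂ) (((v : CC F) (omegaDegree v)).1 y)) := by
  have h : ∀ (w : Omega F) (a : RealAlg F), (((omegaBasis F).repr a w : ℝ) : ℂ) =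
      (Fintype.card (G F (omegaDegree w)) : ℂ)⁻¹ * ∑ x : gl F (omegaDegree w),
        evalEnd (Matrix.toLin' x) (realIncl F a) *
          (starRingEnd ℂ) (((w : CC F) (omegaDegree w)).1 x) := by
    intro w a
    rw [← omegaCoeff_realIncl]
    simp only [evalEnd_toLin']
    rfl
  induction t with
  | zero => simp
  | add s t hs ht =>
    rw [map_add, Complex.ofReal_add, hs, ht, ← mul_add, ← Finset.sum_add_distrib]
    simp only [← Finset.sum_add_distrib, map_add, add_mul]
  | tmul a b =>
    rw [pairForm_tmul, Module.Basis.coord_apply, Module.Basis.coord_apply, Complex.ofReal_mul, h, h,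
      mul_mul_mul_comm, Finset.sum_mul_sum]
    simp only [tensorIncl_tmul, evalEnd₂_tmul]
    congr 1
    exact Finset.sum_congr rfl fun x _ => Finset.sum_congr rfl fun y _ => by ring

/-- The real coefficients in the basis `Ω ⊗ Ω` are hermitian products, hence are computed from the
complex values. This permits identities in the real tensor square to be tested in `C(q) ⊗ C(q)`. -/
theorem ext_evalEnd₂ {s t : RealAlg F ⊗[ℝ] RealAlg F}
    (h : ∀ (k l : ℕ) (x : gl F k) (y : gl F l),
      evalEnd₂ (Matrix.toLin' x) (Matrix.toLin' y) (tensorIncl F (realIncl F) s) =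
        evalEnd₂ (Matrix.toLin' x) (Matrix.toLin' y) (tensorIncl F (realIncl F) t)) : s = t := by
  refine ext_pairForm (omegaBasis F) (omegaBasis F) fun u v => Complex.ofReal_injective ?_
  rw [coe_pairForm_coord, coe_pairForm_coord]
  simp only [h]

theorem realComul_mul (a b : RealAlg F) : realComul (a * b) = realComul a * realComul b := by
  classical
  refine ext_evalEnd₂ fun k l x y => ?_
  rw [tensorIncl_realComul, realIncl_mul, evalEnd₂_comul_mul, evalEnd₂_tensorIncl_mul]
  simp only [tensorIncl_realComul]

theorem counit_realAlg_mul (a b : RealAlg F) :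
    Coalgebra.counit (R := ℝ) (a * b) =
      Coalgebra.counit (R := ℝ) a * Coalgebra.counit (R := ℝ) b := by
  refine Complex.ofReal_injective ?_
  rw [Complex.ofReal_mul, coe_counit, coe_counit, coe_counit, realIncl_mul, counit_mul]

theorem counit_realAlg_one : Coalgebra.counit (R := ℝ) (1 : RealAlg F) = 1 := by
  rw [counit_eq_basisForm, one_eq_basis, basisForm_apply_basis, Module.Basis.coord_apply,
    Module.Basis.repr_self, Finsupp.single_eq_same]

/-- By adjointness the coefficient of `u ⊗ v` is the counit of `u v`, so the claim is dual to
multiplicativity of the counit. -/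
theorem realComul_one : realComul (1 : RealAlg F) = 1 ⊗ₜ 1 := by
  refine ext_pairForm (omegaBasis F) (omegaBasis F) fun u v => ?_
  rw [← basisForm_apply_basis, ← basisForm_apply_basis, pairForm_realComul, pairForm_tmul,
    basisForm_comm, basisForm_comm _ _ 1, basisForm_comm _ _ 1, ← counit_eq_basisForm,
    counit_realAlg_mul]
  rfl

noncomputable instance : Bialgebra ℝ (RealAlg F) :=
  Bialgebra.mk' ℝ (RealAlg F) counit_realAlg_one (fun {a b} => counit_realAlg_mul a b)
    realComul_one (fun {a b} => realComul_mul a b)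

theorem eq_mkOmega_zero {w : Omega F} (h : omegaDegree w = 0) : w = mkOmega 0 0 := by
  obtain ⟨n, ψ, rfl⟩ := exists_eq_mkOmega w
  rw [omegaDegree_mkOmega] at h
  subst h
  congr 1
  ext x
  rw [Subsingleton.elim x 0, AddChar.map_zero_eq_one, AddChar.map_zero_eq_one]

theorem unitSubId_basis_of_degree_zero (w : Omega F) (h : omegaDegree w = 0) :
    unitSubId ℝ (RealAlg F) (omegaBasis F w) = 0 := by
  rw [eq_mkOmega_zero h, ← one_eq_basis]
  change algebraMap ℝ (RealAlg F) (Coalgebra.counit (R := ℝ) (1 : RealAlg F)) - 1 = 0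
  rw [counit_realAlg_one, map_one, sub_self]

noncomputable instance : HopfAlgebra ℝ (RealAlg F) :=
  hopfAlgebraOfConnected (omegaBasis F) omegaDegree structConst (omegaFin F)
    (fun _ _ hw => mem_omegaFin.1 hw) realComul_basis unitSubId_basis_of_degree_zero

theorem isRestriction_realIncl : IsRestriction F (realIncl F) where
  injective := realIncl_injective F
  range_eq := range_realIncl F
  map_mul := realIncl_mul F
  map_one := realIncl_one F
  map_comul := tensorIncl_realComul
  map_counit := coe_counit

end RealForm

/-! ### The grading defined by a homogeneous basis -/

section Grading

/-- The grading of a module for which the elements of a basis are homogeneous of given degrees. -/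
def basisGrading {R H I : Type*} [CommRing R] [AddCommGroup H] [Module R H]
    (Ω : Module.Basis I R H) (deg : I → ℕ) (n : ℕ) : Submodule R H :=
  Submodule.span R (Ω '' {i | deg i = n})

variable {R H I : Type*} [CommRing R] [AddCommGroup H] [Module R H] {Ω : Module.Basis I R H}
  {deg : I → ℕ}

theorem basis_mem_basisGrading (i : I) : Ω i ∈ basisGrading Ω deg (deg i) :=
  Submodule.subset_span ⟨i, rfl, rfl⟩

theorem basis_mem_basisGrading_of_eq {i : I} {n : ℕ} (h : deg i = n) :
    Ω i ∈ basisGrading Ω deg n := Submodule.subset_span ⟨i, h, rfl⟩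

theorem isInternal_basisGrading : DirectSum.IsInternal (basisGrading Ω deg) := by
  refine DirectSum.isInternal_submodule_of_iSupIndep_of_iSup_eq_top ?_ ?_
  · intro n
    nontriviality R
    refine (Ω.linearIndependent.disjoint_span_image (s := {i | deg i = n})
      (t := {i | deg i ≠ n}) ?_).mono_right ?_
    · exact Set.disjoint_left.2 fun i hi hi' => hi' hi
    · refine iSup₂_le fun m hm => Submodule.span_mono (Set.image_mono fun i hi => ?_)
      exact fun h => hm (hi.symm.trans h)
  · rw [eq_top_iff, ← Ω.span_eq, Submodule.span_le]
    rintro _ ⟨i, rfl⟩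
    exact Submodule.mem_iSup_of_mem (deg i) (basis_mem_basisGrading i)

end Grading

/-! ### The PSH axioms -/

section GradedHopf

variable {F : Type u} [Field F] [Fintype F] [DecidableEq F]

theorem comap_realSpanDeg (n : ℕ) : (realSpanDeg F n).comap (realIncl F) =
    basisGrading (omegaBasis F) omegaDegree n := by
  have h : realSpanDeg F n = (basisGrading (omegaBasis F) omegaDegree n).map (realIncl F) := by
    rw [basisGrading, Submodule.map_span, realSpanDeg]
    congr 1
    ext w
    constructor
    · intro hw
      obtain ⟨ψ, rfl⟩ := mem_OmegaDeg hw
      exact ⟨_, ⟨mkOmega n ψ, omegaDegree_mkOmega n ψ, rfl⟩, by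
        rw [omegaBasis_apply, realIncl_omegaElt]⟩
    · rintro ⟨_, ⟨w, hw, rfl⟩, rfl⟩
      obtain ⟨m, ψ, rfl⟩ := exists_eq_mkOmega w
      obtain rfl : m = n := (omegaDegree_mkOmega m ψ).symm.trans hw
      rw [omegaBasis_apply, realIncl_omegaElt, coe_mkOmega]
      exact inDeg_normChar_mem ψ
  rw [h, Submodule.comap_map_eq_of_injective (realIncl_injective F)]

theorem comul_realAlg_basis (w : Omega F) : Coalgebra.comul (R := ℝ) (omegaBasis F w) =
    ∑ p ∈ Finset.HasAntidiagonal.antidiagonal (omegaDegree w),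
      ∑ u ∈ omegaFin F p.1, ∑ v ∈ omegaFin F p.2,
        structConst u v w • (omegaBasis F u ⊗ₜ[ℝ] omegaBasis F v) := realComul_basis w

theorem counit_basis_of_degree_pos {w : Omega F} (h : 0 < omegaDegree w) :
    Coalgebra.counit (R := ℝ) (omegaBasis F w) = 0 := by
  rw [counit_eq_basisForm, one_eq_basis, basisForm_apply_basis, Module.Basis.coord_apply,
    Module.Basis.repr_self]
  refine Finsupp.single_eq_of_ne' fun e => ?_
  rw [e, omegaDegree_mkOmega] at h
  exact lt_irrefl 0 h

theorem isConnectedGradedHopf :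
    IsConnectedGradedHopf ℝ (basisGrading (omegaBasis F) omegaDegree) where
  isInternal := isInternal_basisGrading
  one_mem := by
    rw [one_eq_basis]
    exact basis_mem_basisGrading_of_eq (omegaDegree_mkOmega 0 0)
  mul_mem k l x y hx hy := by
    refine LinearMap.BilinMap.apply_apply_mem_of_mem_span
      (basisGrading (omegaBasis F) omegaDegree (k + l)) _ _ (LinearMap.mul ℝ (RealAlg F)) ?_ x y
      hx hy
    rintro _ ⟨u, rfl, rfl⟩ _ ⟨v, rfl, rfl⟩
    rw [LinearMap.mul_apply', mul_basis]
    exact Submodule.sum_mem _ fun w hw => Submodule.smul_mem _ _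
      (basis_mem_basisGrading_of_eq (mem_omegaFin.1 hw))
  comul_mem n x hx := by
    refine (Submodule.span_le (p := Submodule.comap (Coalgebra.comul (R := ℝ))
      (⨆ p ∈ Finset.HasAntidiagonal.antidiagonal n, LinearMap.range (TensorProduct.map
        (basisGrading (omegaBasis F) omegaDegree p.1).subtype
        (basisGrading (omegaBasis F) omegaDegree p.2).subtype)))).2 ?_ hx
    rintro _ ⟨w, rfl, rfl⟩
    rw [SetLike.mem_coe, Submodule.mem_comap]
    erw [comul_realAlg_basis]
    refine Submodule.sum_mem _ fun p hp => Submodule.sum_mem _ fun u hu =>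
      Submodule.sum_mem _ fun v hv => Submodule.smul_mem _ _ ?_
    refine Submodule.mem_iSup_of_mem p (Submodule.mem_iSup_of_mem hp ?_)
    exact ⟨⟨omegaBasis F u, basis_mem_basisGrading_of_eq (mem_omegaFin.1 hu)⟩ ⊗ₜ
      ⟨omegaBasis F v, basis_mem_basisGrading_of_eq (mem_omegaFin.1 hv)⟩, rfl⟩
  counit_eq_zero n x hn hx := by
    refine (Submodule.span_le
      (p := LinearMap.ker (Coalgebra.counit (R := ℝ) (A := RealAlg F)))).2 ?_ hx
    rintro _ ⟨w, rfl, rfl⟩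
    exact counit_basis_of_degree_pos hn
  connected x hx := by
    refine (Submodule.span_le
      (p := LinearMap.range (Algebra.linearMap ℝ (RealAlg F)))).2 ?_ hx
    rintro _ ⟨w, hw, rfl⟩
    rw [eq_mkOmega_zero hw, ← one_eq_basis]
    exact ⟨1, map_one (algebraMap ℝ (RealAlg F))⟩

theorem isPSHAlgebra_realAlg :
    IsPSHAlgebra ℝ (basisGrading (omegaBasis F) omegaDegree) (omegaBasis F) where
  isConnectedGradedHopf := isConnectedGradedHopf
  homogeneous w := ⟨omegaDegree w, basis_mem_basisGrading w⟩
  unit_nonneg r hr := by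
    rw [Algebra.algebraMap_eq_smul_one, one_eq_basis]
    exact smul_mem_nonnegSpan hr (basis_mem_nonnegSpan _ _)
  counit_nonneg x hx := by
    refine form_nonneg_of_mem_nonnegSpan _ (fun w => ?_) hx
    rw [counit_eq_basisForm, one_eq_basis, basisForm_apply_basis, Module.Basis.coord_apply,
      Module.Basis.repr_self]
    exact Finsupp.single_nonneg.2 zero_le_one _
  mul_nonneg t ht := by
    refine map_mem_nonnegSpan _ (fun p => ?_) ht
    rw [Module.Basis.tensorProduct_apply', LinearMap.mul'_apply, mul_basis]
    exact sum_mem fun w _ => smul_mem_nonnegSpan (structConst_nonneg _ _ _)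
      (basis_mem_nonnegSpan _ w)
  comul_nonneg x hx := by
    refine map_mem_nonnegSpan _ (fun w => ?_) hx
    rw [comul_realAlg_basis]
    refine sum_mem fun p _ => sum_mem fun u _ => sum_mem fun v _ =>
      smul_mem_nonnegSpan (structConst_nonneg _ _ _) ?_
    rw [← Module.Basis.tensorProduct_apply]
    exact basis_mem_nonnegSpan _ (u, v)
  unit_adjoint r x := by
    rw [Algebra.algebraMap_eq_smul_one, map_smul, LinearMap.smul_apply, counit_eq_basisForm,
      smul_eq_mul]
  mul_adjoint t x := by
    induction t with
    | zero => simp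
    | add s t hs ht => simp only [map_add, LinearMap.add_apply, hs, ht]
    | tmul a b =>
      rw [basisForm_tensorProduct_tmul, LinearMap.mul'_apply]
      exact (pairForm_realComul a b x).symm

end GradedHopf

/-! ### Integrality of structure constants as an obstruction to descent -/

section Descent

variable {R S : Type*} [CommRing R] [CommRing S] [Algebra R S]

/-- The isomorphism is multiplicative and matches the two bases as sets, so the structure constants
of `Ω` are sums of images of those of `Ψ`. The grading and the comultiplication play no part. -/
theorem repr_mul_mem_range_of_isBaseChangeOf {A κ : Type*} [Ring A] [HopfAlgebra R A]
    {ℬ : ℕ → Submodule R A} {Ψ : Module.Basis κ R A} {H ι : Type*} [Ring H] [HopfAlgebra S H]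
    {𝒜 : ℕ → Submodule S H} {Ω : Module.Basis ι S H} (h : IsBaseChangeOf R S ℬ Ψ 𝒜 Ω) (i j k : ι) :
    Ω.repr (Ω i * Ω j) k ∈ Set.range (algebraMap R S) := by
  classical
  obtain ⟨f, _, hf⟩ := h
  obtain ⟨a, ha⟩ := hf.symm ▸ Set.mem_range_self (f := Ω) i
  obtain ⟨b, hb⟩ := hf.symm ▸ Set.mem_range_self (f := Ω) j
  have e : Ω i * Ω j = ∑ c ∈ (Ψ.repr (Ψ a * Ψ b)).support,
      algebraMap R S (Ψ.repr (Ψ a * Ψ b) c) • f ((1 : S) ⊗ₜ[R] Ψ c) := by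
    rw [← ha, ← hb, ← map_mul, Algebra.TensorProduct.tmul_mul_tmul, one_mul]
    conv_lhs => rw [← Ψ.linearCombination_repr (Ψ a * Ψ b)]
    rw [Finsupp.linearCombination_apply, Finsupp.sum, TensorProduct.tmul_sum, map_sum]
    refine Finset.sum_congr rfl fun c _ => ?_
    rw [TensorProduct.tmul_smul, ← algebraMap_smul S, map_smul]
  rw [e, map_sum, Finsupp.finsetSum_apply]
  refine sum_mem (S := (algebraMap R S).range) fun c _ => ?_
  obtain ⟨l, hl⟩ := hf ▸ Set.mem_range_self (f := fun k => f ((1 : S) ⊗ₜ[R] Ψ k)) c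
  rw [← hl, map_smul, Finsupp.smul_apply, Module.Basis.repr_self, Finsupp.single_apply, smul_eq_mul]
  refine mul_mem ⟨_, rfl⟩ ?_
  split_ifs
  · exact one_mem _
  · exact zero_mem _

theorem not_isDescending_of_irrational {H ι : Type u} [Ring H] [HopfAlgebra ℝ H]
    {𝒜 : ℕ → Submodule ℝ H} {Ω : Module.Basis ι ℝ H} {i j k : ι}
    (h : Irrational (Ω.repr (Ω i * Ω j) k)) : ¬ IsDescending 𝒜 Ω := by
  rintro ⟨A, _, _, ℬ, κ, Ψ, _, hb⟩
  obtain ⟨n, hn⟩ := repr_mul_mem_range_of_isBaseChangeOf hb i j k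
  exact h ⟨n, by simpa using hn⟩

end Descent

/-! ### Trivial characters and the structure constant in degree two -/

section TrivialCharacters

variable {F : Type u} [Field F] [Fintype F] [DecidableEq F]

theorem two_le_card_real : (2 : ℝ) ≤ Fintype.card F := by
  exact_mod_cast Fintype.one_lt_card (α := F)

theorem card_gl (n : ℕ) : Fintype.card (gl F n) = Fintype.card F ^ (n * n) := by
  simp [Matrix, pow_mul]

theorem card_G_one : (Fintype.card (G F 1) : ℝ) = Fintype.card F - 1 := by
  have := Matrix.card_GL_field (𝔽 := F) 1
  rw [Nat.card_eq_fintype_card] at this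
  rw [this]
  have h : 1 ≤ Fintype.card F := Fintype.card_pos
  simp [Nat.cast_sub h]

theorem card_G_two : (Fintype.card (G F 2) : ℝ) =
    ((Fintype.card F : ℝ) ^ 2 - 1) * ((Fintype.card F : ℝ) ^ 2 - Fintype.card F) := by
  have := Matrix.card_GL_field (𝔽 := F) 2
  rw [Nat.card_eq_fintype_card] at this
  have h1 : 1 ≤ Fintype.card F ^ 2 := Nat.one_le_pow _ _ Fintype.card_pos
  have h2 : Fintype.card F ≤ Fintype.card F ^ 2 := Nat.le_self_pow two_ne_zero _
  rw [this, Fin.prod_univ_two]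
  simp [Nat.cast_sub h1, Nat.cast_sub h2]

theorem orbitNormSq_zero (n : ℕ) : orbitNormSq (0 : AddChar (gl F n) ℂ) =
    (Fintype.card (G F n) : ℝ)⁻¹ * (Fintype.card F : ℝ) ^ (n * n) := by
  rw [orbitNormSq, charOrbit_zero, card_gl]
  simp

theorem coe_mkOmega_zero (n : ℕ) : ((mkOmega n 0 : Omega F) : CC F) =
    inDeg F n (((√((Fintype.card (G F n) : ℝ) / (Fintype.card F : ℝ) ^ (n * n)) : ℝ) : ℂ) •
      one F n) := by
  rw [coe_mkOmega, normChar, orbitSum_zero, orbitNormSq_zero, ← Real.sqrt_inv, mul_inv, inv_inv,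
    div_eq_mul_inv]

theorem coe_mkOmega_one_zero : ((mkOmega 1 0 : Omega F) : CC F) =
    inDeg F 1 (((√(((Fintype.card F : ℝ) - 1) / Fintype.card F) : ℝ) : ℂ) • one F 1) := by
  rw [coe_mkOmega_zero, card_G_one, mul_one, pow_one]

theorem coe_mkOmega_two_zero : ((mkOmega 2 0 : Omega F) : CC F) =
    inDeg F 2 (((√((Fintype.card F : ℝ) * ((Fintype.card F : ℝ) - 1) ^ 2 *
      ((Fintype.card F : ℝ) + 1) / (Fintype.card F : ℝ) ^ 4) : ℝ) : ℂ) • one F 2) := by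
  have e : ((Fintype.card F : ℝ) ^ 2 - 1) * ((Fintype.card F : ℝ) ^ 2 - Fintype.card F) =
      Fintype.card F * (Fintype.card F - 1) ^ 2 * (Fintype.card F + 1) := by ring
  rw [coe_mkOmega_zero, card_G_two, e]

theorem hcRes_one {k l n : ℕ} (h : k + l = n) :
    hcRes h (one F n) = boxTimes F k l (one F k ⊗ₜ one F l) := by
  ext ⟨x, y⟩
  rw [boxTimes_tmul]
  change (Fintype.card (Matrix (Fin k) (Fin l) F) : ℂ)⁻¹ *
    ∑ _u : Matrix (Fin k) (Fin l) F, (1 : ℂ) = 1 * 1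
  have hc : (Fintype.card (Matrix (Fin k) (Fin l) F) : ℂ) ≠ 0 := Nat.cast_ne_zero.2 Fintype.card_ne_zero
  rw [Finset.sum_const, Finset.card_univ, nsmul_eq_mul, mul_one, inv_mul_cancel₀ hc, mul_one]

theorem orbitNormSq_mul_inv_sqrt {n : ℕ} (ψ : AddChar (gl F n) ℂ) :
    (√(orbitNormSq ψ))⁻¹ * orbitNormSq ψ = √(orbitNormSq ψ) := by
  have h := Real.sqrt_pos.2 (orbitNormSq_pos ψ)
  rw [inv_mul_eq_iff_eq_mul₀ h.ne', Real.mul_self_sqrt (orbitNormSq_pos ψ).le]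

theorem herm_normChar_zero (n : ℕ) : herm F (normChar (0 : AddChar (gl F n) ℂ)) (one F n) =
    √(orbitNormSq (0 : AddChar (gl F n) ℂ)) := by
  rw [← orbitSum_zero]
  refine ((hermLeft (orbitSum (0 : AddChar (gl F n) ℂ))).map_smul _ _).trans ?_
  change _ * herm F (orbitSum (0 : AddChar (gl F n) ℂ)) (orbitSum 0) = _
  rw [herm_orbitSum_self, ← Complex.ofReal_mul, orbitNormSq_mul_inv_sqrt]

/-- By adjointness the coefficient is the product of `normChar 0 ⊠ normChar 0` with the restriction
of the constant function, which is `1 ⊠ 1`. Only the norms of the three trivial characters enter. -/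
theorem structConst_zero (k l : ℕ) :
    structConst (mkOmega k 0 : Omega F) (mkOmega l 0) (mkOmega (k + l) 0) =
      √(orbitNormSq (0 : AddChar (gl F k) ℂ) * orbitNormSq (0 : AddChar (gl F l) ℂ) /
        orbitNormSq (0 : AddChar (gl F (k + l)) ℂ)) := by
  refine Complex.ofReal_injective ?_
  have e : normChar (0 : AddChar (gl F (k + l)) ℂ) =
      (((√(orbitNormSq (0 : AddChar (gl F (k + l)) ℂ)))⁻¹ : ℝ) : ℂ) • one F (k + l) := by
    rw [normChar, orbitSum_zero]
  rw [coe_structConst, coe_mkOmega, coe_mkOmega, mul_inDeg, omegaCoeff_mkOmega, inDeg_apply_self,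
    e, herm_smul_right, herm_hcInd, hcRes_one, herm₂_boxTimes]
  rw [herm_normChar_zero, herm_normChar_zero, ← Complex.ofReal_mul, ← Complex.ofReal_mul,
    Real.sqrt_div (mul_nonneg (orbitNormSq_pos _).le (orbitNormSq_pos _).le),
    Real.sqrt_mul (orbitNormSq_pos _).le, div_eq_inv_mul]

theorem structConst_one_one_zero :
    structConst (mkOmega 1 0 : Omega F) (mkOmega 1 0) (mkOmega 2 0) =
      √(((Fintype.card F : ℝ) + 1) / Fintype.card F) := by
  refine (structConst_zero 1 1).trans ?_
  have hq := two_le_card_real (F := F)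
  rw [orbitNormSq_zero, orbitNormSq_zero, card_G_one, card_G_two]
  congr 1
  have h1 : (Fintype.card F : ℝ) ≠ 0 := by positivity
  have h2 : (Fintype.card F : ℝ) - 1 ≠ 0 := by linarith
  have h3 : (Fintype.card F : ℝ) + 1 ≠ 0 := by positivity
  have e : ((Fintype.card F : ℝ) ^ 2 - 1) * ((Fintype.card F : ℝ) ^ 2 - Fintype.card F) =
      Fintype.card F * (Fintype.card F - 1) ^ 2 * (Fintype.card F + 1) := by ring
  norm_num [e]
  field_simp

end TrivialCharacters

/-- The number is `√(q(q+1)) / q`, and `q² < q(q+1) < (q+1)²` excludes a perfect square under the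
root. -/
theorem irrational_sqrt_succ_div {q : ℕ} (hq : q ≠ 0) : Irrational √(((q : ℝ) + 1) / q) := by
  have h : ¬ IsSquare (q * (q + 1)) := by
    rintro ⟨r, hr⟩
    have h1 : q < r := by nlinarith [Nat.pos_of_ne_zero hq]
    nlinarith
  have h0 : (q : ℝ) ≠ 0 := Nat.cast_ne_zero.2 hq
  have e : √(((q : ℝ) + 1) / q) = √((q * (q + 1) : ℕ) : ℝ) / (q : ℕ) := by
    rw [← Real.sqrt_sq (Nat.cast_nonneg q : (0 : ℝ) ≤ (q : ℕ)), ← Real.sqrt_div (by positivity),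
      Real.sqrt_sq (Nat.cast_nonneg q)]
    congr 1
    push_cast
    field_simp
  rw [e]
  exact (irrational_sqrt_natCast_iff.2 h).div_natCast hq

end InvFun

/-! ### The main theorem -/

open InvFun in
theorem mainTheorem1 (F : Type u) [Field F] [Fintype F] [DecidableEq F] :
    ∃ (H : Type u) (_ : Ring H) (_ : HopfAlgebra ℝ H) (j : H →ₗ[ℝ] CC F)
      (Ω : Module.Basis (Omega F) ℝ H),
      IsRestriction F j ∧ (∀ w : Omega F, j (Ω w) = w) ∧
      IsPSHAlgebra ℝ (fun n => (realSpanDeg F n).comap j) Ω ∧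
      ¬ IsDescending (fun n => (realSpanDeg F n).comap j) Ω ∧
      ∃ f h : Omega F,
        (f : CC F) = inDeg F 1 (((√(((Fintype.card F : ℝ) - 1) / Fintype.card F) : ℝ) : ℂ) •
          one F 1) ∧
        (h : CC F) = inDeg F 2 (((√((Fintype.card F : ℝ) * ((Fintype.card F : ℝ) - 1) ^ 2 *
          ((Fintype.card F : ℝ) + 1) / (Fintype.card F : ℝ) ^ 4) : ℝ) : ℂ) • one F 2) ∧
        Ω.repr (Ω f * Ω f) h = √(((Fintype.card F : ℝ) + 1) / Fintype.card F) ∧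
        Irrational √(((Fintype.card F : ℝ) + 1) / Fintype.card F) := by
  have hc : (omegaBasis F).repr (omegaBasis F (mkOmega 1 0) * omegaBasis F (mkOmega 1 0))
      (mkOmega 2 0) = √(((Fintype.card F : ℝ) + 1) / Fintype.card F) := by
    rw [repr_mul_basis, structConst_one_one_zero]
  have hi : Irrational √(((Fintype.card F : ℝ) + 1) / Fintype.card F) :=
    irrational_sqrt_succ_div Fintype.card_ne_zero
  refine ⟨RealAlg F, inferInstance, inferInstance, realIncl F, omegaBasis F,
    isRestriction_realIncl, fun w => by rw [omegaBasis_apply, realIncl_omegaElt], ?_, ?_,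
    mkOmega 1 0, mkOmega 2 0, coe_mkOmega_one_zero, coe_mkOmega_two_zero, hc, hi⟩
  · simp only [comap_realSpanDeg]
    exact isPSHAlgebra_realAlg
  · exact not_isDescending_of_irrational (hc ▸ hi)
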